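/- **Theorem (Embedding in a flow).** Let $f$ be an antiholomorphic parabolic germ at $0\in\mathbb C$, i.e. a germ of antiholomorphic map with $f(0)=0$, $|\partial f/\partial\bar z(0)|=1$, for which $0$ is an isolated fixed point. Let $k\ge 1$ be its codimension: $f$ is formally conjugate to a series $\bar w+\sum_{n\ge k+1}A_n\bar w^n$ with real coefficients and $A_{k+1}\neq 0$; if $k$ is even, assume that $f$ is of positive type, i.e. $A_{k+1}>0$. Let $b\in\mathbb R$ be its formal invariant: $f\circ f$ is analytically conjugate to a germ $z+z^{k+1}+\left(\frac{k+1}2-b\right)z^{2k+1}+o(z^{2k+1})$. Let $v^{t}$ be the time-$t$ map of $\dot z=z^{k+1}/(1+bz^k)$ and $\sigma(z)=\bar z$. Transition functions of $f$ are defined as follows. Choose a holomorphic change of coordinate in which $f$ is prenormalized, $f(z)=\bar z+\frac12\bar z^{k+1}+\left(\frac{k+1}8-\frac b2\right)\bar z^{2k+1}+o(\bar z^{2k+1})$. For $-k\le j\le k$ put $Z_j(z)=-\frac1{kz^k}+b\,\mathrm{Log}(e^{-ij\pi/k}z)$ on $|\mathrm{Arg}(e^{-ij\pi/k}z)|<\pi/k$;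 for $r>0$ small and $R$ large, $Z_j$ maps a domain $S_j\subset\{0<|z|<r\}$ (a petal) bijectively onto $U_j=\{|\mathrm{Im}\,W|>R\}\cup\{(-1)^{j+1}\mathrm{Re}\,W>R\}$. Fatou coordinates of $f$ are injective holomorphic maps $\Phi_j:U_j\to\mathbb C$, $-k\le j\le k$, with $\Phi_{-k}=\Phi_k$, such that $\Phi_j\circ Z_j\circ f=\overline{\Phi_{-j}\circ Z_{-j}}+\frac12$ at every point of $S_{-j}$ that $f$ sends into $S_j$. Identifying points of $U_j$ and $U_{j-\mathrm{sgn}\, j}$ that come from the same point $z\in S_j\cap S_{j-\mathrm{sgn}\, j}$ between the directions $j\pi/k$ and $(j-\mathrm{sgn}\, j)\pi/k$, the corresponding transition functions are, for $j=\pm1,\dots,\pm k$, $\Psi_j=\Phi_j\circ\Phi_{j-\mathrm{sgn}\, j}^{-1}$ if $j$ is odd and $\Psi_j=\Phi_{j-\mathrm{sgn}\, j}\circ\Phi_j^{-1}$ if $j$ is even. Then $f$ admits such Fatou coordinates, and for every choice of them (and of the prenormalizing coordinate, $r$ and $R$) the following are equivalent: 1. $f$ is analytically conjugate to its formal normal form: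 there is a germ of holomorphic diffeomorphism $h$ fixing $0$ with $f=h\circ\sigma\circ v^{1/2}\circ h^{-1}$; 2. all the transition functions $\Psi_j$, $j=\pm1,\dots,\pm k$, are translations. -/

import Mathlib

open Filter Topology Asymptotics ComplexConjugate

noncomputable section

namespace AntiParabolic

/-! ## Germs at the origin

A germ at `0 : ℂ` is given by a representative `ℂ → ℂ`; every notion below except the
petals only sees the representative near `0`. -/

/-- `f` is (a representative of) an antiholomorphic parabolic germ at the origin:
`f ∘ conj` is holomorphic near `0`, `0` is an isolated fixed point of `f`, and
`|∂f/∂z̄ (0)| = 1`. -/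
structure IsParabolicGerm (f : ℂ → ℂ) : Prop where
  antiholomorphic : AnalyticAt ℂ (fun z => f (conj z)) 0
  map_zero : f 0 = 0
  norm_deriv : ‖deriv (fun z => f (conj z)) 0‖ = 1
  isolated : ∀ᶠ z in 𝓝[≠] (0 : ℂ), f z ≠ z

/-- `h` is a germ of holomorphic diffeomorphism fixing the origin. -/
structure IsHolomorphicDiffeo (h : ℂ → ℂ) : Prop where
  analyticAt : AnalyticAt ℂ h 0
  map_zero : h 0 = 0
  deriv_ne_zero : deriv h 0 ≠ 0

/-- The germ of holomorphic diffeomorphism `h` conjugates the germ `f₁` to the germ `f₂`,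
i.e. `f₂ = h ∘ f₁ ∘ h⁻¹` near the origin. -/
def Conjugates (h f₁ f₂ : ℂ → ℂ) : Prop :=
  IsHolomorphicDiffeo h ∧ ∀ᶠ z in 𝓝 (0 : ℂ), h (f₁ z) = f₂ (h z)

/-- Two germs are analytically conjugate. -/
def AnalyticallyConjugate (f₁ f₂ : ℂ → ℂ) : Prop :=
  ∃ h, Conjugates h f₁ f₂

/-! ## Codimension, type and formal invariant -/

/-- The power series `∑ aₙ Xⁿ` such that `f(z) = ∑ aₙ z̄ⁿ`. -/
def conjSeries (f : ℂ → ℂ) : PowerSeries ℂ :=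
  PowerSeries.mk fun n => iteratedDeriv n (fun z => f (conj z)) 0 / (n.factorial : ℂ)

/-- The antiholomorphic germ `f` is formally conjugate to the formal series
`w̄ + ∑_{n ≥ 2} Aₙ w̄ⁿ` with real coefficients. If `H` is the formal change of coordinate,
the equality `H ∘ f = A ∘ H` reads, as an equality of series in `z̄`,
`H (F (z̄)) = A (H̄ (z̄))`, where `F` is the series of `f` and `H̄` has the conjugate
coefficients of `H`. -/
def IsRealFormalForm (f : ℂ → ℂ) (A : PowerSeries ℝ) : Prop :=
  PowerSeries.coeff 0 A = 0 ∧ PowerSeries.coeff 1 A = 1 ∧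
  ∃ H : PowerSeries ℂ, PowerSeries.coeff 0 H = 0 ∧ PowerSeries.coeff 1 H ≠ 0 ∧
    PowerSeries.subst (conjSeries f) H =
      PowerSeries.subst (PowerSeries.map (starRingEnd ℂ) H)
        (PowerSeries.map Complex.ofRealHom A)

/-- The first nonlinear term of `A = X + ⋯` is of order `k + 1`. -/
def FirstNonlinear (A : PowerSeries ℝ) (k : ℕ) : Prop :=
  1 ≤ k ∧ (∀ n, 2 ≤ n → n ≤ k → PowerSeries.coeff n A = 0) ∧ PowerSeries.coeff (k + 1) A ≠ 0

/-- `f` is of codimension `k`. -/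
def HasCodimension (f : ℂ → ℂ) (k : ℕ) : Prop :=
  ∃ A, IsRealFormalForm f A ∧ FirstNonlinear A k

/-- The germ `f` of codimension `k` is of positive type (a notion used when `k` is even). -/
def IsPositiveType (f : ℂ → ℂ) (k : ℕ) : Prop :=
  ∃ A, IsRealFormalForm f A ∧ FirstNonlinear A k ∧ 0 < PowerSeries.coeff (k + 1) A

/-- `b` is the formal invariant of the antiholomorphic germ `f` of codimension `k`: an
analytic change of coordinate brings the holomorphic germ `f ∘ f` to the form
`z + z^(k+1) + ((k+1)/2 - b) z^(2k+1) + o(z^(2k+1))`. -/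
def HasFormalInvariant (f : ℂ → ℂ) (k : ℕ) (b : ℝ) : Prop :=
  ∃ h G : ℂ → ℂ, Conjugates h (fun z => f (f z)) G ∧
    (fun z => G z - (z + z ^ (k + 1) + (((k : ℂ) + 1) / 2 - b) * z ^ (2 * k + 1)))
      =o[𝓝 0] fun z => z ^ (2 * k + 1)

/-! ## The formal normal form -/

/-- The vector field `v(z) = z^(k+1) / (1 + b z^k)`. -/
def field (k : ℕ) (b : ℝ) (z : ℂ) : ℂ := z ^ (k + 1) / (1 + b * z ^ k)

/-- `φ` is, as a germ at the origin, the time-`t` map `v^t` of the flow of `ż = v(z)`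
(`t ≥ 0`): for `z` near `0` an integral curve of `v`, avoiding the poles of `v`, runs from
`z` to `φ z` in time `t`. -/
def IsTimeMap (k : ℕ) (b t : ℝ) (φ : ℂ → ℂ) : Prop :=
  ∀ᶠ z in 𝓝 (0 : ℂ), ∃ γ : ℝ → ℂ, γ 0 = z ∧ γ t = φ z ∧
    (∀ s ∈ Set.Icc 0 t, 1 + (b : ℂ) * γ s ^ k ≠ 0) ∧
    IsIntegralCurveOn γ (fun _ => field k b) (Set.Icc 0 t)

/-- `f` is analytically conjugate to the formal normal form `σ ∘ v^{1/2}`, where `σ` is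
the complex conjugation. -/
def IsConjugateToNormalForm (f : ℂ → ℂ) (k : ℕ) (b : ℝ) : Prop :=
  ∃ φ : ℂ → ℂ, IsTimeMap k b (1 / 2) φ ∧ AnalyticallyConjugate f (fun z => conj (φ z))

/-- `f` is prenormalized: it has the same first three terms as `σ ∘ v^{1/2}`. -/
def IsPrenormalized (f : ℂ → ℂ) (k : ℕ) (b : ℝ) : Prop :=
  (fun z => f z - (conj z + 1 / 2 * conj z ^ (k + 1)
      + (((k : ℂ) + 1) / 8 - b / 2) * conj z ^ (2 * k + 1)))
    =o[𝓝 0] fun z => z ^ (2 * k + 1)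

/-! ## Time coordinate and petals

The petals are indexed by `j = -k, …, k`; the `j`-th one is centred on the direction
`arg z = jπ/k`, is repelling for `j` even and attracting for `j` odd, and the `k`-th and the
`(-k)`-th ones are the same. -/

/-- The rotation by `-θπ/k`. -/
def rot (k : ℕ) (θ : ℝ) (z : ℂ) : ℂ := Complex.exp (-(θ * Real.pi / k : ℝ) * Complex.I) * z

/-- The `j`-th chart of the time coordinate,
`Z_j(z) = -1/(k z^k) + b log z - jiπb/k` for `|arg z - jπ/k| < π/k`. With the principal
logarithm, `log z - jiπ/k = Log (e^{-ijπ/k} z)` there. -/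
def Z (k : ℕ) (b : ℝ) (j : ℤ) (z : ℂ) : ℂ :=
  -1 / (k * z ^ k) + b * Complex.log (rot k j z)

/-- The petal `U_j` in the time coordinate: the union of the upper half-plane `Im W > R`,
of the lower half-plane `Im W < -R`, and of the half-plane `Re W < -R` for `j` even
(repelling petal), `Re W > R` for `j` odd (attracting petal). -/
def U (R : ℝ) (j : ℤ) : Set ℂ :=
  {W | R < |W.im| ∨ (Even j ∧ W.re < -R) ∨ (Odd j ∧ R < W.re)}

/-- The petal `S_j` in the `z`-coordinate, inside the disk of radius `r`. -/
def S (k : ℕ) (b r R : ℝ) (j : ℤ) : Set ℂ :=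
  {z | z ≠ 0 ∧ ‖z‖ < r ∧ |Complex.arg (rot k j z)| < Real.pi / k ∧ Z k b j z ∈ U R j}

/-- The part of `S_j ∩ S_{j - sgn j}` lying between the central directions `jπ/k` and
`(j - sgn j)π/k` of the two petals. (For `k = 1` the two petals have a second
intersection, on the other side.) -/
def overlap (k : ℕ) (b r R : ℝ) (j : ℤ) : Set ℂ :=
  {z | z ∈ S k b r R j ∧ z ∈ S k b r R (j - j.sign) ∧
    |Complex.arg (rot k (j - (j.sign : ℝ) / 2) z)| < Real.pi / (2 * k)}

/-! ## Fatou coordinates and transition functions -/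

/-- A choice of Fatou coordinates for the germ `f` of codimension `k` and formal
invariant `b`: a prenormalizing coordinate, sufficiently small petals, and, in that
coordinate, holomorphic diffeomorphisms `Φ_j` from `U_j` onto their images satisfying
`Φ_j ∘ F ∘ Φ_{-j}⁻¹ = Σ ∘ T_{1/2}`, where `F` is the expression of the germ in the time
coordinate and `Σ ∘ T_{1/2} : W ↦ conj W + 1/2`. -/
structure FatouCoordinates (f : ℂ → ℂ) (k : ℕ) (b : ℝ) where
  /-- a prenormalized germ, analytically conjugate to `f` -/
  g : ℂ → ℂ
  /-- the prenormalizing change of coordinate -/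
  p : ℂ → ℂ
  conj_p : Conjugates p f g
  prenormalized : IsPrenormalized g k b
  /-- size of the petals in the `z`-coordinate -/
  r : ℝ
  /-- size of the petals in the time coordinate -/
  R : ℝ
  r_pos : 0 < r
  antiholomorphic : DifferentiableOn ℂ (fun z => g (conj z)) (Metric.ball 0 r)
  injective : Set.InjOn g (Metric.ball 0 r)
  lt_R : 2 * Real.pi * |b| / k < R
  time_bijOn : ∀ j : ℤ, |j| ≤ k → Set.BijOn (Z k b j) (S k b r R j) (U R j)
  /-- the Fatou coordinates -/
  Φ : ℤ → ℂ → ℂ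
  Φ_holomorphic : ∀ j : ℤ, |j| ≤ k → DifferentiableOn ℂ (Φ j) (U R j)
  Φ_injective : ∀ j : ℤ, |j| ≤ k → Set.InjOn (Φ j) (U R j)
  Φ_last : Set.EqOn (Φ (-(k : ℤ))) (Φ k) (U R k)
  Φ_map : ∀ j : ℤ, |j| ≤ k → ∀ z ∈ S k b r R (-j), g z ∈ S k b r R j →
    Φ j (Z k b j (g z)) = conj (Φ (-j) (Z k b (-j) z)) + 1 / 2

namespace FatouCoordinates

variable {f : ℂ → ℂ} {k : ℕ} {b : ℝ}

/-- The Fatou coordinate `Φ_j` read on the petal `S_j`. -/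
def onPetal (T : FatouCoordinates f k b) (j : ℤ) (z : ℂ) : ℂ := T.Φ j (Z k b j z)

/-- The index of the source petal of the transition function `Ψ_j`, which is always the
repelling one. -/
def source (j : ℤ) : ℤ := if Odd j then j - j.sign else j

/-- The index of the target petal of the transition function `Ψ_j`, which is always the
attracting one. -/
def target (j : ℤ) : ℤ := if Odd j then j else j - j.sign

/-- The domain of `Ψ_j`: the image of the overlap of the two petals. -/
def transitionDomain (T : FatouCoordinates f k b) (j : ℤ) : Set ℂ :=
  T.onPetal (source j) '' overlap k b T.r T.R j

/-- The transition function `Ψ_j`, for `j = ±1, …, ±k`: it is `Φ_j ∘ Φ_{j - sgn j}⁻¹` for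
`j` odd and `Φ_{j - sgn j} ∘ Φ_j⁻¹` for `j` even. Its values are meaningful on
`transitionDomain`. -/
def transition (T : FatouCoordinates f k b) (j : ℤ) (W : ℂ) : ℂ :=
  T.onPetal (target j)
    (Function.invFunOn (T.onPetal (source j)) (overlap k b T.r T.R j) W)

/-- All the transition functions `Ψ_j`, `j = ±1, …, ±k`, are translations. -/
def TransitionsAreTranslations (T : FatouCoordinates f k b) : Prop :=
  ∀ j : ℤ, j ≠ 0 → |j| ≤ k →
    ∃ C : ℂ, ∀ W ∈ T.transitionDomain j, T.transition j W = W + C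

end FatouCoordinates

end AntiParabolic

end

/-!
# Fatou coordinates and the formal normal form of antiholomorphic parabolic germs

*Prenormalization.* Truncating the formal conjugation between `f` and a real series gives a
polynomial change of coordinate bringing `f` to a real polynomial in `conj z`, up to terms of high
order (`exists_polynomial_conjugation`). Real polynomial changes of coordinate reduce it further to
`w + w ^ (k + 1) / 2 + B * w ^ (2 k + 1)`, where `w = conj z`; this is where the positive type is
used for even `k`, since the linear part must have a real `k`-th root
(`exists_normalizing_polynomial`). The value of `B` follows from the formal invariant, because the
coefficient of `z ^ (2 k + 1)` in `f ∘ f` is invariant (`coeff_eq_of_conjugate`, a residue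
argument). See `exists_isPrenormalized`.

*Existence of Fatou coordinates.* In the time coordinate of a petal, `f` is `W ↦ conj W + 1 / 2` up
to an error of order `|W| ^ (-1 - 1 / k)`, so that `f ∘ f`, or its inverse on the repelling petals,
is a unit translation up to an error summable along orbits. The Fatou coordinate is the limit of
`F^[n] X - n` (`NearTranslation.exists_isNormalizedFatou`). The relation between the coordinates of
the petals `j` and `-j` passes to the limit (`LocalDynamics.nonempty_fatouCoordinates`).

*Uniqueness.* A holomorphic function on a petal which turns the dynamics into the unit translation,
and which is injective or of linear growth, is the Fatou coordinate up to a constant: compared with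
it, the function extends to an entire function, which is affine
(`IsNormalizedFatou.eq_add_const`). This reduces an arbitrary choice of Fatou coordinates to the
normalized ones, which are asymptotic to the time coordinates.

*Translations imply the normal form.* If the transition functions are translations, the differences
between Fatou and time coordinates on the various petals differ by constants on the overlaps. As
they have limits at the origin, the constants match all around it, and the differences glue to a
function `δ` holomorphic at the origin. The flow of the normal form during the complex time `δ(z)`
is then a germ of diffeomorphism conjugating `f` to `σ ∘ v^{1/2}`
(`FatouCoordinates.isConjugateToNormalForm_of_translations`).

*The normal form implies translations.* If `H` conjugates the germ to the normal form, the time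
coordinate of `H z` conjugates the dynamics to translations and has linear growth in every petal.
By uniqueness it is the Fatou coordinate up to a constant. The variation of the time coordinate
under `H` is the same function in all the petals, so it cancels in the transition functions, deep
in the overlaps; analytic continuation in the time coordinate, on a connected region, extends this
to the whole overlaps (`FatouCoordinates.translations_of_isConjugateToNormalForm`).
-/

open Filter Topology Asymptotics ComplexConjugate

namespace AntiParabolic

/-! ### Entire functions and holomorphic inverses -/

/-- An entire function of at most linear growth is affine: apply Liouville's theorem to its
difference quotient at the origin. -/
theorem affine_of_linear_growth {f : ℂ → ℂ} (hf : Differentiable ℂ f) {A B : ℝ}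
    (h : ∀ z, ‖f z‖ ≤ A + B * ‖z‖) : ∃ a c : ℂ, ∀ z, f z = a * z + c := by
  have hd : Differentiable ℂ (dslope f 0) := by
    have := (Complex.differentiableOn_dslope (f := f) (s := Set.univ) (c := 0)
      Filter.univ_mem).2 hf.differentiableOn
    exact differentiableOn_univ.1 this
  have hbd : Bornology.IsBounded (Set.range (dslope f 0)) := by
    obtain ⟨M, hM⟩ := (isCompact_closedBall (0 : ℂ) 1).exists_bound_of_continuousOn
      hd.continuous.continuousOn
    refine isBounded_iff_forall_norm_le.2 ⟨max M (|A| + |B| + ‖f 0‖), ?_⟩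
    rintro _ ⟨z, rfl⟩
    by_cases hz : ‖z‖ ≤ 1
    · exact (hM z (by simpa using hz)).trans (le_max_left _ _)
    · push Not at hz
      have hz0 : z ≠ 0 := by rintro rfl; simp at hz; linarith
      refine le_trans ?_ (le_max_right _ _)
      rw [dslope_of_ne _ hz0, slope_def_field, sub_zero, norm_div, div_le_iff₀ (by linarith)]
      calc ‖f z - f 0‖ ≤ ‖f z‖ + ‖f 0‖ := norm_sub_le _ _
        _ ≤ A + B * ‖z‖ + ‖f 0‖ := by gcongr; exact h z
        _ ≤ |A| * ‖z‖ + |B| * ‖z‖ + ‖f 0‖ * ‖z‖ := by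
          gcongr
          · exact (le_abs_self A).trans (le_mul_of_one_le_right (abs_nonneg _) hz.le)
          · exact le_abs_self B
          · exact le_mul_of_one_le_right (norm_nonneg _) hz.le
        _ = _ := by ring
  obtain ⟨a, ha⟩ := hd.exists_const_forall_eq_of_bounded hbd
  refine ⟨a, f 0, fun z => ?_⟩
  have := sub_smul_dslope f 0 z
  rw [ha, sub_zero, smul_eq_mul] at this
  linear_combination -this

/-- An injective entire function is affine. Near infinity `f` stays away from `f c`, by
injectivity and the open mapping theorem, so `(z - c) / (f z - f c)` is an entire function of linear
growth without zeros. -/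
theorem affine_of_injective {f : ℂ → ℂ} (hf : Differentiable ℂ f)
    (hinj : Function.Injective f) : ∃ a c : ℂ, ∀ z, f z = a * z + c := by
  obtain ⟨c, hc⟩ : ∃ c, deriv f c ≠ 0 := by
    by_contra! hcon
    have := is_const_of_deriv_eq_zero hf hcon 0 1
    exact zero_ne_one (hinj this)
  have hd : Differentiable ℂ (dslope f c) := by
    have := (Complex.differentiableOn_dslope (f := f) (s := Set.univ) (c := c)
      Filter.univ_mem).2 hf.differentiableOn
    exact differentiableOn_univ.1 this
  have hne : ∀ z, dslope f c z ≠ 0 := by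
    intro z
    by_cases hz : z = c
    · subst hz; rwa [dslope_same]
    · rw [dslope_of_ne _ hz, slope_def_field]
      exact div_ne_zero (sub_ne_zero.2 fun h => hz (hinj h)) (sub_ne_zero.2 hz)
  have hnhds : 𝓝 (f c) ≤ map f (𝓝 c) := by
    rcases (hf.analyticAt c).eventually_constant_or_nhds_le_map_nhds with h | h
    · exact absurd ((Filter.EventuallyEq.deriv_eq h).trans (deriv_const c (f c))) hc
    · exact h
  obtain ⟨ε, hε, hball⟩ : ∃ ε > 0, Metric.ball (f c) ε ⊆ f '' Metric.ball c 1 :=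
    Metric.mem_nhds_iff.1 (hnhds (image_mem_map (Metric.ball_mem_nhds c one_pos)))
  -- the open image of the unit disc around `c` is not attained again outside of it
  have hfar : ∀ z, 1 ≤ ‖z - c‖ → ε ≤ ‖f z - f c‖ := by
    intro z hz
    by_contra! hlt
    obtain ⟨w, hw, hwz⟩ := hball (by simpa [dist_eq_norm] using hlt : f z ∈ Metric.ball (f c) ε)
    rw [hinj hwz] at hw
    rw [Metric.mem_ball, dist_eq_norm] at hw
    linarith
  set g : ℂ → ℂ := fun z => (dslope f c z)⁻¹ with hg
  have hgd : Differentiable ℂ g := fun z => (hd z).inv (hne z)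
  obtain ⟨M, hM⟩ := (isCompact_closedBall c 1).exists_bound_of_continuousOn
    hgd.continuous.continuousOn
  obtain ⟨a, e, hae⟩ := affine_of_linear_growth hgd (A := |M| + ‖c‖ / ε) (B := ε⁻¹) (by
    intro z
    by_cases hz : ‖z - c‖ ≤ 1
    · have := hM z (by simpa [dist_eq_norm] using hz)
      have h2 : 0 ≤ ‖c‖ / ε := by positivity
      have h3 : 0 ≤ ε⁻¹ * ‖z‖ := by positivity
      linarith [le_abs_self M]
    · push Not at hz
      have hzc : z ≠ c := by rintro rfl; simp at hz; linarith
      have h1 := hfar z hz.le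
      simp only [hg]
      rw [dslope_of_ne _ hzc, slope_def_field, inv_div, norm_div]
      calc ‖z - c‖ / ‖f z - f c‖ ≤ (‖z‖ + ‖c‖) / ε := by
            gcongr; exact norm_sub_le _ _
        _ = ‖c‖ / ε + ε⁻¹ * ‖z‖ := by field_simp; ring
        _ ≤ _ := by linarith [abs_nonneg M])
  -- `g` has no zeros, hence is constant
  have ha : a = 0 := by
    by_contra ha
    have h1 := hae (-e / a)
    rw [mul_div_cancel₀ _ ha, neg_add_cancel] at h1
    exact hne _ (inv_eq_zero.1 h1)
  refine ⟨e⁻¹, f c - e⁻¹ * c, fun z => ?_⟩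
  have h1 : dslope f c z = e⁻¹ := by
    rw [← inv_inv (dslope f c z)]
    have := hae z
    simp only [hg, ha, zero_mul, zero_add] at this
    rw [this]
  have := sub_smul_dslope f c z
  rw [h1, smul_eq_mul] at this
  linear_combination -this

/-- A holomorphic function `P` on a half-plane `Re X > ρ` commuting with the unit translation is
the restriction of an entire function commuting with it. -/
theorem exists_entire_extension {P : ℂ → ℂ} {ρ : ℝ} (hP : DifferentiableOn ℂ P {X | ρ < X.re})
    (hT : ∀ X, ρ < X.re → P (X + 1) = P X + 1) :
    ∃ H : ℂ → ℂ, Differentiable ℂ H ∧ (∀ (X : ℂ) (n : ℕ), ρ < X.re + n → H X = P (X + n) - n) := by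
  have key : ∀ (X : ℂ), ρ < X.re → ∀ n : ℕ, P (X + n) = P X + n := by
    intro X hX n
    induction n with
    | zero => simp
    | succ n ih =>
      have := hT (X + n) (by simp; linarith [(Nat.cast_nonneg n : (0 : ℝ) ≤ n)])
      push_cast
      rw [← add_assoc, this, ih]; ring
  have hN : ∀ X : ℂ, ρ < X.re + ⌈|ρ - X.re| + 1⌉₊ := by
    intro X
    have := Nat.le_ceil (|ρ - X.re| + 1)
    linarith [le_abs_self (ρ - X.re)]
  -- `P (X + n) - n` does not depend on the choice of `n`
  have hval : ∀ (X : ℂ) (n : ℕ), ρ < X.re + n →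
      P (X + ⌈|ρ - X.re| + 1⌉₊) - ⌈|ρ - X.re| + 1⌉₊ = P (X + n) - n := by
    intro X n hn
    generalize hm : ⌈|ρ - X.re| + 1⌉₊ = m
    have hm' : ρ < X.re + m := hm ▸ hN X
    have h1 := key (X + n) (by simpa using hn) m
    have h2 := key (X + m) (by simpa using hm') n
    rw [add_right_comm] at h2
    rw [h1] at h2
    linear_combination -h2
  refine ⟨fun X => P (X + ⌈|ρ - X.re| + 1⌉₊) - ⌈|ρ - X.re| + 1⌉₊, fun X => ?_, hval⟩
  set n := ⌈|ρ - X.re| + 1⌉₊ with hn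
  have hev : ∀ᶠ Y in 𝓝 X, ρ < Y.re + n :=
    (isOpen_lt continuous_const (by fun_prop : Continuous fun Y : ℂ => Y.re + n)).mem_nhds (hN X)
  have hop : IsOpen {X : ℂ | ρ < X.re} := isOpen_lt continuous_const Complex.continuous_re
  have h1 : DifferentiableAt ℂ (fun Y => P (Y + n) - n) X := by
    have h2 : DifferentiableAt ℂ P (X + n) :=
      hP.differentiableAt (hop.mem_nhds (by simpa using hN X))
    exact (h2.comp X (by fun_prop : DifferentiableAt ℂ (fun Y : ℂ => Y + n) X)).sub_const _
  exact h1.congr_of_eventuallyEq (hev.mono fun Y hY => hval Y n hY)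

/-- Inversion of a perturbation `x ↦ x + e x` of the identity on a closed set `K`, by the
contraction principle. -/
theorem exists_add_eq_of_contracting {K : Set ℂ} (hK : IsClosed K) (hne : K.Nonempty)
    {e : ℂ → ℂ} (he : ∀ x ∈ K, ∀ y ∈ K, ‖e x - e y‖ ≤ 1 / 2 * ‖x - y‖) {Y : ℂ}
    (hmaps : ∀ x ∈ K, Y - e x ∈ K) : ∃ x ∈ K, x + e x = Y := by
  have hm : Set.MapsTo (fun x => Y - e x) K K := hmaps
  have hc : ContractingWith (1 / 2) (hm.restrict _ K K) := by
    refine ⟨by rw [← NNReal.coe_lt_coe]; norm_num, LipschitzWith.of_dist_le_mul fun x y => ?_⟩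
    have := he x x.2 y y.2
    simp only [Subtype.dist_eq, Set.MapsTo.val_restrict_apply, dist_eq_norm]
    rw [sub_sub_sub_cancel_left, norm_sub_rev]
    simpa using this
  obtain ⟨x₀, hx₀⟩ := hne
  obtain ⟨x, hx, hfix, -⟩ := hc.exists_fixedPoint' hK.isComplete hm hx₀ (edist_ne_top _ _)
  refine ⟨x, hx, ?_⟩
  have : Y - e x = x := hfix
  linear_combination -this

theorem injOn_add_of_contracting {K : Set ℂ} {e : ℂ → ℂ}
    (he : ∀ x ∈ K, ∀ y ∈ K, ‖e x - e y‖ ≤ 1 / 2 * ‖x - y‖) :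
    Set.InjOn (fun x => x + e x) K := by
  intro x hx y hy hxy
  have h1 := he x hx y hy
  have h2 : e x - e y = -(x - y) := by
    have : x + e x = y + e y := hxy
    linear_combination this
  rw [h2, norm_neg] at h1
  have : ‖x - y‖ = 0 := by linarith [norm_nonneg (x - y)]
  exact sub_eq_zero.1 (norm_eq_zero.1 this)

/-- The inverse of an injective holomorphic function with non-vanishing derivative is
holomorphic. -/
theorem differentiableAt_invFunOn {f : ℂ → ℂ} {S : Set ℂ} (hS : IsOpen S)
    (hf : DifferentiableOn ℂ f S) (hinj : Set.InjOn f S) {z : ℂ} (hz : z ∈ S)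
    (hd : deriv f z ≠ 0) : DifferentiableAt ℂ (Function.invFunOn f S) (f z) := by
  have ha : AnalyticAt ℂ f z := hf.analyticAt (hS.mem_nhds hz)
  have hs : HasStrictDerivAt f (deriv f z) z := ha.hasStrictDerivAt
  have h1 : ∀ᶠ x in 𝓝 z, Function.invFunOn f S (f x) = x := by
    filter_upwards [hS.mem_nhds hz] with x hx
    exact hinj.leftInvOn_invFunOn hx
  exact (hs.to_local_left_inverse hd h1).hasDerivAt.differentiableAt

/-! ### The model petal and near-translations -/

/-- The attracting petal in the time coordinate. The repelling one is its image under
`X ↦ -X`. -/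
def basicPetal (R : ℝ) : Set ℂ := {X | R < |X.im| ∨ R < X.re}

theorem isOpen_basicPetal (R : ℝ) : IsOpen (basicPetal R) :=
  (isOpen_lt continuous_const (by fun_prop : Continuous fun X : ℂ => |X.im|)).union
    (isOpen_lt continuous_const Complex.continuous_re)

theorem basicPetal_anti {R R' : ℝ} (h : R ≤ R') : basicPetal R' ⊆ basicPetal R := by
  rintro X (hX | hX)
  · exact Or.inl (h.trans_lt hX)
  · exact Or.inr (h.trans_lt hX)

theorem isPreconnected_basicPetal (R : ℝ) : IsPreconnected (basicPetal R) := by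
  have h1 : IsPreconnected {X : ℂ | R < X.im} := (convex_halfSpace_im_gt R).isPreconnected
  have h2 : IsPreconnected {X : ℂ | R < X.re} := (convex_halfSpace_re_gt R).isPreconnected
  have h3 : IsPreconnected {X : ℂ | X.im < -R} := (convex_halfSpace_im_lt (-R)).isPreconnected
  have h12 := IsPreconnected.union (⟨R + 1, R + 1⟩ : ℂ) (by simp) (by simp) h1 h2
  have h123 := IsPreconnected.union (⟨R + 1, -R - 1⟩ : ℂ) (Or.inr (by simp))
    (by simp) h12 h3
  convert h123 using 1
  ext X
  simp only [basicPetal, Set.mem_ofPred_eq, Set.mem_union, lt_abs]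
  constructor
  · rintro ((h | h) | h)
    · exact Or.inl (Or.inl h)
    · exact Or.inr (by linarith)
    · exact Or.inl (Or.inr h)
  · rintro ((h | h) | h)
    · exact Or.inl (Or.inl h)
    · exact Or.inr h
    · exact Or.inl (Or.inr (by linarith))

theorem lt_norm_of_mem_basicPetal {R : ℝ} {X : ℂ} (h : X ∈ basicPetal R) : R < ‖X‖ := by
  rcases h with h | h
  · exact h.trans_le (Complex.abs_im_le_norm X)
  · exact h.trans_le (Complex.re_le_norm X)

theorem mem_basicPetal_of_near {R d : ℝ} {X Y : ℂ} (h : X ∈ basicPetal R) (hd : ‖Y - X‖ ≤ d) :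
    Y ∈ basicPetal (R - d) := by
  have h1 := (Complex.abs_im_le_norm (Y - X)).trans hd
  have h2 := (Complex.abs_re_le_norm (Y - X)).trans hd
  rw [Complex.sub_im] at h1
  rw [Complex.sub_re, abs_le] at h2
  rcases h with h | h
  · left
    have := abs_sub_abs_le_abs_sub X.im Y.im
    rw [abs_sub_comm] at this
    linarith
  · right; linarith

theorem add_natCast_mem_basicPetal {R : ℝ} {X : ℂ} (h : X ∈ basicPetal R) (n : ℕ) :
    X + n ∈ basicPetal R := by
  rcases h with h | h
  · left; simpa using h
  · right
    simp only [Complex.add_re, Complex.natCast_re]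
    linarith [(Nat.cast_nonneg n : (0 : ℝ) ≤ n)]

/-- `F` is holomorphic and injective on a petal, and is the unit translation up to an error
which is summable along orbits (`s > 1`). -/
structure NearTranslation (F : ℂ → ℂ) (R₀ s C : ℝ) : Prop where
  one_lt : 1 < s
  nonneg : 0 ≤ C
  holomorphic : DifferentiableOn ℂ F (basicPetal R₀)
  injOn : Set.InjOn F (basicPetal R₀)
  bound : ∀ X ∈ basicPetal R₀, ‖F X - X - 1‖ ≤ C * ‖X‖ ^ (-s)

/-- The majorant of `‖Y‖ ^ (-s)` for `Y` close to a point of the petal of size `R` whose real part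
has integer part `n`. -/
noncomputable def orbitWeight (s R : ℝ) (n : ℤ) : ℝ := ((R - 1 + |(n : ℝ)|) / 4) ^ (-s)

theorem orbitWeight_nonneg {s R : ℝ} (hR : 1 ≤ R) (n : ℤ) : 0 ≤ orbitWeight s R n :=
  Real.rpow_nonneg (by have := abs_nonneg (n : ℝ); linarith) _

theorem orbitWeight_anti {s R R' : ℝ} (hs : 1 < s) (hR : 2 ≤ R) (h : R ≤ R') (n : ℤ) :
    orbitWeight s R' n ≤ orbitWeight s R n := by
  have := abs_nonneg (n : ℝ)
  exact Real.rpow_le_rpow_of_nonpos (by linarith) (by linarith) (by linarith)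

theorem summable_one_add_rpow {s c : ℝ} (hs : 1 < s) (hc : 0 < c) :
    Summable fun n : ℕ => ((1 + (n : ℝ)) / c) ^ (-s) := by
  have h1 : Summable fun n : ℕ => (n : ℝ) ^ (-s) := Real.summable_nat_rpow.2 (by linarith)
  have h2 := ((summable_nat_add_iff 1).2 h1).mul_left (c ^ s)
  refine h2.congr fun n => ?_
  rw [Real.div_rpow (by positivity) hc.le, Real.rpow_neg hc.le, div_inv_eq_mul]
  push_cast
  rw [add_comm (1 : ℝ), mul_comm]

theorem summable_orbitWeight {s R : ℝ} (hs : 1 < s) (hR : 2 ≤ R) :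
    Summable (orbitWeight s R) := by
  have h2 : Summable (orbitWeight s 2) := by
    have h := summable_one_add_rpow hs (c := 4) (by norm_num)
    rw [summable_int_iff_summable_nat_and_neg]
    constructor
    · refine h.congr fun n => ?_
      simp [orbitWeight]; norm_num
    · refine h.congr fun n => ?_
      simp [orbitWeight]; norm_num
  exact Summable.of_nonneg_of_le (orbitWeight_nonneg (by linarith))
    (orbitWeight_anti hs le_rfl hR) h2

theorem tendsto_tsum_orbitWeight {s : ℝ} (hs : 1 < s) :
    Tendsto (fun R => ∑' n, orbitWeight s R n) atTop (𝓝 0) := by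
  have h := tendsto_tsum_of_dominated_convergence (𝓕 := atTop) (f := fun R => orbitWeight s R)
    (g := fun _ : ℤ => (0 : ℝ)) (summable_orbitWeight hs le_rfl)
    (by
      intro n
      have h1 : Tendsto (fun R : ℝ => (R - 1 + |(n : ℝ)|) / 4) atTop atTop := by
        apply Tendsto.atTop_div_const (by norm_num)
        exact tendsto_atTop_add_const_right _ _ (tendsto_atTop_add_const_right _ _ tendsto_id)
      exact (tendsto_rpow_neg_atTop (by linarith)).comp h1)
    (by
      filter_upwards [eventually_ge_atTop 2] with R hR n
      rw [Real.norm_of_nonneg (orbitWeight_nonneg (by linarith) n)]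
      exact orbitWeight_anti hs le_rfl hR n)
  simpa using h

theorem norm_rpow_le_orbitWeight {s R : ℝ} (hs : 1 < s) (hR : 2 ≤ R) {X Y : ℂ}
    (hX : X ∈ basicPetal R) (m : ℕ) (hY : ‖Y - (X + m)‖ ≤ 1) :
    ‖Y‖ ^ (-s) ≤ orbitWeight s R (⌊X.re⌋ + m) := by
  have h1 : R < ‖X + m‖ := lt_norm_of_mem_basicPetal (add_natCast_mem_basicPetal hX m)
  have h2 : |X.re + m| ≤ ‖X + m‖ := by
    simpa using Complex.abs_re_le_norm (X + m)
  have h3 : |((⌊X.re⌋ + m : ℤ) : ℝ)| ≤ |X.re + m| + 1 := by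
    have h4 := Int.floor_le X.re
    have h5 := Int.lt_floor_add_one X.re
    push_cast
    have : |(⌊X.re⌋ : ℝ) - X.re| ≤ 1 := by rw [abs_le]; constructor <;> linarith
    calc |(⌊X.re⌋ : ℝ) + m| = |(X.re + m) + (⌊X.re⌋ - X.re)| := by ring_nf
      _ ≤ _ := (abs_add_le _ _).trans (by linarith)
  have h6 : ‖X + m‖ - 1 ≤ ‖Y‖ := by
    have := norm_sub_norm_le (X + m) Y
    rw [norm_sub_rev] at this
    linarith
  have h7 := abs_nonneg ((⌊X.re⌋ + m : ℤ) : ℝ)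
  exact Real.rpow_le_rpow_of_nonpos (by linarith) (by linarith) (by linarith)

namespace NearTranslation

variable {F : ℂ → ℂ} {R₀ s C : ℝ}

/-- Orbits starting deep enough in the petal follow the orbits of the unit translation. -/
theorem orbit (h : NearTranslation F R₀ s C) {R : ℝ} (hR : R₀ + 1 ≤ R) (hR2 : 2 ≤ R)
    (hC : C * ∑' n, orbitWeight s R n ≤ 1) {X : ℂ} (hX : X ∈ basicPetal R) (n : ℕ) :
    F^[n] X ∈ basicPetal R₀ ∧ ‖F^[n] X - (X + n)‖ ≤ C * ∑' n, orbitWeight s R n ∧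
      ‖F (F^[n] X) - F^[n] X - 1‖ ≤ C * orbitWeight s R (⌊X.re⌋ + n) := by
  have hsum := summable_orbitWeight h.one_lt hR2
  have hle : ∀ n : ℕ, ∑ m ∈ Finset.range n, orbitWeight s R (⌊X.re⌋ + m) ≤
      ∑' n, orbitWeight s R n := by
    intro n
    have hi : Function.Injective fun m : ℕ => ⌊X.re⌋ + (m : ℤ) := by
      intro a b hab
      simpa using hab
    refine ((hsum.comp_injective hi).sum_le_tsum (Finset.range n)
      (fun m _ => orbitWeight_nonneg (by linarith) _)).trans ?_
    exact tsum_comp_le_tsum_of_inj hsum (orbitWeight_nonneg (by linarith)) hi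
  have hstep : ∀ n : ℕ, ‖F^[n] X - (X + n)‖ ≤ 1 →
      F^[n] X ∈ basicPetal R₀ ∧
        ‖F (F^[n] X) - F^[n] X - 1‖ ≤ C * orbitWeight s R (⌊X.re⌋ + n) := by
    intro n hn
    have hmem : F^[n] X ∈ basicPetal R₀ :=
      basicPetal_anti (by linarith) (mem_basicPetal_of_near (add_natCast_mem_basicPetal hX n) hn)
    exact ⟨hmem, (h.bound _ hmem).trans
      (mul_le_mul_of_nonneg_left (norm_rpow_le_orbitWeight h.one_lt hR2 hX n hn) h.nonneg)⟩
  have hmain : ∀ n : ℕ, ‖F^[n] X - (X + n)‖ ≤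
      C * ∑ m ∈ Finset.range n, orbitWeight s R (⌊X.re⌋ + m) := by
    intro n
    induction n with
    | zero => simp
    | succ n ih =>
      have h1 := (hstep n (ih.trans ((mul_le_mul_of_nonneg_left (hle n) h.nonneg).trans hC))).2
      rw [Function.iterate_succ_apply', Finset.sum_range_succ, mul_add]
      calc ‖F (F^[n] X) - (X + (n + 1 : ℕ))‖
          = ‖(F^[n] X - (X + n)) + (F (F^[n] X) - F^[n] X - 1)‖ := by
            congr 1; push_cast; ring
        _ ≤ _ := (norm_add_le _ _).trans (add_le_add ih h1)
  have hfin := (hmain n).trans (mul_le_mul_of_nonneg_left (hle n) h.nonneg)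
  exact ⟨(hstep n (hfin.trans hC)).1, hfin, (hstep n (hfin.trans hC)).2⟩

end NearTranslation

/-- The derivative of a perturbation `e` with `‖e‖ ≤ 1` on a half-plane is small well inside it. -/
theorem contracting_of_bounded {e : ℂ → ℂ} {ρ : ℝ}
    (he : DifferentiableOn ℂ e {X | ρ < X.re}) (hb : ∀ X : ℂ, ρ < X.re → ‖e X‖ ≤ 1) :
    (∀ X : ℂ, ρ + 3 ≤ X.re → ‖deriv e X‖ ≤ 1 / 2) ∧
    ∀ X ∈ {X : ℂ | ρ + 3 ≤ X.re}, ∀ Y ∈ {X : ℂ | ρ + 3 ≤ X.re},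
      ‖e X - e Y‖ ≤ 1 / 2 * ‖X - Y‖ := by
  have hop : IsOpen {X : ℂ | ρ < X.re} := isOpen_lt continuous_const Complex.continuous_re
  have hsub : ∀ X : ℂ, ρ + 3 ≤ X.re → Metric.closedBall X 2 ⊆ {X : ℂ | ρ < X.re} := by
    intro X hX Y hY
    rw [Metric.mem_closedBall, dist_eq_norm] at hY
    have := (Complex.abs_re_le_norm (Y - X)).trans hY
    rw [Complex.sub_re, abs_le] at this
    simp only [Set.mem_ofPred_eq]; linarith
  have hderiv : ∀ X : ℂ, ρ + 3 ≤ X.re → ‖deriv e X‖ ≤ 1 / 2 := by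
    intro X hX
    refine Complex.norm_deriv_le_of_forall_mem_sphere_norm_le (by norm_num)
      ((he.mono ((Metric.closure_ball_subset_closedBall).trans (hsub X hX))).diffContOnCl) ?_
    intro Y hY
    exact hb Y (hsub X hX (Metric.sphere_subset_closedBall hY))
  refine ⟨hderiv, fun X hX Y hY => ?_⟩
  exact Convex.norm_image_sub_le_of_norm_deriv_le (𝕜 := ℂ) (s := {X : ℂ | ρ + 3 ≤ X.re})
    (fun Z hZ => he.differentiableAt (hop.mem_nhds (by
      simp only [Set.mem_ofPred_eq] at hZ ⊢; linarith)))
    (fun Z hZ => hderiv Z hZ) (convex_halfSpace_re_ge (ρ + 3)) hY hX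

/-- `Φ` is the Fatou coordinate of `F` on the petal of size `R`, normalized to be asymptotic to
the identity. -/
structure IsNormalizedFatou (F : ℂ → ℂ) (R₀ R : ℝ) (Φ : ℂ → ℂ) : Prop where
  le : R₀ ≤ R
  holomorphic : DifferentiableOn ℂ Φ (basicPetal R)
  injOn : Set.InjOn Φ (basicPetal R)
  orbit_mem : ∀ X ∈ basicPetal R, ∀ n : ℕ, F^[n] X ∈ basicPetal R₀
  orbit_near : ∀ X ∈ basicPetal R, ∀ n : ℕ, ‖F^[n] X - (X + n)‖ ≤ 1
  tendsto : ∀ X ∈ basicPetal R, Tendsto (fun n : ℕ => F^[n] X - n) atTop (𝓝 (Φ X))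
  near : ∀ X ∈ basicPetal R, ‖Φ X - X‖ ≤ 1
  asymptotic : ∀ ε > 0, ∃ R', ∀ X ∈ basicPetal R', ‖Φ X - X‖ ≤ ε

namespace IsNormalizedFatou

variable {F Φ : ℂ → ℂ} {R₀ R : ℝ}

theorem mono (h : IsNormalizedFatou F R₀ R Φ) {R' : ℝ} (hR : R ≤ R') :
    IsNormalizedFatou F R₀ R' Φ where
  le := h.le.trans hR
  holomorphic := h.holomorphic.mono (basicPetal_anti hR)
  injOn := h.injOn.mono (basicPetal_anti hR)
  orbit_mem X hX := h.orbit_mem X (basicPetal_anti hR hX)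
  orbit_near X hX := h.orbit_near X (basicPetal_anti hR hX)
  tendsto X hX := h.tendsto X (basicPetal_anti hR hX)
  near X hX := h.near X (basicPetal_anti hR hX)
  asymptotic := h.asymptotic

theorem map_apply (h : IsNormalizedFatou F R₀ R Φ) {X : ℂ} (hX : X ∈ basicPetal R)
    (hF : F X ∈ basicPetal R) : Φ (F X) = Φ X + 1 := by
  have h1 := h.tendsto _ hF
  have h2 := ((tendsto_add_atTop_iff_nat 1).2 (h.tendsto _ hX)).add_const 1
  refine tendsto_nhds_unique h1 (h2.congr fun n => ?_)
  rw [Function.iterate_succ_apply]; push_cast; ring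

end IsNormalizedFatou

/-- The Fatou coordinate is the limit of `F^[n] X - n`, the sum of a telescoping series whose
terms are summable along the orbits. It is injective deep in the right half-plane, where it is a
contracting perturbation of the identity, and then on the whole petal since all orbits end there.
-/
theorem NearTranslation.exists_isNormalizedFatou {F : ℂ → ℂ} {R₀ s C : ℝ}
    (h : NearTranslation F R₀ s C) : ∃ R Φ, IsNormalizedFatou F R₀ R Φ := by
  have hT : Tendsto (fun R => C * ∑' n, orbitWeight s R n) atTop (𝓝 0) := by
    simpa using (tendsto_tsum_orbitWeight h.one_lt).const_mul C
  obtain ⟨R, hRC, hR2, hR0⟩ : ∃ R, C * ∑' n, orbitWeight s R n ≤ 1 ∧ 2 ≤ R ∧ R₀ + 1 ≤ R :=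
    ((hT.eventually_le_const one_pos).and
      ((eventually_ge_atTop 2).and (eventually_ge_atTop (R₀ + 1)))).exists
  have horb := fun {X : ℂ} (hX : X ∈ basicPetal R) => h.orbit hR0 hR2 hRC hX
  have hsumm : ∀ X : ℂ, X ∈ basicPetal R →
      Summable fun n : ℕ => F (F^[n] X) - F^[n] X - 1 := by
    intro X hX
    refine Summable.of_norm_bounded (g := fun n : ℕ => C * orbitWeight s R (⌊X.re⌋ + n)) ?_
      (fun n => (horb hX n).2.2)
    refine Summable.mul_left C ((summable_orbitWeight h.one_lt hR2).comp_injective ?_)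
    intro a b hab
    simpa using hab
  set Φ : ℂ → ℂ := fun X => X + ∑' n : ℕ, (F (F^[n] X) - F^[n] X - 1) with hΦ
  have htend : ∀ X ∈ basicPetal R, Tendsto (fun n : ℕ => F^[n] X - n) atTop (𝓝 (Φ X)) := by
    intro X hX
    refine ((hsumm X hX).hasSum.tendsto_sum_nat.const_add X).congr fun n => ?_
    induction n with
    | zero => simp
    | succ n ih =>
      rw [Finset.sum_range_succ, ← add_assoc, ih, Function.iterate_succ_apply']
      push_cast; ring
  -- the total error along an orbit bounds the distance from `Φ` to the identity, and it is
  -- small deep in the petal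
  have hlim : ∀ X : ℂ, ∀ R' ε : ℝ, R ≤ R' → C * ∑' n, orbitWeight s R' n ≤ ε → ε ≤ 1 →
      X ∈ basicPetal R' → ‖Φ X - X‖ ≤ ε := by
    intro X R' ε hR' hε hε1 hX
    have h1 := (htend X (basicPetal_anti hR' hX)).sub_const X
    refine le_of_tendsto h1.norm (Eventually.of_forall fun n => ?_)
    have := (h.orbit (hR0.trans hR') (hR2.trans hR') (hε.trans hε1) hX n).2.1.trans hε
    rwa [sub_right_comm, sub_sub]
  have hnear : ∀ X ∈ basicPetal R, ‖Φ X - X‖ ≤ 1 := fun X hX =>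
    hlim X R 1 le_rfl hRC le_rfl hX
  have hiter : ∀ n : ℕ, DifferentiableOn ℂ (F^[n]) (basicPetal R) := by
    intro n
    induction n with
    | zero => exact differentiableOn_id
    | succ n ih =>
      rw [Function.iterate_succ']
      exact h.holomorphic.comp ih fun X hX => (horb hX n).1
  -- on a vertical strip the integer parts of the real parts are bounded by `M`, so that one
  -- summable majorant serves for all points
  have hhol : DifferentiableOn ℂ Φ (basicPetal R) := by
    intro X hX
    set M : ℕ := ⌈|X.re|⌉₊ + 2 with hM
    set V : Set ℂ := basicPetal R ∩ {Y | |Y.re| < |X.re| + 1} with hV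
    have hVo : IsOpen V := (isOpen_basicPetal R).inter
      (isOpen_lt (by fun_prop) continuous_const)
    have hXV : X ∈ V := ⟨hX, by simp⟩
    have hfl : ∀ Y ∈ V, |(⌊Y.re⌋ : ℝ)| ≤ M := by
      rintro Y ⟨-, hY⟩
      have h1 := Int.floor_le Y.re
      have h2 := Int.lt_floor_add_one Y.re
      have h3 := Nat.le_ceil |X.re|
      simp only [Set.mem_ofPred_eq, abs_lt] at hY
      rw [abs_le]; push_cast [hM]
      constructor <;> linarith
    have hdiff : DifferentiableOn ℂ
        (fun Y => ∑' n : ℕ, (F (F^[n] Y) - F^[n] Y - 1)) V := by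
      refine Complex.differentiableOn_tsum_of_summable_norm
        (u := fun n : ℕ => C * ((1 + (n : ℝ)) / (4 * (1 + M))) ^ (-s)) ?_ ?_ hVo ?_
      · exact (summable_one_add_rpow h.one_lt (by positivity)).mul_left C
      · intro n
        have h1 : DifferentiableOn ℂ (fun Y => F (F^[n] Y)) (basicPetal R) :=
          h.holomorphic.comp (hiter n) fun X hX => (horb hX n).1
        exact ((h1.sub (hiter n)).sub_const 1).mono Set.inter_subset_left
      · intro n Y hY
        refine (horb hY.1 n).2.2.trans (mul_le_mul_of_nonneg_left ?_ h.nonneg)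
        refine Real.rpow_le_rpow_of_nonpos (by positivity) ?_ (by linarith [h.one_lt])
        have h2 := hfl Y hY
        have h3 : (n : ℝ) - M ≤ |((⌊Y.re⌋ + n : ℤ) : ℝ)| := by
          push_cast
          refine le_trans ?_ (le_abs_self _)
          rw [abs_le] at h2
          linarith
        rw [← div_div]
        rw [div_right_comm]
        refine div_le_div_of_nonneg_right ?_ (by norm_num)
        rw [div_le_iff₀ (by positivity)]
        have h4 := abs_nonneg ((⌊Y.re⌋ + n : ℤ) : ℝ)
        have h5 : (0 : ℝ) ≤ M := Nat.cast_nonneg M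
        nlinarith
    have h1 : DifferentiableAt ℂ (fun Y => ∑' n : ℕ, (F (F^[n] Y) - F^[n] Y - 1)) X :=
      hdiff.differentiableAt (hVo.mem_nhds hXV)
    exact (differentiableAt_id.add h1).differentiableWithinAt
  -- injectivity deep in the half-plane, carried back along the orbits
  have hcontr := contracting_of_bounded (e := fun X => Φ X - X) (ρ := R)
    ((hhol.mono fun X hX => Or.inr hX).sub differentiableOn_id)
    (fun X hX => hnear X (Or.inr hX))
  have hinjdeep : Set.InjOn Φ {X : ℂ | R + 3 ≤ X.re} := by
    have := injOn_add_of_contracting hcontr.2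
    simpa using this
  have hfin : ∀ X ∈ basicPetal R, ∀ᶠ n : ℕ in atTop, R + 3 ≤ (F^[n] X).re := by
    intro X hX
    have h1 : ∀ᶠ n : ℕ in atTop, R + 4 - X.re ≤ (n : ℝ) :=
      tendsto_natCast_atTop_atTop.eventually_ge_atTop _
    filter_upwards [h1] with n hn
    have h2 := (Complex.abs_re_le_norm _).trans ((horb hX n).2.1.trans hRC)
    simp only [Complex.sub_re, Complex.add_re, Complex.natCast_re, abs_le] at h2
    linarith
  have hval : ∀ X ∈ basicPetal R, ∀ n : ℕ, F^[n] X ∈ basicPetal R → Φ (F^[n] X) = Φ X + n := by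
    intro X hX n hn
    have h1 := htend _ hn
    have h2 := ((tendsto_add_atTop_iff_nat n).2 (htend _ hX)).add_const (n : ℂ)
    refine tendsto_nhds_unique h1 (h2.congr fun m => ?_)
    rw [Function.iterate_add_apply]; push_cast; ring
  refine ⟨R, Φ, by linarith, hhol, ?_, fun X hX n => (horb hX n).1,
    fun X hX n => (horb hX n).2.1.trans hRC, htend, hnear, ?_⟩
  · intro X hX Y hY hXY
    obtain ⟨n, hn1, hn2⟩ := ((hfin X hX).and (hfin Y hY)).exists
    have h1 := hval X hX n (Or.inr (by linarith))
    have h2 := hval Y hY n (Or.inr (by linarith))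
    have h3 : F^[n] X = F^[n] Y := hinjdeep hn1 hn2 (by rw [h1, h2, hXY])
    clear h1 h2 hn1 hn2
    induction n with
    | zero => exact h3
    | succ n ih =>
      rw [Function.iterate_succ_apply', Function.iterate_succ_apply'] at h3
      exact ih (h.injOn (horb hX n).1 (horb hY n).1 h3)
  · intro ε hε
    obtain ⟨R', h1, h2⟩ : ∃ R', C * ∑' n, orbitWeight s R' n ≤ min ε 1 ∧ R ≤ R' :=
      ((hT.eventually_le_const (by positivity)).and (eventually_ge_atTop R)).exists
    exact ⟨R', fun X hX => (hlim X R' _ h2 h1 (min_le_right _ _) hX).trans (min_le_left _ _)⟩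

/-- Uniqueness of Fatou coordinates up to translation. The comparison map `Ψ ∘ Φ⁻¹`, defined far
to the right, commutes with the unit translation, hence extends to an entire function; this one is
affine, either because it is injective or because it has linear growth. -/
theorem IsNormalizedFatou.eq_add_const {F Φ Ψ : ℂ → ℂ} {R₀ R R' : ℝ}
    (h : IsNormalizedFatou F R₀ R Φ) (hR : R ≤ R')
    (hd : DifferentiableOn ℂ Ψ (basicPetal R'))
    (hT : ∀ X ∈ basicPetal R', F X ∈ basicPetal R' → Ψ (F X) = Ψ X + 1)
    (hΨ : Set.InjOn Ψ (basicPetal R') ∨ ∃ A B : ℝ, ∀ X ∈ basicPetal R', ‖Ψ X‖ ≤ A + B * ‖X‖) :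
    ∃ c, ∀ X ∈ basicPetal R', Ψ X = Φ X + c := by
  replace h := h.mono hR
  have hcontr := contracting_of_bounded (e := fun X => Φ X - X) (ρ := R')
    ((h.holomorphic.mono fun X hX => Or.inr hX).sub differentiableOn_id)
    (fun X hX => h.near X (Or.inr hX))
  set S : Set ℂ := {X : ℂ | R' + 3 < X.re} with hS
  have hSo : IsOpen S := isOpen_lt continuous_const Complex.continuous_re
  have hSP : S ⊆ basicPetal R' := fun X hX => Or.inr (by
    simp only [hS, Set.mem_ofPred_eq] at hX; linarith)
  have hinj : Set.InjOn Φ S := h.injOn.mono hSP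
  -- `Φ` is invertible far to the right, by the contraction principle
  have hsol : ∀ Y : ℂ, R' + 5 < Y.re → ∃ X ∈ S, Φ X = Y := by
    intro Y hY
    obtain ⟨X, hX, hXY⟩ := exists_add_eq_of_contracting (K := {X : ℂ | R' + 4 ≤ X.re})
      (isClosed_le continuous_const Complex.continuous_re) ⟨((R' + 4 : ℝ) : ℂ), by simp⟩
      (e := fun X => Φ X - X) (Y := Y)
      (fun x hx y hy => hcontr.2 x (by simp only [Set.mem_ofPred_eq] at hx ⊢; linarith) y
        (by simp only [Set.mem_ofPred_eq] at hy ⊢; linarith))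
      (fun x hx => by
        simp only [Set.mem_ofPred_eq] at hx ⊢
        have := (Complex.abs_re_le_norm _).trans (h.near x (Or.inr (by linarith)))
        rw [abs_le] at this
        rw [Complex.sub_re]
        linarith)
    refine ⟨X, ?_, by simpa using hXY⟩
    simp only [Set.mem_ofPred_eq, hS] at hX ⊢; linarith
  set I : ℂ → ℂ := Function.invFunOn Φ S with hI
  have hIs : ∀ Y : ℂ, R' + 5 < Y.re → I Y ∈ S ∧ Φ (I Y) = Y := fun Y hY =>
    ⟨Function.invFunOn_mem (hsol Y hY), Function.invFunOn_eq (hsol Y hY)⟩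
  have hIΦ : ∀ X ∈ S, I (Φ X) = X := fun X hX => hinj.leftInvOn_invFunOn hX
  have hFS : ∀ X ∈ S, F X ∈ S := by
    intro X hX
    have h1 := (Complex.abs_re_le_norm _).trans (h.orbit_near X (hSP hX) 1)
    simp only [Function.iterate_one, Nat.cast_one, Complex.sub_re, Complex.add_re,
      Complex.one_re, abs_le] at h1
    simp only [Set.mem_ofPred_eq, hS] at hX ⊢; linarith
  have hnear : ∀ Y : ℂ, R' + 5 < Y.re → ‖I Y‖ ≤ ‖Y‖ + 1 := by
    intro Y hY
    obtain ⟨h1, h2⟩ := hIs Y hY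
    have h3 := h.near _ (hSP h1)
    rw [h2, norm_sub_rev] at h3
    linarith [norm_sub_norm_le (I Y) Y]
  -- `Ψ ∘ Φ⁻¹` commutes with the unit translation and extends to an entire function `H`
  obtain ⟨H, hHd, hH⟩ := exists_entire_extension (P := fun Y => Ψ (I Y)) (ρ := R' + 5) (by
      intro Y hY
      obtain ⟨h1, h2⟩ := hIs Y hY
      have hΦd : DifferentiableAt ℂ Φ (I Y) :=
        h.holomorphic.differentiableAt ((isOpen_basicPetal R').mem_nhds (hSP h1))
      have h3 : deriv Φ (I Y) ≠ 0 := by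
        have h4 := hcontr.1 (I Y) (by simp only [Set.mem_ofPred_eq, hS] at h1; linarith)
        intro h0
        rw [deriv_fun_sub hΦd differentiableAt_fun_id, h0, deriv_id''] at h4
        norm_num at h4
      have h5 : DifferentiableAt ℂ I Y := by
        have := differentiableAt_invFunOn hSo (h.holomorphic.mono hSP) hinj h1 h3
        rwa [h2] at this
      exact ((hd.differentiableAt ((isOpen_basicPetal R').mem_nhds (hSP h1))).comp Y
        h5).differentiableWithinAt) (by
      intro Y hY
      obtain ⟨h1, h2⟩ := hIs Y hY
      have h3 := h.map_apply (hSP h1) (hSP (hFS _ h1))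
      rw [h2] at h3
      have h4 : I (Y + 1) = F (I Y) := by rw [← h3, hIΦ _ (hFS _ h1)]
      simp only [h4]
      exact hT _ (hSP h1) (hSP (hFS _ h1)))
  obtain ⟨a, c, hac⟩ : ∃ a c : ℂ, ∀ z, H z = a * z + c := by
    rcases hΨ with hΨ | ⟨A, B, hAB⟩
    · refine affine_of_injective hHd fun X Y hXY => ?_
      obtain ⟨n, hn⟩ := exists_nat_gt (max (R' + 5 - X.re) (R' + 5 - Y.re))
      rw [max_lt_iff] at hn
      have hX : R' + 5 < (X + n).re := by simp; linarith
      have hY : R' + 5 < (Y + n).re := by simp; linarith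
      rw [hH X n (by linarith), hH Y n (by linarith), sub_left_inj] at hXY
      have h1 := hΨ (hSP (hIs _ hX).1) (hSP (hIs _ hY).1) hXY
      have h2 := congrArg Φ h1
      rw [(hIs _ hX).2, (hIs _ hY).2] at h2
      exact add_right_cancel h2
    · refine affine_of_linear_growth hHd (A := |A| + |B| * (|R' + 5| + 3) + |R' + 5| + 2)
        (B := 2 * |B| + 1) fun X => ?_
      -- with `n` of the order of `|Re X|`, the point `X + n` lies far to the right and the
      -- bound on `Ψ` applies
      set n := ⌈|R' + 5| + |X.re|⌉₊ + 1 with hn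
      have hn1 : |R' + 5| + |X.re| < n := by
        rw [hn]; push_cast
        linarith [Nat.le_ceil (|R' + 5| + |X.re|)]
      have hn2 : (n : ℝ) ≤ |R' + 5| + |X.re| + 2 := by
        rw [hn]; push_cast
        linarith [Nat.ceil_lt_add_one (by positivity : 0 ≤ |R' + 5| + |X.re|)]
      have hX : R' + 5 < (X + n).re := by
        simp only [Complex.add_re, Complex.natCast_re]
        linarith [le_abs_self (R' + 5), neg_abs_le X.re]
      rw [hH X n (by simpa using hX)]
      have h1 := hAB _ (hSP (hIs _ hX).1)
      have h2 := hnear _ hX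
      have h3 : ‖X + n‖ ≤ ‖X‖ + n := by simpa using norm_add_le X (n : ℂ)
      have h4 := Complex.abs_re_le_norm X
      calc ‖Ψ (I (X + n)) - n‖ ≤ ‖Ψ (I (X + n))‖ + n := by
            simpa using norm_sub_le (Ψ (I (X + n))) (n : ℂ)
        _ ≤ (|A| + |B| * ‖I (X + n)‖) + n := by
            gcongr
            refine h1.trans (add_le_add (le_abs_self A) ?_)
            gcongr
            exact le_abs_self B
        _ ≤ (|A| + |B| * (|R' + 5| + 3 + 2 * ‖X‖)) + (|R' + 5| + 2 + ‖X‖) := by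
            gcongr <;> linarith
        _ = _ := by ring
  -- an affine map commuting with the unit translation has slope `1`
  have ha : a = 1 := by
    obtain ⟨n, hn⟩ := exists_nat_gt (R' + 5)
    have h1 := hH 1 n (by simp; linarith)
    have h2 := hH 0 (n + 1) (by push_cast; simp; linarith)
    rw [hac] at h1 h2
    push_cast at h2
    rw [show (0 : ℂ) + (n + 1) = 1 + n by ring] at h2
    linear_combination h1 - h2
  refine ⟨c, ?_⟩
  have hdeep : ∀ X : ℂ, R' + 6 < X.re → Ψ X = Φ X + c := by
    intro X hX
    have hXS : X ∈ S := by simp only [Set.mem_ofPred_eq, hS]; linarith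
    have h1 := (Complex.abs_re_le_norm _).trans (h.near X (hSP hXS))
    rw [Complex.sub_re, abs_le] at h1
    have h2 := hH (Φ X) 0 (by push_cast; linarith)
    rw [hac, ha] at h2
    simp only [Nat.cast_zero, add_zero, sub_zero, hIΦ X hXS] at h2
    rw [← h2]; ring
  -- the petal is connected, so the identity propagates from the half-plane to all of it
  have hz : ((R' + 7 : ℝ) : ℂ) ∈ basicPetal R' := Or.inr (by simp)
  have hEq := AnalyticOnNhd.eqOn_of_preconnected_of_eventuallyEq
    (hd.analyticOnNhd (isOpen_basicPetal R'))
    ((h.holomorphic.add_const c).analyticOnNhd (isOpen_basicPetal R'))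
    (isPreconnected_basicPetal R') hz (by
      filter_upwards [(isOpen_lt continuous_const Complex.continuous_re).mem_nhds
        (show R' + 6 < ((R' + 7 : ℝ) : ℂ).re by simp; norm_num)] with X hX
      exact hdeep X hX)
  exact fun X hX => hEq hX

/-! ### The time coordinate on a slit plane -/

/-- The logarithm is additive when `w` and `w * exp m` lie in one of the half-planes `0 < Re`, `0
< Im`, `Im < 0`: the two principal arguments then differ by at most `π`, which leaves no room for
a multiple of `2 π`. -/
theorem log_mul_exp_of_half_plane {w m : ℂ} (hm : |m.im| < Real.pi)
    (h : (0 < w.re ∧ 0 < (w * Complex.exp m).re) ∨ (0 < w.im ∧ 0 < (w * Complex.exp m).im) ∨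
      (w.im < 0 ∧ (w * Complex.exp m).im < 0)) :
    Complex.log (w * Complex.exp m) = Complex.log w + m := by
  have hw : w ≠ 0 := by rintro rfl; simp at h
  set w' := w * Complex.exp m with hw'
  have hw'0 : w' ≠ 0 := mul_ne_zero hw (Complex.exp_ne_zero m)
  have h1 : Complex.exp (Complex.log w') = Complex.exp (Complex.log w + m) := by
    rw [Complex.exp_log hw'0, Complex.exp_add, Complex.exp_log hw]
  obtain ⟨n, hn⟩ := Complex.exp_eq_exp_iff_exists_int.1 h1
  have him := congrArg Complex.im hn
  simp only [Complex.add_im, Complex.log_im, Complex.mul_im, Complex.intCast_re,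
    Complex.intCast_im, Complex.mul_re, Complex.re_ofNat, Complex.im_ofNat, Complex.ofReal_re,
    Complex.ofReal_im, Complex.I_re, Complex.I_im] at him
  have hd : |w'.arg - w.arg| ≤ Real.pi := by
    rcases h with ⟨h1, h2⟩ | ⟨h1, h2⟩ | ⟨h1, h2⟩
    · have h3 := abs_lt.1 (Complex.abs_arg_lt_pi_div_two_iff.2 (Or.inl h1))
      have h4 := abs_lt.1 (Complex.abs_arg_lt_pi_div_two_iff.2 (Or.inl h2))
      rw [abs_le]; constructor <;> linarith
    · have h3 := Complex.arg_nonneg_iff.2 h1.le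
      have h4 := Complex.arg_nonneg_iff.2 h2.le
      have h5 := Complex.arg_le_pi w
      have h6 := Complex.arg_le_pi w'
      rw [abs_le]; constructor <;> linarith
    · have h3 := Complex.arg_neg_iff.2 h1
      have h4 := Complex.arg_neg_iff.2 h2
      have h5 := Complex.neg_pi_lt_arg w
      have h6 := Complex.neg_pi_lt_arg w'
      rw [abs_le]; constructor <;> linarith
  have hn0 : n = 0 := by
    have h3 : w'.arg - w.arg - m.im = n * (2 * Real.pi) := by linear_combination him
    have h4 : |(n : ℝ) * (2 * Real.pi)| < 2 * Real.pi := by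
      rw [← h3]
      calc _ ≤ |w'.arg - w.arg| + |m.im| := abs_sub _ _
        _ < _ := by linarith
    rw [abs_mul, abs_of_pos Real.two_pi_pos] at h4
    have h5 : |(n : ℝ)| < 1 := by
      by_contra! h6
      have := mul_le_mul_of_nonneg_right h6 Real.two_pi_pos.le
      linarith
    have h6 : |n| < 1 := by exact_mod_cast h5
    exact Int.abs_lt_one_iff.1 h6
  rw [hn, hn0]; simp

/-- The time coordinate of a petal as a function of `η = ±1 / (k z ^ k)`, on the plane slit along
the negative real axis. -/
noncomputable def timeMap (k : ℕ) (β : ℝ) (η : ℂ) : ℂ := η - β / k * Complex.log (k * η)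

/-- The logarithmic term of the time coordinate is small in comparison with `η`. -/
theorem exists_log_bound (k : ℕ) (β : ℝ) : ∃ C : ℝ, 0 ≤ C ∧ ∀ η : ℂ, 1 ≤ k * ‖η‖ →
    ‖(β / k : ℂ) * Complex.log (k * η)‖ ≤ ‖η‖ / 16 + C := by
  set a : ℝ := |β| / k with ha
  have ha0 : 0 ≤ a := by positivity
  set δ : ℝ := 1 / (16 * (a + 1) * (k + 1)) with hδ
  have hδ0 : 0 < δ := by positivity
  refine ⟨a * (|Real.log δ| + Real.pi), by positivity, fun η hη => ?_⟩
  have h1 : ‖Complex.log (k * η)‖ ≤ Real.log (k * ‖η‖) + Real.pi := by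
    refine (Complex.norm_le_abs_re_add_abs_im _).trans ?_
    rw [Complex.log_re, Complex.log_im, norm_mul, Complex.norm_natCast,
      abs_of_nonneg (Real.log_nonneg hη)]
    linarith [Complex.abs_arg_le_pi (k * η)]
  have h2 : Real.log (k * ‖η‖) ≤ δ * (k * ‖η‖) + |Real.log δ| := by
    have h3 := Real.log_le_sub_one_of_pos (mul_pos hδ0 (by linarith : 0 < k * ‖η‖))
    rw [Real.log_mul hδ0.ne' (by linarith)] at h3
    linarith [neg_abs_le (Real.log δ)]
  have h4 : a * (δ * (k * ‖η‖)) ≤ ‖η‖ / 16 := by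
    have : a * (δ * (k * ‖η‖)) = ‖η‖ / 16 * ((a / (a + 1)) * (k / (k + 1))) := by
      rw [hδ]; field_simp
    rw [this]
    refine mul_le_of_le_one_right (by positivity) (mul_le_one₀ ?_ (by positivity) ?_)
    · rw [div_le_one (by positivity)]; linarith
    · rw [div_le_one (by positivity)]; linarith
  have h5 : ‖(β / k : ℂ)‖ = a := by simp [ha]
  rw [norm_mul, h5]
  calc a * ‖Complex.log (k * η)‖ ≤ a * (δ * (k * ‖η‖) + |Real.log δ| + Real.pi) := by
        gcongr; linarith
    _ ≤ _ := by linarith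

theorem abs_im_log_term_le (k : ℕ) (β : ℝ) (η : ℂ) :
    |((β / k : ℂ) * Complex.log (k * η)).im| ≤ |β| / k * Real.pi := by
  have : ((β / k : ℂ)) = ((β / k : ℝ) : ℂ) := by push_cast; rfl
  rw [this, Complex.im_ofReal_mul, abs_mul, abs_div, Nat.abs_cast, Complex.log_im]
  gcongr
  exact Complex.abs_arg_le_pi _

theorem natCast_mul_mem_slitPlane {k : ℕ} (hk : 1 ≤ k) {η : ℂ} (h : η ∈ Complex.slitPlane) :
    (k : ℂ) * η ∈ Complex.slitPlane := by
  have hk' : (0 : ℝ) < k := by exact_mod_cast hk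
  rw [Complex.mem_slitPlane_iff] at h ⊢
  rcases h with h | h
  · left
    have e : ((k : ℂ) * η).re = k * η.re := by simp
    rw [e]
    exact mul_pos hk' h
  · right
    have : (k : ℂ) * η = ((k : ℝ) : ℂ) * η := by push_cast; rfl
    rw [this, Complex.im_ofReal_mul]
    exact mul_ne_zero hk'.ne' h

/-- On a convex set far from the origin the logarithmic term of the time coordinate is
contracting. -/
theorem log_term_contracting {k : ℕ} (hk : 1 ≤ k) (β : ℝ) {K : Set ℂ} (hK : Convex ℝ K)
    (hs : K ⊆ Complex.slitPlane) {m : ℝ} (hm : 0 < m) (hβ : 2 * |β| / k ≤ m)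
    (hn : ∀ η ∈ K, m ≤ ‖η‖) : ∀ x ∈ K, ∀ y ∈ K,
      ‖-((β / k : ℂ) * Complex.log (k * x)) - -((β / k : ℂ) * Complex.log (k * y))‖
        ≤ 1 / 2 * ‖x - y‖ := by
  have hk0 : (k : ℂ) ≠ 0 := by exact_mod_cast (by omega : k ≠ 0)
  have hk' : (0 : ℝ) < k := by exact_mod_cast hk
  have hder : ∀ η ∈ K, HasDerivAt (fun η : ℂ => -((β / k : ℂ) * Complex.log (k * η)))
      (-((β / k : ℂ) * η⁻¹)) η := by
    intro η hη
    have h0 : η ≠ 0 := Complex.slitPlane_ne_zero (hs hη)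
    have h1 := ((hasDerivAt_id η).const_mul (k : ℂ)).clog (natCast_mul_mem_slitPlane hk (hs hη))
    refine ((h1.const_mul (β / k : ℂ)).neg).congr_deriv ?_
    simp only [id]; field_simp
  intro x hx y hy
  refine hK.norm_image_sub_le_of_norm_deriv_le (𝕜 := ℂ)
    (f := fun η : ℂ => -((β / k : ℂ) * Complex.log (k * η))) (s := K)
    (fun η hη => (hder η hη).differentiableAt) (fun η hη => ?_) hy hx
  rw [(hder η hη).deriv, norm_neg, norm_mul, norm_inv, ← div_eq_mul_inv]
  have h1 := hn η hη
  rw [div_le_iff₀ (by linarith)]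
  have h2 : ‖(β / k : ℂ)‖ = |β| / k := by simp
  rw [h2]
  have h3 : 2 * |β| / k = 2 * (|β| / k) := by ring
  linarith

/-- The time coordinate is a bijection from a neighbourhood of infinity in the slit plane, cut
suitably, onto each sufficiently small petal. -/
theorem existsUnique_timeMap_eq {k : ℕ} (hk : 1 ≤ k) (β : ℝ) {M : ℝ} (hM : 1 ≤ k * M) :
    ∃ R₀ : ℝ, ∀ R, R₀ ≤ R → ∀ Y ∈ basicPetal R,
      ∃! η : ℂ, (η ∈ Complex.slitPlane ∧ M < ‖η‖) ∧ timeMap k β η = Y := by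
  obtain ⟨C, hC0, hC⟩ := exists_log_bound k β
  have hk' : (0 : ℝ) < k := by exact_mod_cast hk
  have hM0 : 0 < M := by
    by_contra! h
    have := mul_nonpos_of_nonneg_of_nonpos hk'.le h
    linarith
  set a : ℝ := |β| / k with ha
  have ha0 : 0 ≤ a := by positivity
  refine ⟨1 + 4 * C + 8 * a + 2 * (a * Real.pi) + 5 * M, fun R hR Y hY => ?_⟩
  have hapi : 0 ≤ a * Real.pi := by positivity
  have hR1 : 0 < R := by linarith
  have him := abs_im_log_term_le k β
  have hbig : ∀ η : ℂ, R / 4 ≤ ‖η‖ → M < ‖η‖ ∧ 1 ≤ k * ‖η‖ := by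
    intro η hη
    have h1 : M < ‖η‖ := by linarith
    exact ⟨h1, hM.trans (by gcongr)⟩
  have hcon : ∀ K : Set ℂ, Convex ℝ K → K ⊆ Complex.slitPlane → (∀ η ∈ K, R / 4 ≤ ‖η‖) → _ :=
    fun K h1 h2 h3 => log_term_contracting hk β h1 h2 (m := R / 4) (by linarith) (by
      have : 2 * |β| / k = 2 * a := by rw [ha]; ring
      linarith) h3
  -- three half-planes covering the preimages of the petal, on each of which the contraction
  -- principle applies
  set K₁ : Set ℂ := {η | R / 2 ≤ η.im}
  set K₂ : Set ℂ := {η | η.im ≤ -(R / 2)}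
  set K₃ : Set ℂ := {η | R / 4 ≤ η.re}
  have hn₁ : ∀ η ∈ K₁, R / 4 ≤ ‖η‖ := fun η hη => by
    have h1 : R / 2 ≤ η.im := hη
    linarith [Complex.im_le_norm η]
  have hn₂ : ∀ η ∈ K₂, R / 4 ≤ ‖η‖ := fun η hη => by
    have h1 : η.im ≤ -(R / 2) := hη
    linarith [(abs_le.1 (Complex.abs_im_le_norm η)).1]
  have hn₃ : ∀ η ∈ K₃, R / 4 ≤ ‖η‖ := fun η hη => by
    have h1 : R / 4 ≤ η.re := hη
    linarith [Complex.re_le_norm η]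
  have hs₁ : K₁ ⊆ Complex.slitPlane := fun η hη => by
    have h1 : R / 2 ≤ η.im := hη
    exact Complex.mem_slitPlane_iff.2 (Or.inr (by linarith))
  have hs₂ : K₂ ⊆ Complex.slitPlane := fun η hη => by
    have h1 : η.im ≤ -(R / 2) := hη
    exact Complex.mem_slitPlane_iff.2 (Or.inr (by linarith))
  have hs₃ : K₃ ⊆ Complex.slitPlane := fun η hη => by
    have h1 : R / 4 ≤ η.re := hη
    exact Complex.mem_slitPlane_iff.2 (Or.inl (by linarith))
  have hc₁ := hcon K₁ (convex_halfSpace_im_ge (R / 2)) hs₁ hn₁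
  have hc₂ := hcon K₂ (convex_halfSpace_im_le (-(R / 2))) hs₂ hn₂
  have hc₃ := hcon K₃ (convex_halfSpace_re_ge (R / 4)) hs₃ hn₃
  -- Solutions exist in one of the three half-planes, and all of them lie in the same one.
  obtain ⟨K, hsK, hnK, hcK, hex, hall⟩ : ∃ K : Set ℂ, K ⊆ Complex.slitPlane ∧
      (∀ η ∈ K, R / 4 ≤ ‖η‖) ∧
      (∀ x ∈ K, ∀ y ∈ K, ‖-((β / k : ℂ) * Complex.log (k * x)) -
        -((β / k : ℂ) * Complex.log (k * y))‖ ≤ 1 / 2 * ‖x - y‖) ∧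
      (∃ η ∈ K, η + -((β / k : ℂ) * Complex.log (k * η)) = Y) ∧
      ∀ η : ℂ, M < ‖η‖ → η + -((β / k : ℂ) * Complex.log (k * η)) = Y → η ∈ K := by
    have hYim : ∀ η : ℂ, η + -((β / k : ℂ) * Complex.log (k * η)) = Y →
        |Y.im - η.im| ≤ a * Real.pi := by
      intro η hη
      have h1 := him η
      rw [← hη, Complex.add_im, Complex.neg_im, add_sub_cancel_left, abs_neg]
      exact h1
    by_cases h1 : R < Y.im
    · refine ⟨K₁, hs₁, hn₁, hc₁, exists_add_eq_of_contracting
        (isClosed_le continuous_const Complex.continuous_im) ⟨Y, ?_⟩ hc₁ fun x hx => ?_,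
        fun η _ hη => ?_⟩
      · show R / 2 ≤ Y.im
        linarith
      · have := abs_le.1 (him x)
        show R / 2 ≤ (Y - -_).im
        rw [sub_neg_eq_add, Complex.add_im]
        linarith
      · have := abs_le.1 (hYim η hη)
        show R / 2 ≤ η.im
        linarith
    by_cases h2 : Y.im < -R
    · refine ⟨K₂, hs₂, hn₂, hc₂, exists_add_eq_of_contracting
        (isClosed_le Complex.continuous_im continuous_const) ⟨Y, ?_⟩ hc₂ fun x hx => ?_,
        fun η _ hη => ?_⟩
      · show Y.im ≤ -(R / 2)
        linarith
      · have := abs_le.1 (him x)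
        show (Y - -_).im ≤ -(R / 2)
        rw [sub_neg_eq_add, Complex.add_im]
        linarith
      · have := abs_le.1 (hYim η hη)
        show η.im ≤ -(R / 2)
        linarith
    push Not at h1 h2
    have h3 : R < Y.re := by
      rcases hY with h | h
      · exact absurd h (not_lt.2 (abs_le.2 ⟨h2, h1⟩))
      · exact h
    -- here `Y` is to the right and `|Im Y| ≤ R`; the disc of radius `Re Y / 2` around it is
    -- stable
    have hball : Metric.closedBall Y (Y.re / 2) ⊆ K₃ := by
      intro x hx
      rw [Metric.mem_closedBall, dist_eq_norm] at hx
      have := abs_le.1 ((Complex.abs_re_le_norm _).trans hx)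
      rw [Complex.sub_re] at this
      show R / 4 ≤ x.re
      linarith
    refine ⟨K₃, hs₃, hn₃, hc₃, ?_, fun η hηM hη => ?_⟩
    · obtain ⟨x, hx, hxY⟩ := exists_add_eq_of_contracting (Y := Y)
        (K := Metric.closedBall Y (Y.re / 2)) Metric.isClosed_closedBall
        ⟨Y, Metric.mem_closedBall_self (by linarith)⟩
        (fun x hx y hy => hc₃ x (hball hx) y (hball hy)) (fun x hx => by
          have hx1 := hC x (hbig x (hn₃ x (hball hx))).2
          rw [Metric.mem_closedBall, dist_eq_norm] at hx ⊢
          rw [sub_neg_eq_add, add_sub_cancel_left]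
          have h4 : ‖Y‖ ≤ 2 * Y.re := by
            refine (Complex.norm_le_abs_re_add_abs_im Y).trans ?_
            have : |Y.im| ≤ R := abs_le.2 ⟨h2, h1⟩
            rw [abs_of_pos (by linarith : 0 < Y.re)]
            linarith
          have h5 := norm_sub_norm_le x Y
          refine hx1.trans ?_
          linarith)
      exact ⟨x, hball hx, hxY⟩
    · have h4 := hC η (hM.trans (by gcongr))
      have h5 := abs_le.1 (hYim η hη)
      have h6 : |Y.re - η.re| ≤ ‖η‖ / 16 + C := by
        rw [← hη, Complex.add_re, Complex.neg_re, add_sub_cancel_left, abs_neg]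
        exact (Complex.abs_re_le_norm _).trans h4
      have h7 := Complex.norm_le_abs_re_add_abs_im η
      have h8 : |η.im| ≤ 3 / 2 * R := by rw [abs_le]; constructor <;> linarith
      have h9 := (abs_le.1 h6).2
      show R / 4 ≤ η.re
      -- otherwise `Re Y > R` forces `Re η` to be positive and large, the logarithmic term being
      -- small
      by_contra! h10
      rcases abs_cases η.re with ⟨h11, -⟩ | ⟨h11, -⟩ <;> rw [h11] at h7 <;> linarith
  obtain ⟨η, hηK, hη⟩ := hex
  refine ⟨η, ⟨⟨hsK hηK, (hbig η (hnK η hηK)).1⟩, by rw [← hη, timeMap]; ring⟩, ?_⟩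
  rintro η' ⟨⟨-, h2⟩, h3⟩
  have h4 : η' + -((β / k : ℂ) * Complex.log (k * η')) = Y := by rw [← h3, timeMap]; ring
  exact injOn_add_of_contracting hcK (hall η' h2 h4) hηK (h4.trans hη.symm)

/-- Moving by about `1/2` in the coordinate `η` from a point of a small petal does not cross the
slit. -/
theorem log_continues {k : ℕ} (hk : 1 ≤ k) (β : ℝ) :
    ∃ R₀ : ℝ, ∀ R, R₀ ≤ R → ∀ η ∈ Complex.slitPlane, 1 ≤ k * ‖η‖ →
      timeMap k β η ∈ basicPetal R → ∀ m : ℂ, |m.im| < Real.pi →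
      ‖η * Complex.exp m - η - 1 / 2‖ ≤ 1 / 2 →
      η * Complex.exp m ∈ Complex.slitPlane ∧
        Complex.log (k * (η * Complex.exp m)) = Complex.log (k * η) + m := by
  obtain ⟨C, hC0, hC⟩ := exists_log_bound k β
  have hk' : (0 : ℝ) < k := by exact_mod_cast hk
  refine ⟨3 + C + |β| / k * Real.pi, fun R hR η hη hηk hE m hm hd => ?_⟩
  set η' := η * Complex.exp m with hη'
  have him := abs_im_log_term_le k β η
  have hapi : 0 ≤ |β| / k * Real.pi := by positivity
  have h1 := abs_le.1 ((Complex.abs_im_le_norm _).trans hd)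
  have h2 := abs_le.1 ((Complex.abs_re_le_norm _).trans hd)
  have hhalf : (1 / 2 : ℂ) = ((1 / 2 : ℝ) : ℂ) := by push_cast; rfl
  rw [hhalf] at h1 h2
  simp only [Complex.sub_im, Complex.sub_re, Complex.ofReal_re, Complex.ofReal_im] at h1 h2
  -- close to the real axis, a point of the petal has positive real part
  have hcases : (0 < η.re ∧ 0 < η'.re) ∨ (0 < η.im ∧ 0 < η'.im) ∨ (η.im < 0 ∧ η'.im < 0) := by
    by_cases h3 : 2 ≤ η.im
    · exact Or.inr (Or.inl ⟨by linarith, by linarith⟩)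
    by_cases h4 : η.im ≤ -2
    · exact Or.inr (Or.inr ⟨by linarith, by linarith⟩)
    push Not at h3 h4
    left
    have h5 : 1 < η.re := by
      by_contra! h6
      have h7 := hC η hηk
      have h8 := abs_le.1 ((Complex.abs_re_le_norm _).trans h7)
      have h9 := Complex.norm_le_abs_re_add_abs_im η
      have h10 : |η.im| ≤ 2 := abs_le.2 ⟨h4.le, h3.le⟩
      have h11 := abs_le.1 him
      rcases hE with h | h
      · rw [timeMap, Complex.sub_im, lt_abs] at h
        rcases h with h | h <;> linarith
      · rw [timeMap, Complex.sub_re] at h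
        rcases abs_cases η.re with ⟨h11, -⟩ | ⟨h11, -⟩ <;> rw [h11] at h9 <;> linarith
    exact ⟨by linarith, by linarith⟩
  have hkη : (k : ℂ) * (η * Complex.exp m) = (k * η) * Complex.exp m := by ring
  constructor
  · rw [Complex.mem_slitPlane_iff]
    rcases hcases with h | h | h
    · exact Or.inl h.2
    · exact Or.inr h.2.ne'
    · exact Or.inr h.2.ne
  · rw [hkη]
    refine log_mul_exp_of_half_plane hm ?_
    rw [← hkη, ← hη']
    have e1 : ∀ x : ℂ, ((k : ℂ) * x).re = k * x.re := fun x => by simp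
    have e2 : ∀ x : ℂ, ((k : ℂ) * x).im = k * x.im := fun x => by simp
    simp only [e1, e2]
    rcases hcases with h | h | h
    · exact Or.inl ⟨mul_pos hk' h.1, mul_pos hk' h.2⟩
    · exact Or.inr (Or.inl ⟨mul_pos hk' h.1, mul_pos hk' h.2⟩)
    · exact Or.inr (Or.inr ⟨mul_neg_of_pos_of_neg hk' h.1, mul_neg_of_pos_of_neg hk' h.2⟩)

/-! ### Petals -/

/-- `1` for the attracting petals, `-1` for the repelling ones. -/
noncomputable def par (j : ℤ) : ℝ := if Odd j then 1 else -1

theorem par_eq_or (j : ℤ) : par j = 1 ∨ par j = -1 := by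
  unfold par; split_ifs <;> simp

theorem par_mul_self (j : ℤ) : par j * par j = 1 := by
  rcases par_eq_or j with h | h <;> rw [h] <;> norm_num

theorem par_mul_par_mul (j : ℤ) (w : ℂ) : (par j : ℂ) * ((par j : ℂ) * w) = w := by
  rw [← mul_assoc, ← Complex.ofReal_mul, par_mul_self]; simp

theorem par_neg (j : ℤ) : par (-j) = par j := by
  unfold par; simp

theorem abs_par (j : ℤ) : |par j| = 1 := by
  rcases par_eq_or j with h | h <;> rw [h] <;> norm_num

theorem norm_par (j : ℤ) : ‖(par j : ℂ)‖ = 1 := by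
  rw [Complex.norm_real]; exact abs_par j

theorem mem_U_iff {R : ℝ} {j : ℤ} {W : ℂ} : W ∈ U R j ↔ (par j : ℂ) * W ∈ basicPetal R := by
  simp only [U, basicPetal, Set.mem_ofPred_eq, Complex.re_ofReal_mul, Complex.im_ofReal_mul,
    abs_mul, abs_par, one_mul]
  by_cases hj : Odd j
  · have : ¬ Even j := Int.not_even_iff_odd.2 hj
    simp [par, hj, this]
  · have : Even j := Int.not_odd_iff_even.1 hj
    simp only [par, hj, this, true_and, false_and, or_false, if_false]
    rw [neg_one_mul, lt_neg]

theorem par_mul_mem_U {R : ℝ} {j : ℤ} {X : ℂ} (h : X ∈ basicPetal R) : (par j : ℂ) * X ∈ U R j := by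
  rw [mem_U_iff, par_mul_par_mul]; exact h

theorem isOpen_U (R : ℝ) (j : ℤ) : IsOpen (U R j) := by
  have : U R j = (fun W => (par j : ℂ) * W) ⁻¹' basicPetal R := by
    ext W; exact mem_U_iff
  rw [this]
  exact (isOpen_basicPetal R).preimage (by fun_prop)

theorem U_anti {R R' : ℝ} (h : R ≤ R') (j : ℤ) : U R' j ⊆ U R j := fun _ hW =>
  mem_U_iff.2 (basicPetal_anti h (mem_U_iff.1 hW))

theorem lt_norm_of_mem_U {R : ℝ} {j : ℤ} {W : ℂ} (h : W ∈ U R j) : R < ‖W‖ := by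
  have := lt_norm_of_mem_basicPetal (mem_U_iff.1 h)
  rwa [norm_mul, norm_par, one_mul] at this

theorem conj_mem_U {R : ℝ} {j : ℤ} {W : ℂ} (h : W ∈ U R (-j)) : conj W ∈ U R j := by
  simp only [U, Set.mem_ofPred_eq, Complex.conj_im, Complex.conj_re, abs_neg, even_neg,
    odd_neg] at h ⊢
  exact h

theorem mem_U_of_near {R d : ℝ} {j : ℤ} {W V : ℂ} (h : W ∈ U R j) (hd : ‖V - W‖ ≤ d) :
    V ∈ U (R - d) j := by
  rw [mem_U_iff] at h ⊢
  refine mem_basicPetal_of_near h ?_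
  rwa [← mul_sub, norm_mul, norm_par, one_mul]

theorem norm_rot (k : ℕ) (θ : ℝ) (z : ℂ) : ‖rot k θ z‖ = ‖z‖ := by
  rw [rot, norm_mul, ← Complex.ofReal_neg, Complex.norm_exp_ofReal_mul_I, one_mul]

theorem rot_ne_zero {k : ℕ} {θ : ℝ} {z : ℂ} (hz : z ≠ 0) : rot k θ z ≠ 0 := by
  rw [← norm_pos_iff, norm_rot]; exact norm_pos_iff.2 hz

theorem rot_add (k : ℕ) (θ θ' : ℝ) (z : ℂ) : rot k (θ + θ') z = rot k θ (rot k θ' z) := by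
  rw [rot, rot, rot, ← mul_assoc, ← Complex.exp_add]
  congr 2
  push_cast; ring

theorem rot_zero (k : ℕ) (z : ℂ) : rot k 0 z = z := by simp [rot]

theorem rot_mul (k : ℕ) (θ : ℝ) (z w : ℂ) : rot k θ (z * w) = rot k θ z * w := by
  rw [rot, rot, mul_assoc]

theorem conj_rot (k : ℕ) (θ : ℝ) (z : ℂ) : conj (rot k θ z) = rot k (-θ) (conj z) := by
  rw [rot, rot, map_mul, ← Complex.exp_conj, map_mul, Complex.conj_I, map_neg,
    Complex.conj_ofReal]
  congr 2
  push_cast; ring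

theorem rot_pow {k : ℕ} (hk : 1 ≤ k) (j : ℤ) (z : ℂ) :
    rot k j z ^ k = -(par j : ℂ) * z ^ k := by
  have hk0 : (k : ℂ) ≠ 0 := by exact_mod_cast (by omega : k ≠ 0)
  rw [rot, mul_pow, ← Complex.exp_nat_mul]
  congr 1
  have h1 : (k : ℂ) * ((-(j * Real.pi / k : ℝ) : ℂ) * Complex.I) =
      ((-j : ℤ) : ℂ) * (Real.pi * Complex.I) := by
    push_cast; field_simp
  rw [h1, Complex.exp_int_mul, Complex.exp_pi_mul_I]
  by_cases hj : Odd j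
  · rw [Odd.neg_one_zpow hj.neg]; simp [par, hj]
  · rw [Even.neg_one_zpow (Int.not_odd_iff_even.1 hj).neg]; simp [par, hj]

/-- The slit-plane coordinate of a point of the sector around the direction `jπ/k`. -/
noncomputable def slitCoord (k : ℕ) (j : ℤ) (z : ℂ) : ℂ := (k * rot k j z ^ k)⁻¹

theorem norm_slitCoord (k : ℕ) (j : ℤ) (z : ℂ) : ‖slitCoord k j z‖ = (k * ‖z‖ ^ k)⁻¹ := by
  simp [slitCoord, norm_rot]

theorem slitCoord_eq {k : ℕ} (hk : 1 ≤ k) (j : ℤ) (z : ℂ) :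
    slitCoord k j z = par j * (-1 / (k * z ^ k)) := by
  rw [slitCoord, rot_pow hk]
  rcases par_eq_or j with h | h <;> rw [h] <;> push_cast <;> simp [neg_div]

theorem abs_lt_pi_of_lt_pi_div {k : ℕ} (hk : 1 ≤ k) {x : ℝ} (h : |x| < Real.pi / k) :
    |(k : ℝ) * x| < Real.pi := by
  have hk' : (0 : ℝ) < k := by exact_mod_cast hk
  rw [abs_mul, Nat.abs_cast]
  rwa [lt_div_iff₀ hk', mul_comm] at h

theorem mem_slitPlane_of_exp {x : ℂ} (h : |x.im| < Real.pi) :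
    Complex.exp x ∈ Complex.slitPlane := by
  rw [Complex.mem_slitPlane_iff_arg]
  refine ⟨?_, Complex.exp_ne_zero x⟩
  have h1 := abs_lt.1 h
  rw [← Complex.log_im, Complex.log_exp h1.1 h1.2.le]
  exact h1.2.ne

section

variable {k : ℕ} {j : ℤ} {z : ℂ}

theorem natCast_mul_slitCoord (hk : 1 ≤ k) (hz : z ≠ 0) :
    (k : ℂ) * slitCoord k j z = Complex.exp (-(k * Complex.log (rot k j z))) := by
  have hk0 : (k : ℂ) ≠ 0 := by exact_mod_cast (by omega : k ≠ 0)
  rw [Complex.exp_neg, Complex.exp_nat_mul, Complex.exp_log (rot_ne_zero hz), slitCoord]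
  field_simp

theorem abs_im_natCast_mul_log (hk : 1 ≤ k) (h : |Complex.arg (rot k j z)| < Real.pi / k) :
    |(-((k : ℂ) * Complex.log (rot k j z))).im| < Real.pi := by
  have := abs_lt_pi_of_lt_pi_div hk h
  have e : (-((k : ℂ) * Complex.log (rot k j z))).im = -(k * Complex.arg (rot k j z)) := by
    simp [Complex.log_im]
  rwa [e, abs_neg]

theorem log_slitCoord (hk : 1 ≤ k) (hz : z ≠ 0) (h : |Complex.arg (rot k j z)| < Real.pi / k) :
    Complex.log (k * slitCoord k j z) = -(k * Complex.log (rot k j z)) := by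
  have h1 := abs_lt.1 (abs_im_natCast_mul_log hk h)
  rw [natCast_mul_slitCoord hk hz, Complex.log_exp h1.1 h1.2.le]

theorem slitCoord_mem_slitPlane (hk : 1 ≤ k) (hz : z ≠ 0)
    (h : |Complex.arg (rot k j z)| < Real.pi / k) : slitCoord k j z ∈ Complex.slitPlane := by
  have h1 := mem_slitPlane_of_exp (abs_im_natCast_mul_log hk h)
  rw [← natCast_mul_slitCoord hk hz, Complex.mem_slitPlane_iff] at h1
  rw [Complex.mem_slitPlane_iff]
  rcases h1 with h1 | h1
  · left
    simp only [Complex.mul_re, Complex.natCast_re, Complex.natCast_im, zero_mul, sub_zero] at h1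
    exact pos_of_mul_pos_right h1 (Nat.cast_nonneg k)
  · right
    rintro h2
    simp [h2] at h1

/-- In the coordinate `η`, the time coordinates of all the petals are given up to sign by the map
`timeMap`. -/
theorem par_mul_Z (b : ℝ) (hk : 1 ≤ k) (hz : z ≠ 0)
    (h : |Complex.arg (rot k j z)| < Real.pi / k) :
    (par j : ℂ) * Z k b j z = timeMap k (par j * b) (slitCoord k j z) := by
  have hk0 : (k : ℂ) ≠ 0 := by exact_mod_cast (by omega : k ≠ 0)
  rw [timeMap, log_slitCoord hk hz h, slitCoord_eq hk, Z]
  push_cast; field_simp; ring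

theorem exists_slitCoord_eq (hk : 1 ≤ k) (j : ℤ) {η : ℂ} (hη : η ∈ Complex.slitPlane) :
    ∃ z, z ≠ 0 ∧ |Complex.arg (rot k j z)| < Real.pi / k ∧ slitCoord k j z = η := by
  have hk0 : (k : ℂ) ≠ 0 := by exact_mod_cast (by omega : k ≠ 0)
  have hk' : (0 : ℝ) < k := by exact_mod_cast hk
  set y := Complex.exp (-(Complex.log (k * η) / k)) with hy
  have hkη := natCast_mul_mem_slitPlane hk hη
  have hrot : rot k j (rot k (-j) y) = y := by rw [← rot_add]; simp [rot_zero]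
  have harg : |Complex.arg (k * η)| < Real.pi := by
    rw [abs_lt]
    exact ⟨Complex.neg_pi_lt_arg _, lt_of_le_of_ne (Complex.arg_le_pi _)
      (Complex.mem_slitPlane_iff_arg.1 hkη).1⟩
  have him : (-(Complex.log (k * η) / k)).im = -(Complex.arg (k * η) / k) := by
    simp [Complex.log_im]
  have h1 : |(-(Complex.log (k * η) / k)).im| < Real.pi / k := by
    rw [him, abs_neg, abs_div, Nat.abs_cast]
    gcongr
  have h2 : Real.pi / k ≤ Real.pi := div_le_self Real.pi_pos.le (by exact_mod_cast hk)
  have h3 := abs_lt.1 (h1.trans_le h2)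
  refine ⟨rot k (-j) y, rot_ne_zero (Complex.exp_ne_zero _), ?_, ?_⟩
  · rwa [hrot, ← Complex.log_im, hy, Complex.log_exp h3.1 h3.2.le]
  · rw [slitCoord, hrot, hy, ← Complex.exp_nat_mul]
    have : (k : ℂ) * -(Complex.log (k * η) / k) = -Complex.log (k * η) := by field_simp
    rw [this, Complex.exp_neg, Complex.exp_log (Complex.slitPlane_ne_zero hkη)]
    field_simp

theorem slitCoord_injective (hk : 1 ≤ k) {z' : ℂ} (hz : z ≠ 0) (hz' : z' ≠ 0)
    (h : |Complex.arg (rot k j z)| < Real.pi / k) (h' : |Complex.arg (rot k j z')| < Real.pi / k)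
    (he : slitCoord k j z = slitCoord k j z') : z = z' := by
  have hk0 : (k : ℂ) ≠ 0 := by exact_mod_cast (by omega : k ≠ 0)
  have h1 := log_slitCoord hk hz h
  rw [he, log_slitCoord hk hz' h', neg_inj] at h1
  have h2 := congrArg Complex.exp (mul_left_cancel₀ hk0 h1)
  rw [Complex.exp_log (rot_ne_zero hz), Complex.exp_log (rot_ne_zero hz')] at h2
  exact (mul_left_cancel₀ (Complex.exp_ne_zero _) h2).symm

end

/-- The time coordinate maps the petal `S_j` bijectively onto `U_j` once `R` is large. -/
theorem eventually_bijOn_Z {k : ℕ} (hk : 1 ≤ k) (b : ℝ) {r : ℝ} (hr : 0 < r) (hr1 : r ≤ 1) :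
    ∀ᶠ R in atTop, ∀ j : ℤ, Set.BijOn (Z k b j) (S k b r R j) (U R j) := by
  have hk' : (0 : ℝ) < k := by exact_mod_cast hk
  set M : ℝ := (k * r ^ k)⁻¹ with hM
  have hM1 : 1 ≤ k * M := by
    rw [hM, mul_inv, mul_inv_cancel_left₀ hk'.ne']
    exact (one_le_inv₀ (by positivity)).2 (pow_le_one₀ hr.le hr1)
  have hlt : ∀ (j : ℤ) (z : ℂ), z ≠ 0 → (‖z‖ < r ↔ M < ‖slitCoord k j z‖) := by
    intro j z hz
    have hz' := norm_pos_iff.2 hz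
    rw [norm_slitCoord, hM, inv_lt_inv₀ (by positivity) (by positivity),
      mul_lt_mul_iff_right₀ hk']
    exact (pow_lt_pow_iff_left₀ (norm_nonneg z) hr.le (by omega)).symm
  obtain ⟨R₁, h₁⟩ := existsUnique_timeMap_eq hk b hM1
  obtain ⟨R₂, h₂⟩ := existsUnique_timeMap_eq hk (-b) hM1
  filter_upwards [eventually_ge_atTop (max R₁ R₂)] with R hR j
  have hu : ∀ Y ∈ basicPetal R, ∃! η : ℂ, (η ∈ Complex.slitPlane ∧ M < ‖η‖) ∧
      timeMap k (par j * b) η = Y := by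
    rcases par_eq_or j with h | h
    · rw [h, one_mul]; exact h₁ R ((le_max_left _ _).trans hR)
    · rw [h, neg_one_mul]; exact h₂ R ((le_max_right _ _).trans hR)
  refine ⟨fun z hz => hz.2.2.2, ?_, ?_⟩
  · rintro z ⟨hz0, hzr, hza, hzU⟩ w ⟨hw0, hwr, hwa, hwU⟩ hzw
    refine slitCoord_injective (j := j) hk hz0 hw0 hza hwa ?_
    refine (hu _ (mem_U_iff.1 hzU)).unique
      ⟨⟨slitCoord_mem_slitPlane hk hz0 hza, (hlt j z hz0).1 hzr⟩, (par_mul_Z b hk hz0 hza).symm⟩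
      ⟨⟨slitCoord_mem_slitPlane hk hw0 hwa, (hlt j w hw0).1 hwr⟩, ?_⟩
    rw [hzw]
    exact (par_mul_Z b hk hw0 hwa).symm
  · intro W hW
    obtain ⟨η, ⟨⟨hη, hηM⟩, hE⟩, -⟩ := hu _ (mem_U_iff.1 hW)
    obtain ⟨z, hz, hza, rfl⟩ := exists_slitCoord_eq hk j hη
    rw [← par_mul_Z b hk hz hza] at hE
    have hE' : Z k b j z = W := by
      have := congrArg (fun x => (par j : ℂ) * x) hE
      simpa [par_mul_par_mul] using this
    exact ⟨z, ⟨hz, (hlt j z hz).2 hηM, hza, hE' ▸ hW⟩, hE'⟩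

theorem S_anti {k : ℕ} {b r R R' : ℝ} (h : R ≤ R') (j : ℤ) : S k b r R' j ⊆ S k b r R j :=
  fun _ hz => ⟨hz.1, hz.2.1, hz.2.2.1, U_anti h j hz.2.2.2⟩

/-- The time coordinate is at most of the order of `1 / |z| ^ k`. -/
theorem exists_norm_Z_le (k : ℕ) (b : ℝ) {r : ℝ} (hk : 1 ≤ k) : ∃ C : ℝ, 0 < C ∧
    ∀ (j : ℤ) (z : ℂ), z ≠ 0 → ‖z‖ < r → ‖Z k b j z‖ * ‖z‖ ^ k ≤ C := by
  refine ⟨1 + |b| * ((2 + Real.pi) * (1 + |r|) ^ (k + 1)), by positivity, fun j z hz hzr => ?_⟩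
  have ht : 0 < ‖z‖ := norm_pos_iff.2 hz
  set t := ‖z‖ with htdef
  have hk' : (1 : ℝ) ≤ k := by exact_mod_cast hk
  have htr : t ≤ 1 + |r| := by linarith [le_abs_self r]
  have hr1 : 1 ≤ 1 + |r| := by linarith [abs_nonneg r]
  have h1 : ‖Complex.log (rot k j z)‖ ≤ t + t⁻¹ + Real.pi := by
    refine (Complex.norm_le_abs_re_add_abs_im _).trans ?_
    rw [Complex.log_re, Complex.log_im, norm_rot]
    refine add_le_add ?_ (Complex.abs_arg_le_pi _)
    have h2 := Real.log_le_sub_one_of_pos ht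
    have h3 := Real.log_le_sub_one_of_pos (inv_pos.2 ht)
    rw [Real.log_inv] at h3
    have h4 := inv_pos.2 ht
    rw [abs_le]; constructor <;> linarith
  have h2 : (t + t⁻¹ + Real.pi) * t ^ k ≤ (2 + Real.pi) * (1 + |r|) ^ (k + 1) := by
    have e : t⁻¹ * t ^ k = t ^ (k - 1) := by
      obtain ⟨m, rfl⟩ : ∃ m, k = m + 1 := ⟨k - 1, by omega⟩
      rw [pow_succ]; field_simp; simp
    have hpow : ∀ n ≤ k + 1, t ^ n ≤ (1 + |r|) ^ (k + 1) := fun n hn =>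
      (pow_le_pow_left₀ ht.le htr n).trans (pow_le_pow_right₀ hr1 hn)
    have a1 : t * t ^ k ≤ (1 + |r|) ^ (k + 1) := by rw [← pow_succ']; exact hpow _ le_rfl
    have a2 : t⁻¹ * t ^ k ≤ (1 + |r|) ^ (k + 1) := by rw [e]; exact hpow _ (by omega)
    have a3 := mul_le_mul_of_nonneg_left (hpow k (by omega)) Real.pi_pos.le
    nlinarith
  have h3 : ‖(-1 : ℂ) / (k * z ^ k)‖ * t ^ k ≤ 1 := by
    rw [norm_div, norm_neg, norm_one, norm_mul, norm_pow, Complex.norm_natCast, ← htdef]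
    have : 1 / (k * t ^ k) * t ^ k = 1 / (k : ℝ) := by field_simp
    rw [this]
    exact (div_le_one (by linarith)).2 hk'
  calc ‖Z k b j z‖ * t ^ k
      ≤ (‖(-1 : ℂ) / (k * z ^ k)‖ + |b| * ‖Complex.log (rot k j z)‖) * t ^ k := by
        gcongr
        refine (norm_add_le _ _).trans_eq ?_
        rw [norm_mul, Complex.norm_real, Real.norm_eq_abs]
    _ = ‖(-1 : ℂ) / (k * z ^ k)‖ * t ^ k + |b| * (‖Complex.log (rot k j z)‖ * t ^ k) := by ring
    _ ≤ 1 + |b| * ((t + t⁻¹ + Real.pi) * t ^ k) := by gcongr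
    _ ≤ _ := by gcongr

/-- Small petals in the time coordinate correspond to points close to the origin. -/
theorem eventually_norm_lt_of_mem_S {k : ℕ} (hk : 1 ≤ k) (b : ℝ) (r : ℝ) {ρ : ℝ} (hρ : 0 < ρ) :
    ∀ᶠ R in atTop, ∀ (j : ℤ), ∀ z ∈ S k b r R j, ‖z‖ < ρ := by
  obtain ⟨C, hC0, hC⟩ := exists_norm_Z_le k b (r := r) hk
  filter_upwards [eventually_ge_atTop (C / ρ ^ k), eventually_ge_atTop 0] with R hR hR0 j z hz
  by_contra! h
  have h1 := hC j z hz.1 hz.2.1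
  have h2 := lt_norm_of_mem_U hz.2.2.2
  have h3 : ρ ^ k ≤ ‖z‖ ^ k := by gcongr
  have h4 : C ≤ R * ρ ^ k := (div_le_iff₀ (by positivity)).1 hR
  have h5 : R * ρ ^ k < ‖Z k b j z‖ * ‖z‖ ^ k :=
    mul_lt_mul h2 h3 (by positivity) (norm_nonneg _)
  linarith

/-- Within small petals the time coordinate is exactly of the order of `1 / |z| ^ k`. -/
theorem eventually_le_norm_Z {k : ℕ} (hk : 1 ≤ k) (b : ℝ) (r : ℝ) :
    ∀ᶠ R in atTop, ∀ (j : ℤ), ∀ z ∈ S k b r R j, 1 ≤ 2 * k * ‖Z k b j z‖ * ‖z‖ ^ k := by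
  obtain ⟨C₁, hC₁, h₁⟩ := exists_log_bound k b
  obtain ⟨C₂, hC₂, h₂⟩ := exists_log_bound k (-b)
  have hk' : (0 : ℝ) < k := by exact_mod_cast hk
  have hlim : Tendsto (fun t : ℝ => 4 * k * (C₁ + C₂) * t ^ k) (𝓝 0) (𝓝 0) := by
    have : Continuous fun t : ℝ => 4 * k * (C₁ + C₂) * t ^ k := by fun_prop
    simpa [zero_pow (by omega : k ≠ 0)] using this.tendsto 0
  obtain ⟨ρ, hρ, hρ1⟩ := Metric.eventually_nhds_iff.1 (hlim.eventually_le_const one_pos)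
  filter_upwards [eventually_norm_lt_of_mem_S hk b r (lt_min hρ one_pos)] with R hR j z hz
  have hzn := hR j z hz
  rw [lt_min_iff] at hzn
  have hz0 := norm_pos_iff.2 hz.1
  have hsmall := hρ1 (y := ‖z‖) (by simpa using hzn.1)
  have hη := norm_slitCoord k j z
  have hηk : 1 ≤ k * ‖slitCoord k j z‖ := by
    rw [hη, mul_inv, mul_inv_cancel_left₀ hk'.ne']
    exact (one_le_inv₀ (by positivity)).2 (pow_le_one₀ hz0.le hzn.2.le)
  have hb : ‖(par j * b : ℝ) / (k : ℂ) * Complex.log (k * slitCoord k j z)‖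
      ≤ ‖slitCoord k j z‖ / 16 + (C₁ + C₂) := by
    rcases par_eq_or j with h | h
    · rw [h, one_mul]
      exact (h₁ _ hηk).trans (by linarith)
    · rw [h, neg_one_mul]
      exact (h₂ _ hηk).trans (by linarith)
  have h3 : ‖Z k b j z‖ = ‖timeMap k (par j * b) (slitCoord k j z)‖ := by
    rw [← par_mul_Z b hk hz.1 hz.2.2.1, norm_mul, norm_par, one_mul]
  have h4 : ‖slitCoord k j z‖ - (‖slitCoord k j z‖ / 16 + (C₁ + C₂)) ≤ ‖Z k b j z‖ := by
    rw [h3, timeMap]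
    exact (sub_le_sub_left hb _).trans (norm_sub_norm_le _ _)
  have h5 : ‖slitCoord k j z‖ * (k * ‖z‖ ^ k) = 1 := by
    rw [hη]; exact inv_mul_cancel₀ (by positivity)
  have h6 : 0 < k * ‖z‖ ^ k := by positivity
  have h7 := mul_le_mul_of_nonneg_right h4 h6.le
  nlinarith

/-- An angle at most `3 π / 4` stays away from the negative real axis. -/
theorem half_le_cos_or_sin {x : ℝ} (hx : |x| ≤ 3 * Real.pi / 4) :
    1 / 2 ≤ Real.cos x ∨ 1 / 2 ≤ |Real.sin x| := by
  by_contra! h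
  obtain ⟨h1, h2⟩ := h
  have h3 : Real.cos (3 * Real.pi / 4) ≤ Real.cos x := by
    rw [← Real.cos_abs x]
    exact Real.cos_le_cos_of_nonneg_of_le_pi (abs_nonneg x) (by linarith [Real.pi_pos]) hx
  have h4 : Real.cos (3 * Real.pi / 4) = -(√2 / 2) := by
    rw [show 3 * Real.pi / 4 = Real.pi - Real.pi / 4 by ring, Real.cos_pi_sub,
      Real.cos_pi_div_four]
  rw [h4] at h3
  have h5 : √2 ^ 2 = 2 := Real.sq_sqrt (by norm_num)
  have h6 : 0 ≤ √2 := Real.sqrt_nonneg 2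
  have h7 : √2 < 3 / 2 := by nlinarith
  have h8 := Real.sin_sq_add_cos_sq x
  have h9 := sq_abs (Real.sin x)
  have h10 := abs_nonneg (Real.sin x)
  nlinarith

/-- A closed sector around the axis of a petal, strictly narrower than the petal, is contained in
the petal near the origin. -/
theorem eventually_mem_U_of_sector {k : ℕ} (hk : 1 ≤ k) (b R : ℝ) :
    ∀ᶠ z in 𝓝[≠] (0 : ℂ), ∀ j : ℤ, |Complex.arg (rot k j z)| ≤ 3 * Real.pi / (4 * k) →
      Z k b j z ∈ U R j := by
  obtain ⟨C₁, hC₁, h₁⟩ := exists_log_bound k b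
  obtain ⟨C₂, hC₂, h₂⟩ := exists_log_bound k (-b)
  have hk' : (0 : ℝ) < k := by exact_mod_cast hk
  have hlim : Tendsto (fun z : ℂ => 4 * k * (C₁ + C₂ + |R| + 1) * ‖z‖ ^ k) (𝓝 0) (𝓝 0) := by
    have : Continuous fun z : ℂ => 4 * k * (C₁ + C₂ + |R| + 1) * ‖z‖ ^ k := by fun_prop
    simpa [zero_pow (by omega : k ≠ 0)] using this.tendsto 0
  filter_upwards [(hlim.mono_left nhdsWithin_le_nhds).eventually_le_const one_pos,
    (Metric.ball_mem_nhds (0 : ℂ) one_pos |> mem_nhdsWithin_of_mem_nhds :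
      Metric.ball (0 : ℂ) 1 ∈ 𝓝[≠] (0 : ℂ)),
    self_mem_nhdsWithin] with z hsmall hz1 hz j hj
  have hz0 : z ≠ 0 := hz
  have hzp := norm_pos_iff.2 hz0
  have hz1' : ‖z‖ < 1 := by simpa using hz1
  have hη := norm_slitCoord k j z
  have hηk : 1 ≤ k * ‖slitCoord k j z‖ := by
    rw [hη, mul_inv, mul_inv_cancel_left₀ hk'.ne']
    exact (one_le_inv₀ (by positivity)).2 (pow_le_one₀ hzp.le hz1'.le)
  have harg : |Complex.arg (rot k j z)| < Real.pi / k := by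
    refine hj.trans_lt ?_
    rw [div_lt_div_iff₀ (by positivity) hk']
    nlinarith [Real.pi_pos, mul_pos Real.pi_pos hk']
  have hb : ‖(par j * b : ℝ) / (k : ℂ) * Complex.log (k * slitCoord k j z)‖
      ≤ ‖slitCoord k j z‖ / 16 + (C₁ + C₂) := by
    rcases par_eq_or j with h | h
    · rw [h, one_mul]
      exact (h₁ _ hηk).trans (by linarith)
    · rw [h, neg_one_mul]
      exact (h₂ _ hηk).trans (by linarith)
  set η := slitCoord k j z with hηdef
  have h5 : ‖η‖ * (k * ‖z‖ ^ k) = 1 := by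
    rw [hη]; exact inv_mul_cancel₀ (by positivity)
  have h6 : 4 * (C₁ + C₂ + |R| + 1) ≤ ‖η‖ := by
    by_contra! h
    have h7 : 0 < k * ‖z‖ ^ k := by positivity
    nlinarith
  rw [mem_U_iff, par_mul_Z b hk hz0 harg, ← hηdef]
  have hlog := log_slitCoord hk hz0 harg
  have harg' : Complex.arg (k * η) = -(k * Complex.arg (rot k j z)) := by
    rw [← Complex.log_im, hlog]; simp [Complex.log_im]
  have hx : |-(k * Complex.arg (rot k j z))| ≤ 3 * Real.pi / 4 := by
    rw [abs_neg, abs_mul, Nat.abs_cast]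
    calc (k : ℝ) * |Complex.arg (rot k j z)| ≤ k * (3 * Real.pi / (4 * k)) := by gcongr
      _ = _ := by field_simp
  have hre : η.re = ‖η‖ * Real.cos (-(k * Complex.arg (rot k j z))) := by
    have := Complex.norm_mul_cos_arg (k * η)
    rw [harg', norm_mul, Complex.norm_natCast, mul_assoc] at this
    have e : ((k : ℂ) * η).re = k * η.re := by simp
    rw [e] at this
    exact (mul_left_cancel₀ hk'.ne' this).symm
  have him : η.im = ‖η‖ * Real.sin (-(k * Complex.arg (rot k j z))) := by
    have := Complex.norm_mul_sin_arg (k * η)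
    rw [harg', norm_mul, Complex.norm_natCast, mul_assoc] at this
    have e : ((k : ℂ) * η).im = k * η.im := by simp
    rw [e] at this
    exact (mul_left_cancel₀ hk'.ne' this).symm
  have hn := norm_nonneg η
  have hR := le_abs_self R
  have h8 := abs_le.1 ((Complex.abs_re_le_norm _).trans hb)
  have h9 := (Complex.abs_im_le_norm _).trans hb
  -- the argument of `η` is at most `3 π / 4` in absolute value, so that `Re η` or `|Im η|` is
  -- at least `‖η‖ / 2`, and this dominates the logarithmic term
  rcases half_le_cos_or_sin hx with h | h
  · right
    rw [timeMap, Complex.sub_re]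
    have h10 : ‖η‖ / 2 ≤ η.re := by rw [hre]; nlinarith
    linarith [abs_nonneg R]
  · left
    rw [timeMap, Complex.sub_im]
    have h10 : ‖η‖ / 2 ≤ |η.im| := by rw [him, abs_mul, abs_of_nonneg hn]; nlinarith
    have h11 := abs_sub_abs_le_abs_sub η.im
      ((par j * b : ℝ) / (k : ℂ) * Complex.log (k * η)).im
    linarith [abs_nonneg R]

theorem arg_conj_rot {k : ℕ} (hk : 1 ≤ k) {j : ℤ} {z : ℂ}
    (h : |Complex.arg (rot k (-j : ℤ) z)| < Real.pi / k) :
    |Complex.arg (rot k j (conj z))| < Real.pi / k ∧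
      Complex.log (rot k j (conj z)) = conj (Complex.log (rot k (-j : ℤ) z)) := by
  have h1 : Real.pi / k ≤ Real.pi := div_le_self Real.pi_pos.le (by exact_mod_cast hk)
  have h2 : Complex.arg (rot k (-j : ℤ) z) ≠ Real.pi := by
    have := (abs_lt.1 h).2
    linarith
  have h3 : rot k j (conj z) = conj (rot k (-j : ℤ) z) := by
    rw [conj_rot]; push_cast; rw [neg_neg]
  rw [h3, Complex.arg_conj, if_neg h2, abs_neg]
  exact ⟨h, Complex.log_conj _ h2⟩

theorem Z_conj {k : ℕ} (hk : 1 ≤ k) {b : ℝ} {j : ℤ} {z : ℂ}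
    (h : |Complex.arg (rot k (-j : ℤ) z)| < Real.pi / k) :
    Z k b j (conj z) = conj (Z k b (-j) z) := by
  rw [Z, Z, (arg_conj_rot hk h).2]
  simp

/-! ### Antiholomorphic germs in the time coordinate -/

/-- The variation of the time coordinate from `z` to `z * exp l`. -/
noncomputable def timeShift (k : ℕ) (b : ℝ) (z l : ℂ) : ℂ :=
  (1 - Complex.exp (-(k * l))) / (k * z ^ k) + b * l

/-- The antiholomorphic germ `γ(z) = conj z * exp (ℓ z)` is, in the time coordinate and up to
complex conjugation, the translation by `ε / 2`, with an error of order `z ^ (k + 1)`. -/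
structure HalfStep (k : ℕ) (b : ℝ) (γ ℓ : ℂ → ℂ) (ε : ℝ) : Prop where
  tendsto : Tendsto ℓ (𝓝[≠] 0) (𝓝 0)
  map_eq : ∀ᶠ z in 𝓝[≠] (0 : ℂ), γ z = conj z * Complex.exp (ℓ z)
  shift : (fun z => timeShift k b (conj z) (ℓ z) - (ε / 2 : ℝ)) =O[𝓝[≠] 0]
    fun z => z ^ (k + 1)

theorem HalfStep.tendsto_shift {k : ℕ} {b : ℝ} {γ ℓ : ℂ → ℂ} {ε : ℝ} (h : HalfStep k b γ ℓ ε) :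
    Tendsto (fun z => timeShift k b (conj z) (ℓ z) - (ε / 2 : ℝ)) (𝓝[≠] 0) (𝓝 0) := by
  refine h.shift.trans_tendsto ?_
  have : Tendsto (fun z : ℂ => z ^ (k + 1)) (𝓝 0) (𝓝 0) := by
    simpa using (continuous_pow (k + 1)).tendsto (0 : ℂ)
  exact this.mono_left nhdsWithin_le_nhds

theorem par_mul_timeShift {k : ℕ} (hk : 1 ≤ k) (b : ℝ) (j : ℤ) (z l : ℂ) :
    (par j : ℂ) * (timeShift k b z l - b * l) =
      slitCoord k j z * Complex.exp (-(k * l)) - slitCoord k j z := by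
  rw [slitCoord_eq hk, timeShift]; ring

theorem neg_one_div_mul_exp {k : ℕ} (z l : ℂ) :
    -1 / (k * (z * Complex.exp l) ^ k) =
      -1 / (k * z ^ k) + (1 - Complex.exp (-(k * l))) / (k * z ^ k) := by
  rw [mul_pow, ← Complex.exp_nat_mul, Complex.exp_neg]
  have := Complex.exp_ne_zero (k * l)
  rw [← mul_assoc, ← div_div, ← add_div]
  rw [div_right_comm]
  congr 1
  field_simp; ring

/-- A half step maps the petals deep inside `S_{-j}` into `S_j`, in the way prescribed by the time
coordinate. -/
theorem HalfStep.eventually_mapsTo {k : ℕ} (hk : 1 ≤ k) {b : ℝ} {γ ℓ : ℂ → ℂ} {ε : ℝ}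
    (h : HalfStep k b γ ℓ ε) {r : ℝ} (hr : 0 < r) :
    ∀ᶠ R in atTop, ∀ j : ℤ, par j = ε → ∀ z ∈ S k b r R (-j),
      γ z ∈ S k b r (R - 1) j ∧
        Z k b j (γ z) = conj (Z k b (-j) z) + timeShift k b (conj z) (ℓ z) := by
  have hk' : (0 : ℝ) < k := by exact_mod_cast hk
  set c : ℝ := 1 / (4 * (k + |b|)) with hc
  have hc0 : 0 < c := by positivity
  have e1 := h.tendsto.norm.eventually_le_const (u := c) (by simpa using hc0)
  have e2 := h.tendsto_shift.norm.eventually_le_const (u := 1 / 4) (by simp)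
  obtain ⟨ρ, hρ, hball⟩ := Metric.mem_nhdsWithin_iff.1 (h.map_eq.and (e1.and e2))
  obtain ⟨R₁, h₁⟩ := log_continues hk (ε * b)
  filter_upwards [eventually_norm_lt_of_mem_S hk b r (lt_min (lt_min hρ one_pos)
    (by positivity : 0 < r / 3)), eventually_ge_atTop R₁] with R hR hR₁ j hj z hz
  have hzn := hR (-j) z hz
  simp only [lt_min_iff] at hzn
  obtain ⟨⟨hzρ, hz1⟩, hzr⟩ := hzn
  obtain ⟨hmap, hl, hs⟩ := hball ⟨by simpa using hzρ, hz.1⟩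
  have hz0 := hz.1
  have hzp := norm_pos_iff.2 hz0
  have hcz0 : conj z ≠ 0 := (map_ne_zero _).2 hz0
  set l := ℓ z with hldef
  set w := conj z with hw
  obtain ⟨harg, hlogc⟩ := arg_conj_rot hk hz.2.2.1
  have hZc := Z_conj (b := b) hk hz.2.2.1
  set η := slitCoord k j w with hη
  have hkl : k * ‖l‖ ≤ 1 / 4 := by
    calc (k : ℝ) * ‖l‖ ≤ k * c := by gcongr
      _ ≤ 1 / 4 := by
        rw [hc, mul_one_div, div_le_iff₀ (by positivity)]; linarith [abs_nonneg b]
  have hbl : |b| * ‖l‖ ≤ 1 / 4 := by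
    calc |b| * ‖l‖ ≤ |b| * c := by gcongr
      _ ≤ 1 / 4 := by
        rw [hc, mul_one_div, div_le_iff₀ (by positivity)]; linarith
  have hηk : 1 ≤ k * ‖η‖ := by
    rw [hη, norm_slitCoord, mul_inv, mul_inv_cancel_left₀ hk'.ne', hw, Complex.norm_conj]
    exact (one_le_inv₀ (by positivity)).2 (pow_le_one₀ hzp.le hz1.le)
  have hE : timeMap k (ε * b) η ∈ basicPetal R := by
    rw [← hj, hη, ← par_mul_Z b hk hcz0 harg, hZc]
    exact mem_U_iff.1 (conj_mem_U hz.2.2.2)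
  have hm : ‖-((k : ℂ) * l)‖ ≤ 1 / 4 := by
    rw [norm_neg, norm_mul, Complex.norm_natCast]; exact hkl
  have hmim : |(-((k : ℂ) * l)).im| < Real.pi :=
    ((Complex.abs_im_le_norm _).trans hm).trans_lt (by linarith [Real.pi_gt_three])
  -- in the coordinate `η` the half step moves the point by about `1 / 2`, which does not cross
  -- the slit
  have hdist : ‖η * Complex.exp (-(k * l)) - η - 1 / 2‖ ≤ 1 / 2 := by
    rw [hη, ← par_mul_timeShift hk b]
    have e : (par j : ℂ) * (timeShift k b w l - b * l) - 1 / 2 =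
        (par j : ℂ) * (timeShift k b w l - (ε / 2 : ℝ)) - (par j : ℂ) * (b * l) := by
      have : (par j : ℂ) * (ε / 2 : ℝ) = 1 / 2 := by
        rw [← hj]; push_cast
        rw [← mul_div_assoc, ← Complex.ofReal_mul, par_mul_self]; simp
      linear_combination this
    rw [e]
    refine (norm_sub_le _ _).trans ?_
    rw [norm_mul, norm_mul, norm_par, one_mul, one_mul, norm_mul, Complex.norm_real,
      Real.norm_eq_abs]
    linarith
  obtain ⟨hslit, hlog⟩ := h₁ R hR₁ η (slitCoord_mem_slitPlane hk hcz0 harg) hηk hE _ hmim hdist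
  have hπk : Real.pi / k ≤ Real.pi := div_le_self Real.pi_pos.le (by exact_mod_cast hk)
  rw [hη, log_slitCoord hk hcz0 harg, ← hη] at hlog
  -- the logarithm of the image is the continuation of the logarithm of the source
  have him : |(Complex.log (rot k j w) + l).im| < Real.pi / k := by
    have e : (Complex.log (rot k j w) + l).im =
        -(Complex.arg (k * (η * Complex.exp (-(k * l))))) / k := by
      rw [← Complex.log_im, hlog]
      simp only [Complex.add_im, Complex.neg_im]
      have e2 : ∀ x : ℂ, ((k : ℂ) * x).im = k * x.im := fun x => by simp
      rw [e2, e2]; field_simp; ring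
    rw [e, abs_div, abs_neg, Nat.abs_cast]
    gcongr
    have := Complex.mem_slitPlane_iff_arg.1 (natCast_mul_mem_slitPlane hk hslit)
    exact abs_lt.2 ⟨Complex.neg_pi_lt_arg _, lt_of_le_of_ne (Complex.arg_le_pi _) this.1⟩
  have hrot : rot k j (γ z) = Complex.exp (Complex.log (rot k j w) + l) := by
    rw [hmap, rot_mul, Complex.exp_add, Complex.exp_log (rot_ne_zero hcz0)]
  have hlogγ : Complex.log (rot k j (γ z)) = Complex.log (rot k j w) + l := by
    have := abs_lt.1 (him.trans_le hπk)
    rw [hrot, Complex.log_exp this.1 this.2.le]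
  have hγ0 : γ z ≠ 0 := by rw [hmap]; exact mul_ne_zero hcz0 (Complex.exp_ne_zero _)
  have hZ : Z k b j (γ z) = conj (Z k b (-j) z) + timeShift k b w l := by
    rw [← hZc, Z, Z, hlogγ, hmap, neg_one_div_mul_exp, timeShift]; ring
  refine ⟨⟨hγ0, ?_, ?_, ?_⟩, hZ⟩
  · rw [hmap, norm_mul, hw, Complex.norm_conj]
    have h3 : ‖l‖ ≤ 1 := by
      have : (1 : ℝ) ≤ k := by exact_mod_cast hk
      nlinarith [norm_nonneg l]
    have h4 : ‖Complex.exp l‖ ≤ Real.exp 1 := by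
      rw [Complex.norm_exp]
      exact Real.exp_le_exp.2 ((Complex.re_le_norm l).trans h3)
    have h5 := Real.exp_one_lt_d9
    have h6 : ‖z‖ * ‖Complex.exp l‖ ≤ ‖z‖ * Real.exp 1 := by gcongr
    nlinarith
  · rw [← Complex.log_im, hlogγ]; exact him
  · rw [hZ]
    refine mem_U_of_near (conj_mem_U hz.2.2.2) ?_
    rw [add_sub_cancel_left]
    have h3 : ‖timeShift k b w l‖ ≤ ‖timeShift k b w l - (ε / 2 : ℝ)‖ + ‖((ε / 2 : ℝ) : ℂ)‖ := by
      simpa using norm_add_le (timeShift k b w l - (ε / 2 : ℝ)) ((ε / 2 : ℝ) : ℂ)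
    have h4 : ‖((ε / 2 : ℝ) : ℂ)‖ = 1 / 2 := by
      rw [Complex.norm_real, Real.norm_eq_abs, abs_div, ← hj, abs_par]; norm_num
    linarith

/-! ### The second iterate of a half step as a near-translation -/

theorem mem_slitPlane_of_abs_arg_lt {k : ℕ} (hk : 1 ≤ k) {y : ℂ} (hy : y ≠ 0)
    (h : |Complex.arg y| < Real.pi / k) : y ∈ Complex.slitPlane := by
  have h1 : Real.pi / k ≤ Real.pi := div_le_self Real.pi_pos.le (by exact_mod_cast hk)
  exact Complex.mem_slitPlane_iff_arg.2 ⟨(((abs_lt.1 h).2).trans_le h1).ne, hy⟩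

theorem hasDerivAt_Z {k : ℕ} (hk : 1 ≤ k) (b : ℝ) {j : ℤ} {z : ℂ} (hz : z ≠ 0)
    (h : |Complex.arg (rot k j z)| < Real.pi / k) :
    HasDerivAt (Z k b j) (1 / z ^ (k + 1) + b / z) z := by
  have hk0 : (k : ℂ) ≠ 0 := by exact_mod_cast (by omega : k ≠ 0)
  have hrot : HasDerivAt (fun z => rot k j z) (rot k j 1) z := by
    have := (hasDerivAt_id z).const_mul (Complex.exp (-(j * Real.pi / k : ℝ) * Complex.I))
    exact this.congr_deriv (by simp [rot])
  have hlog := (hrot.clog (mem_slitPlane_of_abs_arg_lt hk (rot_ne_zero hz) h)).const_mul (b : ℂ)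
  have hpow : HasDerivAt (fun z : ℂ => -1 / (k * z ^ k)) (1 / z ^ (k + 1)) z := by
    have h1 := ((hasDerivAt_pow k z).const_mul (k : ℂ)).inv
      (mul_ne_zero hk0 (pow_ne_zero k hz))
    have h2 := h1.neg
    refine (h2.congr_of_eventuallyEq (Eventually.of_forall fun w => ?_)).congr_deriv ?_
    · simp [div_eq_mul_inv]
    · obtain ⟨m, rfl⟩ : ∃ m, k = m + 1 := ⟨k - 1, by omega⟩
      simp only [Nat.add_sub_cancel]
      field_simp
      ring
  refine (hpow.add hlog).congr_deriv ?_
  have e : rot k j z = rot k j 1 * z := by rw [← rot_mul, one_mul]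
  have h1 : rot k j 1 ≠ 0 := rot_ne_zero one_ne_zero
  rw [e]; field_simp

theorem isOpen_S {k : ℕ} (hk : 1 ≤ k) (b r R : ℝ) (j : ℤ) : IsOpen (S k b r R j) := by
  rw [isOpen_iff_mem_nhds]
  rintro z ⟨h1, h2, h3, h4⟩
  have c1 : ContinuousAt (fun z => |Complex.arg (rot k j z)|) z := by
    have hr : ContinuousAt (fun z => rot k j z) z := by unfold rot; fun_prop
    have := Complex.continuousAt_arg (mem_slitPlane_of_abs_arg_lt hk (rot_ne_zero h1) h3)
    exact (ContinuousAt.comp (f := fun z => rot k j z) this hr).abs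
  have c2 : ContinuousAt (Z k b j) z := (hasDerivAt_Z hk b h1 h3).continuousAt
  filter_upwards [isOpen_ne.mem_nhds h1,
    (isOpen_lt continuous_norm continuous_const).mem_nhds h2, c1.eventually_lt_const h3,
    c2.eventually_mem ((isOpen_U R j).mem_nhds h4)] with w w1 w2 w3 w4
  exact ⟨w1, w2, w3, w4⟩

theorem differentiableOn_Z {k : ℕ} (hk : 1 ≤ k) (b r R : ℝ) (j : ℤ) :
    DifferentiableOn ℂ (Z k b j) (S k b r R j) := fun _ hz =>
  (hasDerivAt_Z hk b hz.1 hz.2.2.1).differentiableAt.differentiableWithinAt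

/-- The second iterate of `γ`, read in the time coordinate of the `j`-th petal and reflected for
the repelling petals. -/
noncomputable def petalMap (k : ℕ) (b r R : ℝ) (j : ℤ) (γ : ℂ → ℂ) (X : ℂ) : ℂ :=
  par j * Z k b j (γ (γ (Function.invFunOn (Z k b j) (S k b r R j) (par j * X))))

section

variable {k : ℕ} {b : ℝ} {γ ℓ : ℂ → ℂ} {ε r R : ℝ} {j : ℤ}

theorem petalMap_apply (hR : Set.BijOn (Z k b j) (S k b r R j) (U R j)) {z : ℂ}
    (hz : z ∈ S k b r R j) :
    petalMap k b r R j γ (par j * Z k b j z) = par j * Z k b j (γ (γ z)) := by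
  rw [petalMap, par_mul_par_mul, hR.injOn.leftInvOn_invFunOn hz]

theorem invFunOn_Z_mem (hR : Set.BijOn (Z k b j) (S k b r R j) (U R j)) {R' : ℝ} (h : R ≤ R')
    {X : ℂ} (hX : X ∈ basicPetal R') :
    Function.invFunOn (Z k b j) (S k b r R j) (par j * X) ∈ S k b r R' j ∧
      (par j : ℂ) * Z k b j (Function.invFunOn (Z k b j) (S k b r R j) (par j * X)) = X := by
  have hW : (par j : ℂ) * X ∈ Z k b j '' S k b r R j := by
    rw [hR.image_eq]; exact U_anti h j (par_mul_mem_U hX)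
  have h1 := Function.invFunOn_mem hW
  have h2 := Function.invFunOn_eq hW
  refine ⟨⟨h1.1, h1.2.1, h1.2.2.1, ?_⟩, ?_⟩
  · rw [h2]; exact par_mul_mem_U hX
  · rw [h2, par_mul_par_mul]

theorem differentiableAt_invFunOn_Z (hk : 1 ≤ k) :
    ∀ᶠ z in 𝓝[≠] (0 : ℂ), ∀ (r R : ℝ) (j : ℤ), Set.BijOn (Z k b j) (S k b r R j) (U R j) →
      z ∈ S k b r R j →
      DifferentiableAt ℂ (Function.invFunOn (Z k b j) (S k b r R j)) (Z k b j z) := by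
  have hlim : Tendsto (fun z : ℂ => 1 + (b : ℂ) * z ^ k) (𝓝[≠] 0) (𝓝 1) := by
    have : Continuous fun z : ℂ => 1 + (b : ℂ) * z ^ k := by fun_prop
    have h := this.tendsto 0
    simp only [zero_pow (by omega : k ≠ 0), mul_zero, add_zero] at h
    exact h.mono_left nhdsWithin_le_nhds
  filter_upwards [hlim.eventually_ne one_ne_zero] with z hz r R j hR hzS
  refine differentiableAt_invFunOn (isOpen_S hk b r R j) (differentiableOn_Z hk b r R j)
    hR.injOn hzS ?_
  rw [(hasDerivAt_Z hk b hzS.1 hzS.2.2.1).deriv]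
  have h0 := hzS.1
  have e : 1 / z ^ (k + 1) + b / z = (1 + b * z ^ k) / z ^ (k + 1) := by
    rw [pow_succ]; field_simp
  rw [e]
  exact div_ne_zero hz (pow_ne_zero _ h0)

/-- Two half steps starting deep in a petal. -/
theorem HalfStep.eventually_two_steps (hk : 1 ≤ k) (h : HalfStep k b γ ℓ ε) (hr : 0 < r) :
    ∀ᶠ R' in atTop, ∀ j : ℤ, par j = ε → ∀ R'' ≥ R', ∀ z ∈ S k b r R'' j,
      γ z ∈ S k b r (R'' - 1) (-j) ∧ γ (γ z) ∈ S k b r (R'' - 2) j ∧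
      Z k b (-j) (γ z) = conj (Z k b j z) + timeShift k b (conj z) (ℓ z) ∧
      Z k b j (γ (γ z)) = conj (Z k b (-j) (γ z)) + timeShift k b (conj (γ z)) (ℓ (γ z)) := by
  obtain ⟨R₁, h₁⟩ := eventually_atTop.1 (h.eventually_mapsTo hk hr)
  filter_upwards [eventually_ge_atTop (R₁ + 1)] with R' hR' j hj R'' hR'' z hz
  have h2 := h₁ R'' (by linarith) (-j) (by rw [par_neg, hj]) z (by rwa [neg_neg])
  rw [neg_neg] at h2
  have h3 := h₁ (R'' - 1) (by linarith) j hj (γ z) h2.1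
  refine ⟨h2.1, ?_, h2.2, h3.2⟩
  have e : R'' - 2 = R'' - 1 - 1 := by ring
  rw [e]
  exact h3.1

/-- On a petal which it contracts, the second iterate of a half step is a near-translation in the
time coordinate: its error is of order `z ^ (k + 1)`, that is `‖X‖ ^ (-(1 + 1 / k))`, it is
holomorphic, and it is injective because the half step is. -/
theorem HalfStep.exists_nearTranslation (hk : 1 ≤ k) (h : HalfStep k b γ ℓ ε) (hr : 0 < r)
    (hd : ∀ᶠ z in 𝓝 (0 : ℂ), DifferentiableAt ℂ (fun z => γ (γ z)) z)
    (hinj : ∃ ρ > 0, Set.InjOn γ (Metric.ball 0 ρ)) (hj : par j = ε)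
    (hR : Set.BijOn (Z k b j) (S k b r R j) (U R j)) :
    ∀ᶠ R' in atTop, ∃ C, NearTranslation (petalMap k b r R j γ) R' (1 + 1 / k) C := by
  have hk' : (0 : ℝ) < k := by exact_mod_cast hk
  obtain ⟨C₀, hC₀, hO⟩ := h.shift.exists_pos
  rw [IsBigOWith] at hO
  obtain ⟨C₁, hC₁, hZ⟩ := exists_norm_Z_le k b (r := r) hk
  obtain ⟨ρ₁, hρ₁, hinj⟩ := hinj
  obtain ⟨ρ₂, hρ₂, hball⟩ := Metric.mem_nhdsWithin_iff.1
    (hO.and ((h.tendsto_shift.norm.eventually_le_const (u := 1 / 2) (by simp)).and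
      ((differentiableAt_invFunOn_Z (b := b) hk).and (hd.filter_mono nhdsWithin_le_nhds))))
  obtain ⟨R₁, hR₁⟩ := eventually_atTop.1
    (eventually_norm_lt_of_mem_S hk b r (lt_min hρ₁ hρ₂))
  filter_upwards [h.eventually_two_steps hk hr, eventually_ge_atTop (R₁ + 2),
    eventually_ge_atTop (R + 2), eventually_ge_atTop 2] with R' hstep hR' hR'R hR'2
  set s : ℝ := 1 + 1 / k with hs
  have hs1 : 1 < s := by rw [hs]; linarith [one_div_pos.2 hk']
  refine ⟨C₀ * (C₁ ^ s + (2 * C₁) ^ s), hs1, by positivity, ?_, ?_, ?_⟩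
  -- holomorphy
  · intro X hX
    obtain ⟨hz, hzX⟩ := invFunOn_Z_mem hR (by linarith : R ≤ R') hX
    set z := Function.invFunOn (Z k b j) (S k b r R j) (par j * X) with hzdef
    have hzn := hR₁ R' (by linarith) j z hz
    rw [lt_min_iff] at hzn
    obtain ⟨-, -, hψ, hγγ⟩ := hball ⟨by simpa using hzn.2, hz.1⟩
    have hzR := S_anti (by linarith : R ≤ R') j hz
    have h1 := hψ r R j hR hzR
    have e : (par j : ℂ) * X = Z k b j z := by rw [← hzX, par_mul_par_mul]
    rw [← e] at h1
    have h2 := (hstep j hj R' le_rfl z hz).2.1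
    have h3 := (hasDerivAt_Z hk b h2.1 h2.2.2.1).differentiableAt
    have h4 : DifferentiableAt ℂ (fun X : ℂ => (par j : ℂ) * X) X := by fun_prop
    have h5 : DifferentiableAt ℂ
        (fun X : ℂ => Function.invFunOn (Z k b j) (S k b r R j) (par j * X)) X := h1.comp X h4
    have h6 : DifferentiableAt ℂ (fun X : ℂ =>
        γ (γ (Function.invFunOn (Z k b j) (S k b r R j) (par j * X)))) X :=
      DifferentiableAt.comp (g := fun z => γ (γ z)) X hγγ h5
    exact ((DifferentiableAt.comp (g := Z k b j) X h3 h6).const_mul _).differentiableWithinAt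
  -- injectivity
  · intro X hX Y hY hXY
    obtain ⟨hz, hzX⟩ := invFunOn_Z_mem hR (by linarith : R ≤ R') hX
    obtain ⟨hw, hwY⟩ := invFunOn_Z_mem hR (by linarith : R ≤ R') hY
    rw [petalMap, petalMap] at hXY
    set z := Function.invFunOn (Z k b j) (S k b r R j) (par j * X) with hzdef
    set w := Function.invFunOn (Z k b j) (S k b r R j) (par j * Y) with hwdef
    have hz' := hstep j hj R' le_rfl z hz
    have hw' := hstep j hj R' le_rfl w hw
    have h1 : Z k b j (γ (γ z)) = Z k b j (γ (γ w)) := by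
      have := congrArg (fun x => (par j : ℂ) * x) hXY
      simpa only [par_mul_par_mul] using this
    have h2 := hR.injOn (S_anti (by linarith) j hz'.2.1) (S_anti (by linarith) j hw'.2.1) h1
    have hnear : ∀ (i : ℤ) (R'' : ℝ), R' - 1 ≤ R'' → ∀ x ∈ S k b r R'' i, x ∈ Metric.ball 0 ρ₁ := by
      intro i R'' hR'' x hx
      have := hR₁ R'' (by linarith) i x hx
      rw [lt_min_iff] at this
      simpa using this.1
    have h3 := hinj (hnear _ _ le_rfl _ hz'.1) (hnear _ _ le_rfl _ hw'.1) h2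
    have h4 := hinj (hnear _ _ (by linarith) _ hz) (hnear _ _ (by linarith) _ hw) h3
    rw [← hzX, ← hwY, h4]
  -- the error term
  · intro X hX
    obtain ⟨hz, hzX⟩ := invFunOn_Z_mem hR (by linarith : R ≤ R') hX
    rw [petalMap]
    set z := Function.invFunOn (Z k b j) (S k b r R j) (par j * X) with hzdef
    obtain ⟨m1, m2, e1, e2⟩ := hstep j hj R' le_rfl z hz
    have hzn := hR₁ R' (by linarith) j z hz
    have hγn := hR₁ (R' - 1) (by linarith) (-j) (γ z) m1
    rw [lt_min_iff] at hzn hγn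
    obtain ⟨o1, h6, -⟩ := hball ⟨by simpa using hzn.2, hz.1⟩
    obtain ⟨o2, -⟩ := hball ⟨by simpa using hγn.2, m1.1⟩
    have hXn : R' < ‖X‖ := lt_norm_of_mem_basicPetal hX
    have hX0 : 0 < ‖X‖ := by linarith
    have hnZ : ‖Z k b j z‖ = ‖X‖ := by rw [← hzX, norm_mul, norm_par, one_mul]
    -- a point whose time coordinate is large is small
    have hsmall : ∀ (i : ℤ) (x : ℂ) (c : ℝ), 0 < c → x ≠ 0 → ‖x‖ < r → ‖X‖ ≤ c * ‖Z k b i x‖ →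
        ‖x‖ ^ (k + 1) ≤ (c * C₁) ^ s * ‖X‖ ^ (-s) := by
      intro i x c hc hx hxr hxX
      have h1 := hZ i x hx hxr
      have h2 : ‖x‖ ^ k ≤ c * C₁ / ‖X‖ := by
        rw [le_div_iff₀ hX0]
        calc ‖x‖ ^ k * ‖X‖ ≤ ‖x‖ ^ k * (c * ‖Z k b i x‖) := by gcongr
          _ = c * (‖Z k b i x‖ * ‖x‖ ^ k) := by ring
          _ ≤ c * C₁ := by gcongr
      have h3 : ‖x‖ ^ (k + 1) = (‖x‖ ^ k) ^ s := by
        rw [← Real.rpow_natCast, ← Real.rpow_natCast, ← Real.rpow_mul (norm_nonneg x), hs]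
        congr 1
        push_cast; field_simp
      rw [h3]
      calc (‖x‖ ^ k) ^ s ≤ (c * C₁ / ‖X‖) ^ s := by gcongr
        _ = _ := by
          rw [Real.div_rpow (by positivity) hX0.le, Real.rpow_neg hX0.le, div_eq_mul_inv]
    have s1 := hsmall j z 1 one_pos hz.1 hz.2.1 (by rw [one_mul, hnZ])
    have hD2 : ‖timeShift k b (conj z) (ℓ z)‖ ≤ ‖X‖ / 2 := by
      have h4 : ‖((ε / 2 : ℝ) : ℂ)‖ = 1 / 2 := by
        rw [Complex.norm_real, Real.norm_eq_abs, abs_div, ← hj, abs_par]; norm_num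
      have h5 : ‖timeShift k b (conj z) (ℓ z)‖ ≤
          ‖timeShift k b (conj z) (ℓ z) - (ε / 2 : ℝ)‖ + ‖((ε / 2 : ℝ) : ℂ)‖ := by
        simpa using norm_add_le (timeShift k b (conj z) (ℓ z) - (ε / 2 : ℝ)) ((ε / 2 : ℝ) : ℂ)
      linarith
    have s2 := hsmall (-j) (γ z) 2 two_pos m1.1 m1.2.1 (by
      rw [e1]
      have h3 := norm_sub_le_norm_add (conj (Z k b j z)) (timeShift k b (conj z) (ℓ z))
      rw [Complex.norm_conj, hnZ] at h3
      linarith)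
    have e : (par j : ℂ) * Z k b j (γ (γ z)) - X - 1 =
        (par j : ℂ) * (conj (timeShift k b (conj z) (ℓ z) - (ε / 2 : ℝ)) +
          (timeShift k b (conj (γ z)) (ℓ (γ z)) - (ε / 2 : ℝ))) := by
      have h3 : (par j : ℂ) * (ε / 2 : ℝ) = 1 / 2 := by
        rw [← hj]; push_cast
        rw [← mul_div_assoc, ← Complex.ofReal_mul, par_mul_self]; simp
      rw [e2, e1, map_sub, Complex.conj_ofReal, map_add, Complex.conj_conj]
      linear_combination hzX + 2 * h3
    rw [e, norm_mul, norm_par, one_mul]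
    calc _ ≤ ‖timeShift k b (conj z) (ℓ z) - (ε / 2 : ℝ)‖ +
          ‖timeShift k b (conj (γ z)) (ℓ (γ z)) - (ε / 2 : ℝ)‖ := by
          refine (norm_add_le _ _).trans_eq ?_
          rw [Complex.norm_conj]
      _ ≤ C₀ * ‖z ^ (k + 1)‖ + C₀ * ‖γ z ^ (k + 1)‖ := add_le_add o1 o2
      _ ≤ C₀ * ((1 * C₁) ^ s * ‖X‖ ^ (-s)) + C₀ * ((2 * C₁) ^ s * ‖X‖ ^ (-s)) := by
          rw [norm_pow, norm_pow]
          gcongr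
      _ = _ := by rw [one_mul]; ring

end

/-! ### Fatou coordinates -/

theorem conj_half : conj (1 / 2 : ℂ) = 1 / 2 := by
  rw [map_div₀, map_one, map_ofNat]

/-- A germ `g` and its local inverse, which are half steps in opposite directions. -/
structure LocalDynamics (k : ℕ) (b : ℝ) (g g' ℓ ℓ' : ℂ → ℂ) : Prop where
  step : HalfStep k b g ℓ 1
  step_inv : HalfStep k b g' ℓ' (-1)
  left_inv : ∀ᶠ z in 𝓝 (0 : ℂ), g' (g z) = z
  right_inv : ∀ᶠ z in 𝓝 (0 : ℂ), g (g' z) = z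
  differentiableAt : ∀ᶠ z in 𝓝 (0 : ℂ), DifferentiableAt ℂ (fun z => g (g z)) z
  differentiableAt_inv : ∀ᶠ z in 𝓝 (0 : ℂ), DifferentiableAt ℂ (fun z => g' (g' z)) z

/-- The choice between a germ and its inverse whose second iterate is attracted to the origin in
the `j`-th petal. -/
noncomputable def contractingBranch (g g' : ℂ → ℂ) (j : ℤ) : ℂ → ℂ := if Odd j then g else g'

theorem contractingBranch_neg (g g' : ℂ → ℂ) (j : ℤ) :
    contractingBranch g g' (-j) = contractingBranch g g' j := by
  unfold contractingBranch; simp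

section

variable {k : ℕ} {b : ℝ} {γ ℓ Φ : ℂ → ℂ} {ε r R₀ R' R : ℝ} {j : ℤ}

/-- The orbits of `petalMap` are the orbits of the second iterate read in the time coordinate. -/
theorem iterate_petalMap (hR₀ : Set.BijOn (Z k b j) (S k b r R₀ j) (U R₀ j)) (hR' : R₀ + 2 ≤ R')
    (hstep : ∀ z ∈ S k b r R' j, γ (γ z) ∈ S k b r (R' - 2) j)
    (hΦ : IsNormalizedFatou (petalMap k b r R₀ j γ) R' R Φ) {z : ℂ} (hz : z ∈ S k b r R j)
    (n : ℕ) : (fun z => γ (γ z))^[n] z ∈ S k b r R' j ∧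
      (petalMap k b r R₀ j γ)^[n] (par j * Z k b j z) =
        par j * Z k b j ((fun z => γ (γ z))^[n] z) := by
  induction n with
  | zero => exact ⟨S_anti hΦ.le j hz, rfl⟩
  | succ n ih =>
    obtain ⟨h1, h2⟩ := ih
    have h3 := hstep _ h1
    have h4 : (petalMap k b r R₀ j γ)^[n + 1] (par j * Z k b j z) =
        par j * Z k b j ((fun z => γ (γ z))^[n + 1] z) := by
      rw [Function.iterate_succ_apply', h2, petalMap_apply hR₀ (S_anti (by linarith) j h1),
        Function.iterate_succ_apply']
    refine ⟨?_, h4⟩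
    rw [Function.iterate_succ_apply']
    refine ⟨h3.1, h3.2.1, h3.2.2.1, ?_⟩
    rw [mem_U_iff]
    have h5 := hΦ.orbit_mem _ (mem_U_iff.1 hz.2.2.2) (n + 1)
    rwa [h4, Function.iterate_succ_apply'] at h5

/-- In a petal contracted by the half step, the orbits converge to the origin. -/
theorem tendsto_iterate_zero (hk : 1 ≤ k)
    (hR₀ : Set.BijOn (Z k b j) (S k b r R₀ j) (U R₀ j)) (hR' : R₀ + 2 ≤ R')
    (hstep : ∀ z ∈ S k b r R' j, γ (γ z) ∈ S k b r (R' - 2) j)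
    (hΦ : IsNormalizedFatou (petalMap k b r R₀ j γ) R' R Φ) {z : ℂ} (hz : z ∈ S k b r R j) :
    Tendsto (fun n : ℕ => (fun z => γ (γ z))^[n] z) atTop (𝓝[≠] 0) := by
  have horb := iterate_petalMap hR₀ hR' hstep hΦ hz
  refine tendsto_nhdsWithin_iff.2 ⟨?_, Eventually.of_forall fun n => (horb n).1.1⟩
  rw [Metric.tendsto_nhds]
  intro ρ hρ
  obtain ⟨R₁, hR₁⟩ := (eventually_norm_lt_of_mem_S hk b r hρ).exists
  have h1 : ∀ᶠ n : ℕ in atTop, R₁ + 1 - (par j * Z k b j z).re < (n : ℝ) :=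
    tendsto_natCast_atTop_atTop.eventually_gt_atTop _
  filter_upwards [h1] with n hn
  rw [dist_zero_right]
  have h2 := (horb n).1
  refine hR₁ j _ ⟨h2.1, h2.2.1, h2.2.2.1, ?_⟩
  rw [mem_U_iff, ← (horb n).2]
  right
  have h3 := (Complex.abs_re_le_norm _).trans
    (hΦ.orbit_near _ (mem_U_iff.1 hz.2.2.2) n)
  simp only [Complex.sub_re, Complex.add_re, Complex.natCast_re, abs_le] at h3
  linarith

/-- The normalized Fatou coordinates on the petals `j` and `-j` are exchanged by a half step. -/
theorem normalized_map {Φ' : ℂ → ℂ} {R'' : ℝ} (hk : 1 ≤ k) (h : HalfStep k b γ ℓ ε)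
    (hj : par j = ε)
    (hR₀ : Set.BijOn (Z k b j) (S k b r R₀ j) (U R₀ j))
    (hR₀' : Set.BijOn (Z k b (-j)) (S k b r R₀ (-j)) (U R₀ (-j)))
    (hR' : R₀ + 2 ≤ R') (hR'' : R₀ + 2 ≤ R'')
    (hstep : ∀ z ∈ S k b r R' j, γ (γ z) ∈ S k b r (R' - 2) j)
    (hstep' : ∀ z ∈ S k b r R'' (-j), γ (γ z) ∈ S k b r (R'' - 2) (-j) ∧
      Z k b j (γ z) = conj (Z k b (-j) z) + timeShift k b (conj z) (ℓ z))
    (hΦ : IsNormalizedFatou (petalMap k b r R₀ j γ) R' R Φ)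
    (hΦ' : IsNormalizedFatou (petalMap k b r R₀ (-j) γ) R'' R Φ')
    {z : ℂ} (hz : z ∈ S k b r R (-j)) (hγz : γ z ∈ S k b r R j) :
    Φ (par j * Z k b j (γ z)) = conj (Φ' (par j * Z k b (-j) z)) + 1 / 2 := by
  have horb := iterate_petalMap hR₀ hR' hstep hΦ hγz
  have horb' := iterate_petalMap hR₀' hR'' (fun z hz => (hstep' z hz).1) hΦ' hz
  have hto := tendsto_iterate_zero hk hR₀' hR'' (fun z hz => (hstep' z hz).1) hΦ' hz
  have h1 := hΦ.tendsto _ (mem_U_iff.1 hγz.2.2.2)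
  have h2 := hΦ'.tendsto _ (mem_U_iff.1 hz.2.2.2)
  have h3 := (Complex.continuous_conj.tendsto _).comp h2
  have h4 := ((h.tendsto_shift.comp hto).add_const ((ε / 2 : ℝ) : ℂ)).const_mul (par j : ℂ)
  have h5 := h3.add h4
  rw [par_neg] at h5
  have e : (par j : ℂ) * (0 + (ε / 2 : ℝ)) = 1 / 2 := by
    rw [← hj]; push_cast
    rw [zero_add, ← mul_div_assoc, ← Complex.ofReal_mul, par_mul_self]; simp
  rw [e] at h5
  refine tendsto_nhds_unique h1 (h5.congr fun n => ?_)
  have hcomm : (fun z => γ (γ z))^[n] (γ z) = γ ((fun z => γ (γ z))^[n] z) :=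
    (Function.Commute.iterate_left (f := fun z => γ (γ z)) (g := γ) (fun _ => rfl) n z)
  have h6 := (horb' n).2
  rw [par_neg] at h6
  simp only [Function.comp]
  rw [(horb n).2, h6, hcomm, (hstep' _ (horb' n).1).2]
  simp only [map_sub, map_mul, Complex.conj_ofReal, map_natCast]
  ring

end

namespace LocalDynamics

variable {k : ℕ} {b : ℝ} {g g' ℓ ℓ' : ℂ → ℂ}

/-- On every petal, the contracting branch is a half step in the contracting direction, its second
iterate is holomorphic, and it is injective near the origin. -/
theorem branch (h : LocalDynamics k b g g' ℓ ℓ') (j : ℤ) :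
    HalfStep k b (contractingBranch g g' j) (contractingBranch ℓ ℓ' j) (par j) ∧
    (∀ᶠ z in 𝓝 (0 : ℂ), DifferentiableAt ℂ
      (fun z => contractingBranch g g' j (contractingBranch g g' j z)) z) ∧
    ∃ ρ > 0, Set.InjOn (contractingBranch g g' j) (Metric.ball 0 ρ) := by
  have inj : ∀ {u v : ℂ → ℂ}, (∀ᶠ z in 𝓝 (0 : ℂ), v (u z) = z) →
      ∃ ρ > 0, Set.InjOn u (Metric.ball 0 ρ) := by
    intro u v huv
    obtain ⟨ρ, hρ, hb⟩ := Metric.eventually_nhds_iff_ball.1 huv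
    refine ⟨ρ, hρ, fun x hx y hy hxy => ?_⟩
    rw [← hb x hx, ← hb y hy, hxy]
  unfold contractingBranch par
  split_ifs with hj
  · exact ⟨h.step, h.differentiableAt, inj h.left_inv⟩
  · exact ⟨h.step_inv, h.differentiableAt_inv, inj h.right_inv⟩

/-- On every petal there is a normalized Fatou coordinate. -/
theorem exists_normalized (h : LocalDynamics k b g g' ℓ ℓ') (hk : 1 ≤ k) {r R₀ : ℝ} (hr : 0 < r)
    (j : ℤ) (hR₀ : Set.BijOn (Z k b j) (S k b r R₀ j) (U R₀ j)) (R₁ : ℝ) :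
    ∃ R' R Φ, R₀ + 2 ≤ R' ∧ R₁ ≤ R' ∧
      IsNormalizedFatou (petalMap k b r R₀ j (contractingBranch g g' j)) R' R Φ ∧
      ∀ R'' ≥ R', ∀ z ∈ S k b r R'' j,
        contractingBranch g g' j z ∈ S k b r (R'' - 1) (-j) ∧
        contractingBranch g g' j (contractingBranch g g' j z) ∈ S k b r (R'' - 2) j ∧
        Z k b (-j) (contractingBranch g g' j z) =
          conj (Z k b j z) + timeShift k b (conj z) (contractingBranch ℓ ℓ' j z) := by
  obtain ⟨h1, h2, h3⟩ := h.branch j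
  obtain ⟨R', ⟨C, hC⟩, hs, hR', hR₁⟩ := ((h1.exists_nearTranslation hk hr h2 h3 rfl hR₀).and
    ((h1.eventually_two_steps hk hr).and ((eventually_ge_atTop (R₀ + 2)).and
      (eventually_ge_atTop R₁)))).exists
  obtain ⟨R, Φ, hΦ⟩ := hC.exists_isNormalizedFatou
  refine ⟨R', R, Φ, hR', hR₁, hΦ, fun R'' hR'' z hz => ?_⟩
  obtain ⟨a1, a2, a3, -⟩ := hs j rfl R'' hR'' z hz
  exact ⟨a1, a2, a3⟩

theorem rot_natCast_neg (k : ℕ) : rot k ((-(k : ℤ) : ℤ) : ℝ) = rot k ((k : ℤ) : ℝ) := by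
  funext z
  rcases Nat.eq_zero_or_pos k with rfl | hk
  · simp
  have hk0 : (k : ℂ) ≠ 0 := by exact_mod_cast hk.ne'
  rw [rot, rot]
  congr 1
  have e1 : (-((((-(k : ℤ) : ℤ) : ℝ) * Real.pi / k : ℝ) : ℂ)) * Complex.I =
      Real.pi * Complex.I := by
    push_cast; field_simp
  have e2 : (-((((k : ℤ) : ℝ) * Real.pi / k : ℝ) : ℂ)) * Complex.I =
      -(Real.pi * Complex.I) := by
    push_cast; field_simp
  rw [e1, e2, Complex.exp_neg, Complex.exp_pi_mul_I]; norm_num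

theorem Z_natCast_neg (k : ℕ) (b : ℝ) : Z k b (-(k : ℤ)) = Z k b k := by
  funext z
  rw [Z, Z, rot_natCast_neg]

theorem U_neg (R : ℝ) (j : ℤ) : U R (-j) = U R j := by
  ext W; rw [mem_U_iff, mem_U_iff, par_neg]

theorem S_natCast_neg (k : ℕ) (b r R : ℝ) : S k b r R (-(k : ℤ)) = S k b r R k := by
  ext z
  simp only [S, Set.mem_ofPred_eq, rot_natCast_neg, Z_natCast_neg, U_neg]

/-- The local dynamics of a prenormalized germ provides Fatou coordinates. -/
theorem nonempty_fatouCoordinates (h : LocalDynamics k b g g' ℓ ℓ') (hk : 1 ≤ k)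
    {f p : ℂ → ℂ} (hp : Conjugates p f g) (hpre : IsPrenormalized g k b)
    (hanti : ∀ᶠ z in 𝓝 (0 : ℂ), DifferentiableAt ℂ (fun z => g (conj z)) z) :
    Nonempty (FatouCoordinates f k b) := by
  obtain ⟨ρ, hρ, hball⟩ := Metric.eventually_nhds_iff_ball.1 (h.left_inv.and hanti)
  set r := min ρ 1 with hrdef
  have hr : 0 < r := lt_min hρ one_pos
  have hsub : Metric.ball (0 : ℂ) r ⊆ Metric.ball 0 ρ := Metric.ball_subset_ball (min_le_left _ _)
  obtain ⟨R₀, hR₀⟩ := eventually_atTop.1 (eventually_bijOn_Z hk b hr (min_le_right _ _))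
  -- on each petal the normalized Fatou coordinate of the second iterate of the contracting
  -- branch
  choose R' R₁ Φ hR' _ hΦ hstep using fun j : ℤ =>
    h.exists_normalized hk hr j (hR₀ R₀ le_rfl j) R₀
  have hfin : ∀ᶠ R in atTop, ∀ j ∈ Finset.Icc (-(k : ℤ)) k, R₁ j ≤ R :=
    (Filter.eventually_all_finset _).2 fun j _ => eventually_ge_atTop (R₁ j)
  -- a common size of the petals
  obtain ⟨R, hR1, hR2, hR3⟩ := (hfin.and ((eventually_ge_atTop R₀).and
    (eventually_gt_atTop (2 * Real.pi * |b| / k)))).exists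
  have hN : ∀ j : ℤ, |j| ≤ k →
      IsNormalizedFatou (petalMap k b r R₀ j (contractingBranch g g' j)) (R' j) R (Φ j) :=
    fun j hj => (hΦ j).mono (hR1 j (Finset.mem_Icc.2 (abs_le.1 hj)))
  have hopen : ∀ j : ℤ, Set.MapsTo (fun W : ℂ => (par j : ℂ) * W) (U R j) (basicPetal R) :=
    fun j W hW => mem_U_iff.1 hW
  -- the relation between the petals `j` and `-j`, for a point mapped by the contracting branch
  have hmap : ∀ j : ℤ, |j| ≤ k → ∀ z ∈ S k b r R (-j),
      contractingBranch g g' j z ∈ S k b r R j →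
      Φ j (par j * Z k b j (contractingBranch g g' j z)) =
        conj (Φ (-j) (par j * Z k b (-j) z)) + 1 / 2 := by
    intro j hj z hz hγz
    have hN' := hN (-j) (by rwa [abs_neg])
    have hs' := hstep (-j)
    rw [contractingBranch_neg] at hN' hs'
    rw [contractingBranch_neg] at hs'
    refine normalized_map hk (h.branch j).1 rfl (hR₀ R₀ le_rfl j) (hR₀ R₀ le_rfl (-j)) (hR' j)
      (hR' (-j)) (fun z hz => (hstep j (R' j) le_rfl z hz).2.1) (fun z hz => ?_) (hN j hj) hN'
      hz hγz
    have := hs' (R' (-j)) le_rfl z hz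
    rw [neg_neg] at this
    exact ⟨this.2.1, this.2.2⟩
  refine ⟨⟨g, p, hp, hpre, r, R, hr, ?_, ?_, hR3, fun j _ => hR₀ R hR2 j,
    fun j W => par j * Φ j (par j * W), ?_, ?_, ?_, ?_⟩⟩
  · exact fun z hz => (hball z (hsub hz)).2.differentiableWithinAt
  · intro x hx y hy hxy
    rw [← (hball x (hsub hx)).1, ← (hball y (hsub hy)).1, hxy]
  · intro j hj
    exact ((hN j hj).holomorphic.comp (by fun_prop) (hopen j)).const_mul _
  · intro j hj W hW V hV hWV
    have h1 := congrArg (fun x => (par j : ℂ) * x) hWV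
    simp only [par_mul_par_mul] at h1
    have h2 := congrArg (fun x => (par j : ℂ) * x) ((hN j hj).injOn (hopen j hW) (hopen j hV) h1)
    simpa only [par_mul_par_mul] using h2
  · intro W hW
    have h1 := hN k (by simp)
    have h2 := hN (-(k : ℤ)) (by simp)
    have e : petalMap k b r R₀ (-(k : ℤ)) (contractingBranch g g' (-(k : ℤ))) =
        petalMap k b r R₀ k (contractingBranch g g' k) := by
      funext X
      rw [petalMap, petalMap, contractingBranch_neg, Z_natCast_neg, S_natCast_neg, par_neg]
    rw [e] at h2
    simp only [par_neg]
    congr 1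
    exact tendsto_nhds_unique (h2.tendsto _ (hopen k hW)) (h1.tendsto _ (hopen k hW))
  · intro j hj z hz hgz
    by_cases hodd : Odd j
    · have h1 := hmap j hj z hz (by simpa [contractingBranch, hodd] using hgz)
      simp only [contractingBranch, hodd, if_true] at h1
      simpa [par, hodd] using h1
    · have hzr : z ∈ Metric.ball 0 ρ := hsub (by simpa using hz.2.1)
      have e : contractingBranch g g' (-j) (g z) = z := by
        simp only [contractingBranch, odd_neg, hodd, if_false]
        exact (hball z hzr).1
      have h1 := hmap (-j) (by rwa [abs_neg]) (g z) (by rwa [neg_neg]) (by rwa [e])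
      rw [e, neg_neg] at h1
      simp only [par, odd_neg, hodd, if_false] at h1 ⊢
      push_cast at h1 ⊢
      rw [h1]
      simp only [map_mul, map_neg, map_one, map_add, conj_half, Complex.conj_conj]
      ring

end LocalDynamics

/-! ### Asymptotics of arbitrary Fatou coordinates -/

namespace FatouCoordinates

variable {f : ℂ → ℂ} {k : ℕ} {b : ℝ} {g' ℓ ℓ' : ℂ → ℂ}

/-- Any Fatou coordinate differs from the normalized one by a translation. -/
theorem exists_eq_normalized (T : FatouCoordinates f k b) (hk : 1 ≤ k)
    (h : LocalDynamics k b T.g g' ℓ ℓ') {j : ℤ} (hj : |j| ≤ k) (R₁ : ℝ) :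
    ∃ R' R Φ c, T.R + 2 ≤ R' ∧ R₁ ≤ R' ∧
      IsNormalizedFatou (petalMap k b T.r T.R j (contractingBranch T.g g' j)) R' R Φ ∧
      (∀ R'' ≥ R', ∀ z ∈ S k b T.r R'' j,
        contractingBranch T.g g' j (contractingBranch T.g g' j z) ∈ S k b T.r (R'' - 2) j) ∧
      ∀ X ∈ basicPetal R, (par j : ℂ) * T.Φ j (par j * X) = Φ X + c := by
  obtain ⟨ρ, hρ, hball⟩ := Metric.eventually_nhds_iff_ball.1 h.right_inv
  obtain ⟨R₂, hR₂⟩ := eventually_atTop.1 (eventually_norm_lt_of_mem_S hk b T.r hρ)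
  have hbij := T.time_bijOn j hj
  obtain ⟨R', R, Φ, hR', hR₁, hΦ, hstep⟩ := h.exists_normalized hk T.r_pos j hbij
    (max R₁ (R₂ + 1))
  have hR₂' : R₂ + 1 ≤ R' := (le_max_right _ _).trans hR₁
  have hTR : T.R ≤ R := by linarith [hΦ.le]
  have hmaps : Set.MapsTo (fun X : ℂ => (par j : ℂ) * X) (basicPetal R) (U T.R j) :=
    fun X hX => U_anti hTR j (par_mul_mem_U hX)
  -- the second iterate of the contracting branch is, read by the given Fatou coordinate, the
  -- unit translation, and that coordinate is injective
  obtain ⟨c, hc⟩ := hΦ.eq_add_const (Ψ := fun X => (par j : ℂ) * T.Φ j (par j * X)) le_rfl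
    (((T.Φ_holomorphic j hj).comp (by fun_prop) hmaps).const_mul _) (by
      intro X hX hFX
      obtain ⟨hz, hzX⟩ := invFunOn_Z_mem hbij hTR hX
      rw [petalMap, par_mul_par_mul]
      set z := Function.invFunOn (Z k b j) (S k b T.r T.R j) (par j * X) with hzdef
      have e : (par j : ℂ) * X = Z k b j z := by rw [← hzX, par_mul_par_mul]
      rw [e]
      obtain ⟨a1, a2, -⟩ := hstep R hΦ.le z hz
      have m0 := S_anti hTR j hz
      have m1 := S_anti (by linarith [hΦ.le] : T.R ≤ R - 1) (-j) a1
      have m2 := S_anti (by linarith [hΦ.le] : T.R ≤ R - 2) j a2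
      by_cases hodd : Odd j
      · simp only [contractingBranch, hodd, if_true, par] at m1 m2 ⊢
        have p1 := T.Φ_map (-j) (by rwa [abs_neg]) z (by rwa [neg_neg]) m1
        have p2 := T.Φ_map j hj (T.g z) m1 m2
        rw [p2, p1, neg_neg, map_add, conj_half, Complex.conj_conj]
        push_cast; ring
      · simp only [contractingBranch, hodd, if_false, par] at a1 m1 m2 ⊢
        have i1 : T.g (g' z) = z := hball z (by
          simpa using hR₂ R (by linarith [hΦ.le]) j z hz)
        have i2 : T.g (g' (g' z)) = g' z := hball (g' z) (by
          simpa using hR₂ (R - 1) (by linarith [hΦ.le]) (-j) _ a1)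
        have p1 := T.Φ_map j hj (g' z) m1 (by rwa [i1])
        have p2 := T.Φ_map (-j) (by rwa [abs_neg]) (g' (g' z)) (by rwa [neg_neg])
          (by rwa [i2])
        rw [i1] at p1
        rw [i2, neg_neg] at p2
        rw [p1, p2, map_add, conj_half, Complex.conj_conj]
        push_cast; ring)
    (Or.inl (by
      intro X hX Y hY hXY
      have h1 := congrArg (fun x => (par j : ℂ) * x) hXY
      simp only [par_mul_par_mul] at h1
      have h2 := congrArg (fun x => (par j : ℂ) * x)
        (T.Φ_injective j hj (hmaps hX) (hmaps hY) h1)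
      simpa only [par_mul_par_mul] using h2))
  exact ⟨R', R, Φ, c, hR', (le_max_left _ _).trans hR₁, hΦ,
    fun R'' hR'' z hz => (hstep R'' hR'' z hz).2.1, hc⟩

/-- Every Fatou coordinate is asymptotic to a translation. -/
theorem exists_asymptotic (T : FatouCoordinates f k b) (hk : 1 ≤ k)
    (h : LocalDynamics k b T.g g' ℓ ℓ') {j : ℤ} (hj : |j| ≤ k) :
    ∃ c : ℂ, ∀ ε > 0, ∀ᶠ R in atTop, ∀ W ∈ U R j, ‖T.Φ j W - W - c‖ ≤ ε := by
  obtain ⟨R', R, Φ, c, -, -, hΦ, -, hc⟩ := T.exists_eq_normalized hk h hj 0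
  refine ⟨par j * c, fun ε hε => ?_⟩
  obtain ⟨R₁, hR₁⟩ := hΦ.asymptotic ε hε
  filter_upwards [eventually_ge_atTop R, eventually_ge_atTop R₁] with R₂ h1 h2 W hW
  have hX := mem_U_iff.1 hW
  have e := hc _ (basicPetal_anti h1 hX)
  rw [par_mul_par_mul] at e
  have h3 := hR₁ _ (basicPetal_anti h2 hX)
  have e2 : (par j : ℂ) * (T.Φ j W - W - par j * c) = Φ (par j * W) - par j * W := by
    rw [mul_sub, mul_sub, e, par_mul_par_mul]; ring
  have e3 : ‖T.Φ j W - W - par j * c‖ = ‖(par j : ℂ) * (T.Φ j W - W - par j * c)‖ := by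
    rw [norm_mul, norm_par, one_mul]
  rw [e3, e2]
  exact h3

end FatouCoordinates

/-! ### The flow of the normal form -/

/-- `z ^ k` times the variation of the time coordinate from `z` to `z * exp l`, as a function of
`x = z ^ k` and `l`. -/
noncomputable def logShift (k : ℕ) (b : ℝ) (x l : ℂ) : ℂ :=
  (1 - Complex.exp (-(k * l))) / k + b * x * l

theorem pow_mul_timeShift {k : ℕ} (b : ℝ) {z : ℂ} (hz : z ≠ 0) (l : ℂ) :
    z ^ k * timeShift k b z l = logShift k b (z ^ k) l := by
  rw [timeShift, logShift, mul_add, ← div_div, mul_div_cancel₀ _ (pow_ne_zero k hz)]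
  ring

theorem hasStrictFDerivAt_logShift {k : ℕ} (hk : 1 ≤ k) (b : ℝ) :
    HasStrictFDerivAt (fun p : ℂ × ℂ => (p.1, logShift k b p.1 p.2))
      ((ContinuousLinearEquiv.refl ℂ (ℂ × ℂ) : (ℂ × ℂ) ≃L[ℂ] (ℂ × ℂ)) : (ℂ × ℂ) →L[ℂ] (ℂ × ℂ)) 0 := by
  have hk0 : (k : ℂ) ≠ 0 := by exact_mod_cast (by omega : k ≠ 0)
  have h1 : HasStrictFDerivAt (fun p : ℂ × ℂ => p.1) (ContinuousLinearMap.fst ℂ ℂ ℂ) 0 :=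
    hasStrictFDerivAt_fst
  have h2 : HasStrictFDerivAt (fun p : ℂ × ℂ => p.2) (ContinuousLinearMap.snd ℂ ℂ ℂ) 0 :=
    hasStrictFDerivAt_snd
  have h3 := (((h2.const_mul (k : ℂ)).neg.cexp).const_sub 1).mul_const ((k : ℂ)⁻¹)
  have h4 := (h1.const_mul (b : ℂ)).mul h2
  have h5 := h1.prodMk (h3.add h4)
  refine (h5.congr_fderiv ?_).congr_of_eventuallyEq (Eventually.of_forall fun p => ?_)
  · refine ContinuousLinearMap.ext fun p => ?_
    refine Prod.ext ?_ ?_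
    · simp
    · simp [hk0]
  · simp [logShift, div_eq_mul_inv]

/-- Small solutions `l` of `logShift k b x l = τ` are unique. -/
theorem logShift_injective {k : ℕ} (hk : 1 ≤ k) (b : ℝ) : ∃ δ > 0, ∀ x l l' : ℂ, ‖x‖ < δ →
    ‖l‖ < δ → ‖l'‖ < δ → logShift k b x l = logShift k b x l' → l = l' := by
  have h := (hasStrictFDerivAt_logShift hk b).eventually_left_inverse
  obtain ⟨δ, hδ, hb⟩ := Metric.eventually_nhds_iff_ball.1 h
  refine ⟨δ, hδ, fun x l l' hx hl hl' he => ?_⟩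
  have h1 := hb (x, l) (by simp [Prod.norm_def, hx, hl])
  have h2 := hb (x, l') (by simp [Prod.norm_def, hx, hl'])
  simp only [he] at h1
  have := h1.symm.trans h2
  exact (Prod.mk.inj this).2

/-- A holomorphic solution of `logShift k b x l = τ`. -/
theorem exists_logShift_inverse {k : ℕ} (hk : 1 ≤ k) (b : ℝ) : ∃ lam : ℂ × ℂ → ℂ, lam 0 = 0 ∧
    (∀ᶠ p in 𝓝 (0 : ℂ × ℂ), DifferentiableAt ℂ lam p) ∧
    (∀ᶠ p in 𝓝 (0 : ℂ × ℂ), logShift k b p.1 (lam p) = p.2) := by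
  have hs := hasStrictFDerivAt_logShift hk b
  have hc : ContDiffAt ℂ 1 (fun p : ℂ × ℂ => (p.1, logShift k b p.1 p.2)) 0 := by
    unfold logShift
    fun_prop
  have h0 : ((0 : ℂ × ℂ).1, logShift k b (0 : ℂ × ℂ).1 (0 : ℂ × ℂ).2) = 0 := by
    simp [logShift]
  set Λ := hc.localInverse hs.hasFDerivAt one_ne_zero with hΛ
  have hd : ContDiffAt ℂ 1 Λ 0 := by
    have := hc.to_localInverse hs.hasFDerivAt one_ne_zero
    rwa [h0] at this
  have hr : ∀ᶠ p in 𝓝 (0 : ℂ × ℂ), ((Λ p).1, logShift k b (Λ p).1 (Λ p).2) = p := by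
    have := hs.eventually_right_inverse
    rw [h0] at this
    exact this
  refine ⟨fun p => (Λ p).2, ?_, ?_, ?_⟩
  · have := hc.localInverse_apply_image hs.hasFDerivAt one_ne_zero
    rw [h0] at this
    simp [hΛ, this]
  · filter_upwards [hd.eventually (by simp)] with p hp
    exact (hp.differentiableAt one_ne_zero).snd
  · filter_upwards [hr] with p hp
    have h1 := congrArg Prod.fst hp
    have h2 := congrArg Prod.snd hp
    simp only at h1 h2
    rw [← h1]
    exact h2

/-- For a holomorphic germ `δ`, the point reached from `z` by the flow of the normal form in the
complex time `δ(z)`; its formula is `z * exp (ℓ z)`. -/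
theorem exists_flow_along {k : ℕ} (hk : 1 ≤ k) (b : ℝ) {δ : ℂ → ℂ} (hδ : AnalyticAt ℂ δ 0) :
    ∃ ℓ : ℂ → ℂ, Tendsto ℓ (𝓝 0) (𝓝 0) ∧
      IsHolomorphicDiffeo (fun z => z * Complex.exp (ℓ z)) ∧
      ∀ᶠ z in 𝓝[≠] (0 : ℂ), timeShift k b z (ℓ z) = δ z := by
  obtain ⟨lam, h0, hd, hs⟩ := exists_logShift_inverse hk b
  have hk0 : k ≠ 0 := by omega
  set u : ℂ → ℂ × ℂ := fun z => (z ^ k, δ z * z ^ k) with hu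
  have hua : ∀ᶠ z in 𝓝 (0 : ℂ), DifferentiableAt ℂ u z := by
    filter_upwards [hδ.eventually_analyticAt] with z hz
    have := hz.differentiableAt
    fun_prop
  have hu0 : u 0 = 0 := by simp [hu, hk0]
  have hut : Tendsto u (𝓝 0) (𝓝 0) := by
    have := hua.self_of_nhds.continuousAt.tendsto
    rwa [hu0] at this
  have hℓd : ∀ᶠ z in 𝓝 (0 : ℂ), DifferentiableAt ℂ (fun z => lam (u z)) z := by
    filter_upwards [hua, hut.eventually hd] with z h1 h2
    exact h2.comp z h1
  have hℓ0 : lam (u 0) = 0 := by rw [hu0, h0]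
  refine ⟨fun z => lam (u z), ?_, ⟨?_, by simp, ?_⟩, ?_⟩
  · have := hℓd.self_of_nhds.continuousAt.tendsto
    rwa [hℓ0] at this
  · rw [Complex.analyticAt_iff_eventually_differentiableAt]
    filter_upwards [hℓd] with z hz
    exact differentiableAt_id.mul hz.cexp
  · have h1 := (hasDerivAt_id (0 : ℂ)).mul hℓd.self_of_nhds.hasDerivAt.cexp
    have h2 : HasDerivAt (fun z => z * Complex.exp (lam (u z))) _ 0 := h1
    rw [h2.deriv, hℓ0]
    simp
  · filter_upwards [(hut.eventually hs).filter_mono nhdsWithin_le_nhds, self_mem_nhdsWithin]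
      with z h1 hz
    have hz0 : z ≠ 0 := hz
    have h2 := pow_mul_timeShift (k := k) b hz0 (lam (u z))
    refine mul_left_cancel₀ (pow_ne_zero k hz0) (h2.trans ?_)
    have h3 : logShift k b (z ^ k) (lam (u z)) = δ z * z ^ k := h1
    rw [h3, mul_comm]

/-- Integral curves of the normal form, in closed form. -/
theorem exists_integralCurve {k : ℕ} (hk : 1 ≤ k) (b : ℝ) : ∃ lam : ℂ × ℂ → ℂ, lam 0 = 0 ∧
    ContinuousAt lam 0 ∧
    (∀ᶠ p in 𝓝 (0 : ℂ × ℂ), logShift k b p.1 (lam p) = p.2) ∧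
    ∀ᶠ z in 𝓝 (0 : ℂ), ∀ s ∈ Set.Icc (0 : ℝ) (1 / 2),
      HasDerivAt (fun s : ℝ => z * Complex.exp (lam (z ^ k, s * z ^ k)))
        (field k b (z * Complex.exp (lam (z ^ k, s * z ^ k)))) s ∧
      1 + (b : ℂ) * (z * Complex.exp (lam (z ^ k, s * z ^ k))) ^ k ≠ 0 ∧
      lam (z ^ k, 0) = 0 := by
  obtain ⟨lam, h0, hd, hs⟩ := exists_logShift_inverse hk b
  have hk0 : (k : ℂ) ≠ 0 := by exact_mod_cast (by omega : k ≠ 0)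
  have hcont : ContinuousAt lam 0 := hd.self_of_nhds.continuousAt
  refine ⟨lam, h0, hcont, hs, ?_⟩
  obtain ⟨δ, hδ, hinj⟩ := logShift_injective hk b
  have hne : ∀ᶠ p in 𝓝 (0 : ℂ × ℂ), Complex.exp (-(k * lam p)) + b * p.1 ≠ 0 := by
    have hc : ContinuousAt (fun p : ℂ × ℂ => Complex.exp (-(k * lam p)) + b * p.1) 0 := by
      fun_prop
    refine hc.eventually_ne ?_
    simp [h0]
  have hsmall : ∀ᶠ p in 𝓝 (0 : ℂ × ℂ), ‖lam p‖ < δ ∧ ‖p‖ < δ :=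
    (hcont.norm.eventually_lt_const (by simpa [h0] using hδ)).and
      (continuous_norm.continuousAt.eventually_lt_const (by simpa using hδ))
  obtain ⟨ρ, hρ, hball⟩ := Metric.eventually_nhds_iff_ball.1
    (hd.and (hs.eventually_nhds.and (hne.and hsmall)))
  have hpow : Tendsto (fun z : ℂ => ‖z ^ k‖) (𝓝 0) (𝓝 0) := by
    have : Continuous fun z : ℂ => ‖z ^ k‖ := by fun_prop
    simpa [zero_pow (by omega : k ≠ 0)] using this.tendsto 0
  filter_upwards [hpow.eventually_lt_const hρ] with z hz s hs01
  set x := z ^ k with hx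
  have hmem : (x, (s : ℂ) * x) ∈ Metric.ball (0 : ℂ × ℂ) ρ := by
    rw [mem_ball_zero_iff, Prod.norm_def, max_lt_iff]
    refine ⟨hz, ?_⟩
    rw [norm_mul, Complex.norm_real, Real.norm_of_nonneg hs01.1]
    have : s * ‖x‖ ≤ 1 * ‖x‖ := by
      have := hs01.2
      gcongr; linarith
    simpa using this.trans_lt (by simpa using hz)
  have hmem0 : (x, (0 : ℂ)) ∈ Metric.ball (0 : ℂ × ℂ) ρ := by
    rw [mem_ball_zero_iff, Prod.norm_def]
    simpa using hz
  obtain ⟨d1, d2, d3, -⟩ := hball _ hmem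
  obtain ⟨-, e2, -, e4, e5⟩ := hball _ hmem0
  set m : ℂ → ℂ := fun t => lam (x, t * x) with hm
  have hmd : DifferentiableAt ℂ m (s : ℂ) :=
    DifferentiableAt.comp (g := lam) (f := fun t : ℂ => (x, t * x)) (s : ℂ) d1 (by fun_prop)
  have hcs : ContinuousAt (fun t : ℂ => (x, t * x)) (s : ℂ) := by fun_prop
  have hev : (fun t => logShift k b x (m t)) =ᶠ[𝓝 (s : ℂ)] fun t => t * x :=
    hcs.eventually d2
  have h1 : HasDerivAt (fun t => logShift k b x (m t))
      ((Complex.exp (-(k * m s)) + b * x) * deriv m s) (s : ℂ) := by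
    have h2 := ((hmd.hasDerivAt.const_mul (k : ℂ)).neg.cexp.const_sub 1).div_const (k : ℂ)
    have h3 := h2.add (hmd.hasDerivAt.const_mul ((b : ℂ) * x))
    refine HasDerivAt.congr_deriv (f := fun t => logShift k b x (m t)) h3 ?_
    simp only [Pi.neg_apply]
    field_simp
  have h2 : HasDerivAt (fun t : ℂ => t * x) x (s : ℂ) := by
    simpa using (hasDerivAt_id (s : ℂ)).mul_const x
  -- derivative of the implicit equation `logShift x (m t) = t * x`
  have h3 : (Complex.exp (-(k * m s)) + b * x) * deriv m s = x :=
    h1.unique (h2.congr_of_eventuallyEq hev)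
  have h4 : Complex.exp (-(k * m s)) = (Complex.exp (m s) ^ k)⁻¹ := by
    rw [Complex.exp_neg, Complex.exp_nat_mul]
  have hE : Complex.exp (m s) ^ k ≠ 0 := pow_ne_zero k (Complex.exp_ne_zero _)
  have d3' : Complex.exp (-(k * m s)) + b * x ≠ 0 := d3
  have hpole : 1 + (b : ℂ) * (z * Complex.exp (m s)) ^ k ≠ 0 := by
    have e : 1 + (b : ℂ) * (z * Complex.exp (m s)) ^ k =
        Complex.exp (m s) ^ k * (Complex.exp (-(k * m s)) + b * x) := by
      rw [h4, mul_add, mul_inv_cancel₀ hE, mul_pow, hx]; ring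
    rw [e]
    exact mul_ne_zero hE d3'
  refine ⟨?_, hpole, ?_⟩
  · have h5 := (hmd.hasDerivAt.cexp.const_mul z).comp_ofReal
    refine h5.congr_deriv ?_
    have h6 : deriv m s = x / (Complex.exp (-(k * m s)) + b * x) := by
      rw [eq_div_iff d3', mul_comm]; exact h3
    change z * (Complex.exp (m s) * deriv m s) = field k b (z * Complex.exp (m s))
    rw [h6, field, mul_div_assoc', mul_div_assoc', div_eq_div_iff d3' hpole, h4, mul_pow, mul_pow,
      hx]
    field_simp; ring
  · have e3 := e2.self_of_nhds
    refine hinj x _ _ ?_ e4 (by simpa using hδ) ?_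
    · rw [Prod.norm_def] at e5
      exact (le_max_left _ _).trans_lt e5
    · rw [e3]; simp [logShift]

theorem analyticAt_field {k : ℕ} {b : ℝ} {w : ℂ} (hw : 1 + (b : ℂ) * w ^ k ≠ 0) :
    AnalyticAt ℂ (field k b) w := by
  have h1 : AnalyticAt ℂ (fun z : ℂ => z ^ (k + 1)) w := by fun_prop
  have h2 : AnalyticAt ℂ (fun z : ℂ => 1 + (b : ℂ) * z ^ k) w := by fun_prop
  exact h1.div h2 hw

/-- The time-`1/2` map exists near the origin, by the closed form of the integral curves. -/
theorem exists_isTimeMap {k : ℕ} (hk : 1 ≤ k) (b : ℝ) : ∃ φ, IsTimeMap k b (1 / 2) φ := by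
  obtain ⟨lam, h0, -, -, h⟩ := exists_integralCurve hk b
  refine ⟨fun z => z * Complex.exp (lam (z ^ k, ((1 / 2 : ℝ) : ℂ) * z ^ k)), ?_⟩
  filter_upwards [h] with z hz
  refine ⟨fun s => z * Complex.exp (lam (z ^ k, s * z ^ k)), ?_, rfl,
    fun s hs => (hz s hs).2.1, fun s hs => (hz s hs).1.hasDerivWithinAt⟩
  have := (hz 0 ⟨le_rfl, by norm_num⟩).2.2
  simp [this]

/-- Any time-`1/2` map of the normal form increases the time coordinate by `1/2`. -/
theorem IsTimeMap.exists_log {k : ℕ} (hk : 1 ≤ k) {b : ℝ} {φ : ℂ → ℂ}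
    (hφ : IsTimeMap k b (1 / 2) φ) : ∃ ℓ : ℂ → ℂ, Tendsto ℓ (𝓝 0) (𝓝 0) ∧
      (∀ᶠ z in 𝓝 (0 : ℂ), φ z = z * Complex.exp (ℓ z)) ∧
      ∀ᶠ z in 𝓝[≠] (0 : ℂ), timeShift k b z (ℓ z) = 1 / 2 := by
  obtain ⟨lam, h0, hcont, hs, h⟩ := exists_integralCurve hk b
  set u : ℂ → ℂ × ℂ := fun z => (z ^ k, ((1 / 2 : ℝ) : ℂ) * z ^ k) with hu
  have hut : Tendsto u (𝓝 0) (𝓝 0) := by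
    have hc : Continuous u := by fun_prop
    have e : u 0 = 0 := by simp [hu]; omega
    simpa [e] using hc.tendsto 0
  refine ⟨fun z => lam (u z), ?_, ?_, ?_⟩
  · have := (hcont.tendsto).comp hut
    rwa [h0] at this
  · filter_upwards [h, hφ] with z hz ⟨γ, hγ0, hγ1, hγp, hγ⟩
    set c : ℝ → ℂ := fun s => z * Complex.exp (lam (z ^ k, s * z ^ k)) with hc
    have hI : (0 : ℝ) ∈ Set.Icc (0 : ℝ) (1 / 2) := ⟨le_rfl, by norm_num⟩
    have hc0 : c 0 = z := by simp [hc, (hz 0 hI).2.2]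
    have hγc : ContinuousOn γ (Set.Icc 0 (1 / 2)) := fun s hs => (hγ s hs).continuousWithinAt
    have hcc : ContinuousOn c (Set.Icc 0 (1 / 2)) := fun s hs =>
      (hz s hs).1.continuousAt.continuousWithinAt
    -- both curves stay in a compact set on which the field is Lipschitz
    set K : Set ℂ := γ '' Set.Icc 0 (1 / 2) ∪ c '' Set.Icc 0 (1 / 2) with hK
    have hKc : IsCompact K := (isCompact_Icc.image_of_continuousOn hγc).union
      (isCompact_Icc.image_of_continuousOn hcc)
    have hKp : ∀ w ∈ K, 1 + (b : ℂ) * w ^ k ≠ 0 := by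
      rintro w (⟨s, hs, rfl⟩ | ⟨s, hs, rfl⟩)
      · exact hγp s hs
      · exact (hz s hs).2.1
    obtain ⟨L, hL⟩ := LocallyLipschitzOn.exists_lipschitzOnWith_of_compact (f := field k b) hKc
      (fun w hw => by
        obtain ⟨L, t, ht, hLt⟩ :=
          ((analyticAt_field (hKp w hw)).contDiffAt (n := 1)).exists_lipschitzOnWith
        exact ⟨L, t, mem_nhdsWithin_of_mem_nhds ht, hLt⟩)
    have hEq := ODE_solution_unique_of_mem_Icc_right (v := fun _ => field k b) (s := fun _ => K)
      (K := L) (f := γ) (g := c) (a := 0) (b := 1 / 2) (fun t _ => hL) hγc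
      (fun t ht => by
        have := hγ t ⟨ht.1, ht.2.le⟩
        refine this.mono_of_mem_nhdsWithin ?_
        exact mem_of_superset (Icc_mem_nhdsGE ht.2) (Set.Icc_subset_Icc_left ht.1))
      (fun t ht => Or.inl ⟨t, ⟨ht.1, ht.2.le⟩, rfl⟩) hcc
      (fun t ht => (hz t ⟨ht.1, ht.2.le⟩).1.hasDerivWithinAt)
      (fun t ht => Or.inr ⟨t, ⟨ht.1, ht.2.le⟩, rfl⟩) (hγ0.trans hc0.symm)
    rw [← hγ1, hEq ⟨by norm_num, le_rfl⟩]
  · filter_upwards [(hut.eventually hs).filter_mono nhdsWithin_le_nhds, self_mem_nhdsWithin]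
      with z h1 hz
    have hz0 : z ≠ 0 := hz
    have h2 := pow_mul_timeShift (k := k) b hz0 (lam (u z))
    refine mul_left_cancel₀ (pow_ne_zero k hz0) (h2.trans ?_)
    have h3 : logShift k b (z ^ k) (lam (u z)) = ((1 / 2 : ℝ) : ℂ) * z ^ k := h1
    rw [h3]; push_cast; ring

/-! ### Prenormalized germs in the time coordinate -/

theorem exists_eq_pow_mul_of_isLittleO {f : ℂ → ℂ} (hf : AnalyticAt ℂ f 0) {n : ℕ}
    (ho : f =o[𝓝 0] fun z => z ^ n) :
    ∃ u : ℂ → ℂ, AnalyticAt ℂ u 0 ∧ ∀ᶠ z in 𝓝 (0 : ℂ), f z = z ^ (n + 1) * u z := by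
  by_cases h : ((n + 1 : ℕ) : ℕ∞) ≤ analyticOrderAt f 0
  · obtain ⟨u, hu, he⟩ := (natCast_le_analyticOrderAt hf).1 h
    exact ⟨u, hu, by simpa using he⟩
  exfalso
  push Not at h
  obtain ⟨m, hm⟩ := ENat.ne_top_iff_exists.1 h.ne_top
  have hmn : m ≤ n := by
    rw [← hm] at h
    have : m < n + 1 := by exact_mod_cast h
    omega
  obtain ⟨u, hu, hu0, he⟩ := hf.analyticOrderAt_eq_natCast.1 hm.symm
  refine hu0 ?_
  have h1 : f =o[𝓝 0] fun z => z ^ m := by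
    refine ho.trans_isBigO ?_
    refine IsBigO.of_bound 1 ?_
    have : ∀ᶠ z in 𝓝 (0 : ℂ), ‖z‖ < 1 :=
      continuous_norm.continuousAt.eventually_lt_const (by simp)
    filter_upwards [this] with z hz
    rw [norm_pow, norm_pow, one_mul]
    exact pow_le_pow_of_le_one (norm_nonneg _) hz.le hmn
  have h2 : Tendsto u (𝓝[≠] 0) (𝓝 0) := by
    refine (h1.mono (nhdsWithin_le_nhds (s := {0}ᶜ))).tendsto_div_nhds_zero.congr' ?_
    filter_upwards [he.filter_mono nhdsWithin_le_nhds, self_mem_nhdsWithin] with z h3 h4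
    have : z ≠ 0 := h4
    rw [h3, sub_zero, smul_eq_mul, mul_div_cancel_left₀ _ (pow_ne_zero m this)]
  exact tendsto_nhds_unique (hu.continuousAt.tendsto.mono_left nhdsWithin_le_nhds) h2

theorem IsHolomorphicDiffeo.exists_inverse {h : ℂ → ℂ} (hh : IsHolomorphicDiffeo h) :
    ∃ h' : ℂ → ℂ, IsHolomorphicDiffeo h' ∧ (∀ᶠ z in 𝓝 (0 : ℂ), h' (h z) = z) ∧
      ∀ᶠ z in 𝓝 (0 : ℂ), h (h' z) = z := by
  have hs := hh.analyticAt.hasStrictDerivAt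
  have hl := hs.eventually_left_inverse hh.deriv_ne_zero
  have hr := hs.eventually_right_inverse hh.deriv_ne_zero
  have hd := hs.to_localInverse hh.deriv_ne_zero
  have ha := hh.analyticAt.analyticAt_localInverse hh.deriv_ne_zero
  have h0 := hl.self_of_nhds
  rw [hh.map_zero] at hr hd h0 ha
  refine ⟨_, ⟨ha, h0, ?_⟩, hl, hr⟩
  rw [hd.hasDerivAt.deriv]
  exact inv_ne_zero hh.deriv_ne_zero

theorem IsHolomorphicDiffeo.comp {h₁ h₂ : ℂ → ℂ} (hh₁ : IsHolomorphicDiffeo h₁)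
    (hh₂ : IsHolomorphicDiffeo h₂) : IsHolomorphicDiffeo (fun z => h₁ (h₂ z)) := by
  have h1 : AnalyticAt ℂ h₁ (h₂ 0) := by rw [hh₂.map_zero]; exact hh₁.analyticAt
  refine ⟨h1.comp hh₂.analyticAt, by rw [hh₂.map_zero, hh₁.map_zero], ?_⟩
  have := (h1.differentiableAt.hasDerivAt.comp 0 hh₂.analyticAt.differentiableAt.hasDerivAt)
  have h2 : HasDerivAt (fun z => h₁ (h₂ z)) _ 0 := this
  rw [h2.deriv, hh₂.map_zero]
  exact mul_ne_zero hh₁.deriv_ne_zero hh₂.deriv_ne_zero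

theorem IsHolomorphicDiffeo.tendsto {h : ℂ → ℂ} (hh : IsHolomorphicDiffeo h) :
    Tendsto h (𝓝 0) (𝓝 0) := by
  have := hh.analyticAt.continuousAt.tendsto
  rwa [hh.map_zero] at this

/-- Second order expansion of `log (1 + y)`. -/
theorem exists_log_one_add_eq : ∃ φ : ℂ → ℂ, AnalyticAt ℂ φ 0 ∧
    ∀ᶠ y in 𝓝 (0 : ℂ), Complex.log (1 + y) = y - y ^ 2 / 2 + y ^ 3 * φ y := by
  have ha : AnalyticAt ℂ (fun y : ℂ => Complex.log (1 + y) - (y - y ^ 2 / 2)) 0 := by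
    have : AnalyticAt ℂ (fun y : ℂ => Complex.log (1 + y)) 0 := by
      refine AnalyticAt.clog (by fun_prop) (by simp)
    fun_prop
  have ho : (fun y : ℂ => Complex.log (1 + y) - (y - y ^ 2 / 2)) =o[𝓝 0] fun y => y ^ 2 := by
    have h1 : (fun y : ℂ => Complex.log (1 + y) - (y - y ^ 2 / 2)) =O[𝓝 0] fun y => y ^ 3 := by
      refine IsBigO.of_bound 1 ?_
      have : ∀ᶠ z in 𝓝 (0 : ℂ), ‖z‖ < 1 / 2 :=
        continuous_norm.continuousAt.eventually_lt_const (by simp)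
      filter_upwards [this] with y hy
      have h2 := Complex.norm_log_sub_logTaylor_le 2 (z := y) (by linarith)
      have e : Complex.logTaylor (2 + 1) y = y - y ^ 2 / 2 := by
        simp [Complex.logTaylor, Finset.sum_range_succ]; ring
      rw [e] at h2
      refine h2.trans ?_
      rw [norm_pow, one_mul]
      have h3 : (1 - ‖y‖)⁻¹ ≤ 2 := by
        rw [inv_le_comm₀ (by linarith) (by norm_num)]; linarith
      have h4 : 0 ≤ ‖y‖ ^ (2 + 1) := by positivity
      have h5 := mul_le_mul_of_nonneg_left h3 h4
      have h6 : (0 : ℝ) ≤ ‖y‖ ^ (2 + 1) := by positivity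
      rw [div_le_iff₀ (by norm_num)]
      change ‖y‖ ^ (2 + 1) * (1 - ‖y‖)⁻¹ ≤ ‖y‖ ^ (2 + 1) * ((2 : ℕ) + 1)
      simp only [Nat.reduceAdd] at h5 h6 ⊢
      push_cast
      linarith
    exact h1.trans_isLittleO (isLittleO_pow_pow (by norm_num))
  obtain ⟨φ, hφ, he⟩ := exists_eq_pow_mul_of_isLittleO ha ho
  refine ⟨φ, hφ, ?_⟩
  filter_upwards [he] with y hy
  rw [← sub_eq_iff_eq_add', hy]

/-- Second order expansion of `exp`. -/
theorem exists_exp_eq : ∃ φ : ℂ → ℂ, AnalyticAt ℂ φ 0 ∧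
    ∀ᶠ y in 𝓝 (0 : ℂ), Complex.exp y = 1 + y + y ^ 2 / 2 + y ^ 3 * φ y := by
  have ha : AnalyticAt ℂ (fun y : ℂ => Complex.exp y - (1 + y + y ^ 2 / 2)) 0 := by fun_prop
  have ho : (fun y : ℂ => Complex.exp y - (1 + y + y ^ 2 / 2)) =o[𝓝 0] fun y => y ^ 2 := by
    have h1 : (fun y : ℂ => Complex.exp y - (1 + y + y ^ 2 / 2)) =O[𝓝 0] fun y => y ^ 3 := by
      refine IsBigO.of_bound (Real.exp 1) ?_
      have : ∀ᶠ z in 𝓝 (0 : ℂ), ‖z‖ < 1 :=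
        continuous_norm.continuousAt.eventually_lt_const (by simp)
      filter_upwards [this] with y hy
      have h2 := Complex.norm_exp_sub_sum_le_norm_mul_exp y 3
      have e : ∑ m ∈ Finset.range 3, y ^ m / (m.factorial : ℂ) = 1 + y + y ^ 2 / 2 := by
        simp [Finset.sum_range_succ]
      rw [e] at h2
      refine h2.trans ?_
      rw [norm_pow, mul_comm]
      gcongr
    exact h1.trans_isLittleO (isLittleO_pow_pow (by norm_num))
  obtain ⟨φ, hφ, he⟩ := exists_eq_pow_mul_of_isLittleO ha ho
  refine ⟨φ, hφ, ?_⟩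
  filter_upwards [he] with y hy
  rw [← sub_eq_iff_eq_add', hy]

/-- The computation behind the choice of the coefficient of `z ^ (2 k + 1)` in a prenormalized
germ. -/
theorem timeShift_identity {k w x₁ u φ₁ φ₂ b y L : ℂ} (hk : k ≠ 0) (hw : w ≠ 0) (hx : x₁ ≠ 0)
    (hy : y = w * x₁ * (1 / 2 + ((k + 1) / 8 - b / 2) * (w * x₁) + w * x₁ * w * u))
    (hL : L = y - y ^ 2 / 2 + y ^ 3 * φ₁) :
    ∃ N n m, m = 1 / 2 + ((k + 1) / 8 - b / 2) * (w * x₁) + w * x₁ * w * u ∧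
      N = u - x₁ * (((k + 1) / 8 - b / 2) + w * u) * (m + 1 / 2) / 2 + x₁ * m ^ 3 * φ₁ ∧
      n = 1 / 2 + w * x₁ * ((k / 8 - b / 2) + w * N) ∧
      (1 - (1 + -(k * L) + (-(k * L)) ^ 2 / 2 + (-(k * L)) ^ 3 * φ₂)) / (k * (w * x₁)) + b * L - 1 / 2
      = w * x₁ * w * (N - k / 2 * x₁ * ((k / 8 - b / 2) + w * N) * (n + 1 / 2)
        + b * x₁ * ((k / 8 - b / 2) + w * N) + k ^ 2 * x₁ * n ^ 3 * φ₂) := by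
  obtain ⟨m, hm⟩ : ∃ m, m = 1 / 2 + ((k + 1) / 8 - b / 2) * (w * x₁) + w * x₁ * w * u := ⟨_, rfl⟩
  obtain ⟨N, hN⟩ : ∃ N, N = u - x₁ * (((k + 1) / 8 - b / 2) + w * u) * (m + 1 / 2) / 2 +
    x₁ * m ^ 3 * φ₁ := ⟨_, rfl⟩
  obtain ⟨n, hn⟩ : ∃ n, n = 1 / 2 + w * x₁ * ((k / 8 - b / 2) + w * N) := ⟨_, rfl⟩
  refine ⟨N, n, m, hm, hN, hn, ?_⟩
  rw [← hm] at hy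
  have hLn : L = w * x₁ * n := by
    rw [hL, hy, hn, hN]
    linear_combination (w * x₁) * (1 - w * x₁ * (m + 1 / 2) / 2) * hm
  have h1 : (1 - (1 + -(k * L) + (-(k * L)) ^ 2 / 2 + (-(k * L)) ^ 3 * φ₂)) / (k * (w * x₁)) =
      n - k / 2 * (w * x₁) * n ^ 2 + k ^ 2 * (w * x₁) ^ 2 * n ^ 3 * φ₂ := by
    rw [hLn, div_eq_iff (mul_ne_zero hk (mul_ne_zero hw hx))]
    ring
  rw [h1, hLn]
  linear_combination (1 - k / 2 * (w * x₁) * (n + 1 / 2) + b * (w * x₁)) * hn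

/-- A prenormalized germ, written `z ↦ G (conj z)`, is close to the half-translation in the time
coordinate. -/
theorem exists_log_of_prenormalized {k : ℕ} (hk : 1 ≤ k) {b : ℝ} {G : ℂ → ℂ}
    (hG : AnalyticAt ℂ G 0)
    (ho : (fun z => G z - (z + 1 / 2 * z ^ (k + 1) + (((k : ℂ) + 1) / 8 - b / 2) * z ^ (2 * k + 1)))
      =o[𝓝 0] fun z => z ^ (2 * k + 1)) :
    ∃ L : ℂ → ℂ, Tendsto L (𝓝 0) (𝓝 0) ∧ (∀ᶠ w in 𝓝 (0 : ℂ), G w = w * Complex.exp (L w)) ∧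
      (fun w => timeShift k b w (L w) - 1 / 2) =O[𝓝[≠] 0] fun w => w ^ (k + 1) := by
  have ha : AnalyticAt ℂ (fun z => G z -
      (z + 1 / 2 * z ^ (k + 1) + (((k : ℂ) + 1) / 8 - b / 2) * z ^ (2 * k + 1))) 0 := by fun_prop
  obtain ⟨u, hu, hGu⟩ := exists_eq_pow_mul_of_isLittleO ha ho
  obtain ⟨φ₁, hφ₁, hlog⟩ := exists_log_one_add_eq
  obtain ⟨φ₂, hφ₂, hexp⟩ := exists_exp_eq
  obtain ⟨d, rfl⟩ : ∃ d, k = d + 1 := ⟨k - 1, by omega⟩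
  have hk0 : ((d + 1 : ℕ) : ℂ) ≠ 0 := by exact_mod_cast (by omega : d + 1 ≠ 0)
  set κ : ℂ := ((d + 1 : ℕ) : ℂ) with hκ
  set y : ℂ → ℂ := fun w => w * w ^ d * (1 / 2 + ((κ + 1) / 8 - b / 2) * (w * w ^ d) +
    w * w ^ d * w * u w) with hy
  have huc := hu.continuousAt
  have hyc : ContinuousAt y 0 := by fun_prop
  have hy0 : y 0 = 0 := by simp [hy]
  set L : ℂ → ℂ := fun w => Complex.log (1 + y w) with hL
  have hLc : ContinuousAt L 0 := by
    refine ContinuousAt.clog (by fun_prop) (by simp [hy0])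
  have hL0 : L 0 = 0 := by simp [hL, hy0]
  have hyt : Tendsto y (𝓝 0) (𝓝 0) := by simpa [ContinuousAt, hy0] using hyc
  have hLt : Tendsto L (𝓝 0) (𝓝 0) := by simpa [ContinuousAt, hL0] using hLc
  refine ⟨L, hLt, ?_, ?_⟩
  · have hne : ∀ᶠ w in 𝓝 (0 : ℂ), 1 + y w ≠ 0 := by
      have : ContinuousAt (fun w => 1 + y w) 0 := by fun_prop
      exact this.eventually_ne (by simp [hy0])
    filter_upwards [hGu, hne] with w h1 h2
    rw [hL, Complex.exp_log h2, sub_eq_iff_eq_add'.1 h1, hy]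
    ring
  · set m : ℂ → ℂ := fun w => 1 / 2 + ((κ + 1) / 8 - b / 2) * (w * w ^ d) + w * w ^ d * w * u w
      with hm
    set N : ℂ → ℂ := fun w => u w - w ^ d * (((κ + 1) / 8 - b / 2) + w * u w) * (m w + 1 / 2) * (1 / 2) +
      w ^ d * m w ^ 3 * φ₁ (y w) with hN
    set n : ℂ → ℂ := fun w => 1 / 2 + w * w ^ d * ((κ / 8 - b / 2) + w * N w) with hn
    -- the quotient by `z ^ (k + 1)` of the error, from `timeShift_identity`, extends
    -- continuously
    set t : ℂ → ℂ := fun w => N w - κ / 2 * w ^ d * ((κ / 8 - b / 2) + w * N w) * (n w + 1 / 2)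
        + b * w ^ d * ((κ / 8 - b / 2) + w * N w) + κ ^ 2 * w ^ d * n w ^ 3 * φ₂ (-(κ * L w))
      with ht
    have c1 : ContinuousAt (fun w => φ₁ (y w)) 0 :=
      ContinuousAt.comp (g := φ₁) (by rw [hy0]; exact hφ₁.continuousAt) hyc
    have hLk : ContinuousAt (fun w => -(κ * L w)) 0 := by fun_prop
    have c2 : ContinuousAt (fun w => φ₂ (-(κ * L w))) 0 :=
      ContinuousAt.comp (g := φ₂) (f := fun w => -(κ * L w))
        (by simpa [hL0] using hφ₂.continuousAt) hLk
    have c3 : ContinuousAt m 0 := by fun_prop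
    have c7 : ContinuousAt (fun w => m w ^ 3) 0 := c3.pow 3
    have c4 : ContinuousAt N 0 :=
      (ContinuousAt.sub (by fun_prop) (by fun_prop)).add
        ((ContinuousAt.mul (by fun_prop) c7).mul c1)
    have c5 : ContinuousAt n 0 := by fun_prop
    have c8 : ContinuousAt (fun w => n w ^ 3) 0 := c5.pow 3
    have c6 : ContinuousAt t 0 :=
      (ContinuousAt.add (by fun_prop) (by fun_prop)).add
        ((ContinuousAt.mul (by fun_prop) c8).mul c2)
    have hLkt : Tendsto (fun w => -(κ * L w)) (𝓝 0) (𝓝 0) := by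
      simpa [ContinuousAt, hL0] using hLk
    have hev : (fun w => timeShift (d + 1) b w (L w) - 1 / 2) =ᶠ[𝓝[≠] 0]
        fun w => w ^ (d + 1 + 1) * t w := by
      filter_upwards [(hyt.eventually hlog).filter_mono nhdsWithin_le_nhds,
        (hLkt.eventually hexp).filter_mono nhdsWithin_le_nhds, self_mem_nhdsWithin] with w h1 h2 h3
      have hw : w ≠ 0 := h3
      obtain ⟨N', n', m', hm', hN', hn', he⟩ := timeShift_identity (k := κ) (w := w)
        (x₁ := w ^ d) (u := u w) (φ₁ := φ₁ (y w)) (φ₂ := φ₂ (-(κ * L w))) (b := b) (y := y w)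
        (L := L w) hk0 hw (pow_ne_zero d hw) rfl h1
      have e1 : m' = m w := hm'
      subst e1
      have e2 : N' = N w := by rw [hN', hN]; ring
      subst e2
      have e3 : n' = n w := hn'
      subst e3
      rw [timeShift, h2, pow_succ' w d, he, ← pow_succ' w d]
      simp only [ht]
      rw [pow_succ w (d + 1), pow_succ' w d]
    refine hev.trans_isBigO ?_
    have h7 : t =O[𝓝[≠] 0] fun _ => (1 : ℂ) :=
      (c6.tendsto.isBigO_one ℂ).mono nhdsWithin_le_nhds
    simpa using (isBigO_refl (fun w : ℂ => w ^ (d + 1 + 1)) (𝓝[≠] 0)).mul h7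

theorem timeShift_conj (k : ℕ) (b : ℝ) (z l : ℂ) :
    timeShift k b (conj z) (conj l) = conj (timeShift k b z l) := by
  simp [timeShift, ← Complex.exp_conj]

theorem timeShift_mul_exp_neg {k : ℕ} (b : ℝ) {z : ℂ} (hz : z ≠ 0) (l : ℂ) :
    timeShift k b (z * Complex.exp l) (-l) = -timeShift k b z l := by
  rcases eq_or_ne (k : ℂ) 0 with hk | hk
  · simp [timeShift, hk]
  rw [timeShift, timeShift, mul_pow, ← Complex.exp_nat_mul, mul_neg, neg_neg, Complex.exp_neg]
  have h1 := pow_ne_zero k hz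
  have h2 := Complex.exp_ne_zero (k * l)
  field_simp
  ring

/-- A prenormalized germ and its inverse act in the time coordinate as half-translations, up to a
small error. -/
theorem IsPrenormalized.exists_localDynamics {k : ℕ} (hk : 1 ≤ k) {b : ℝ} {g : ℂ → ℂ}
    (hg : IsPrenormalized g k b) (ha : AnalyticAt ℂ (fun z => g (conj z)) 0) :
    ∃ g' ℓ ℓ', LocalDynamics k b g g' ℓ ℓ' := by
  set G : ℂ → ℂ := fun z => g (conj z) with hG
  have hct : Tendsto (fun z : ℂ => conj z) (𝓝 0) (𝓝 0) := by
    simpa using Complex.continuous_conj.tendsto 0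
  have hct' : Tendsto (fun z : ℂ => conj z) (𝓝[≠] 0) (𝓝[≠] 0) := by
    refine tendsto_nhdsWithin_iff.2 ⟨hct.mono_left nhdsWithin_le_nhds, ?_⟩
    filter_upwards [self_mem_nhdsWithin] with z hz
    simpa using hz
  obtain ⟨L, hL0, hL, hLs⟩ := exists_log_of_prenormalized hk ha (b := b) (by
    have := IsLittleO.comp_tendsto hg hct
    refine (this.congr_left fun z => ?_).trans_isBigO ?_
    · simp [hG]
    · refine IsBigO.of_bound 1 (Eventually.of_forall fun z => ?_)
      simp)
  have hgz : ∀ᶠ z in 𝓝 (0 : ℂ), g z = conj z * Complex.exp (L (conj z)) := by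
    filter_upwards [hct.eventually hL] with z hz
    simpa [hG] using hz
  have hstep : HalfStep k b g (fun z => L (conj z)) 1 := by
    refine ⟨(hL0.comp hct).mono_left nhdsWithin_le_nhds, hgz.filter_mono nhdsWithin_le_nhds, ?_⟩
    have := hLs.comp_tendsto hct'
    refine (this.congr_left fun z => ?_).trans (IsBigO.of_bound 1 (Eventually.of_forall fun z => ?_))
    · simp
    · simp
  have hGd : IsHolomorphicDiffeo G := by
    have h0 : G 0 = 0 := by
      have := hL.self_of_nhds
      simpa using this
    refine ⟨ha, h0, ?_⟩
    have hd : HasDerivAt G 1 0 := by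
      rw [hasDerivAt_iff_tendsto_slope]
      have h1 : Tendsto (fun z => Complex.exp (L z)) (𝓝[≠] 0) (𝓝 1) := by
        have := (Complex.continuous_exp.tendsto 0).comp hL0
        rw [Complex.exp_zero] at this
        exact this.mono_left nhdsWithin_le_nhds
      refine h1.congr' ?_
      filter_upwards [hL.filter_mono nhdsWithin_le_nhds, self_mem_nhdsWithin] with z h2 h3
      have : z ≠ 0 := h3
      rw [slope_def_field, h0, h2]
      field_simp
      simp
    rw [hd.deriv]; exact one_ne_zero
  -- the inverse germ, which is a half step in the opposite direction
  obtain ⟨Γ, hΓ, hΓG, hGΓ⟩ := hGd.exists_inverse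
  set g' : ℂ → ℂ := fun z => conj (Γ z) with hg'
  have hg't : Tendsto g' (𝓝 0) (𝓝 0) := hct.comp hΓ.tendsto
  have hleft : ∀ᶠ z in 𝓝 (0 : ℂ), g' (g z) = z := by
    filter_upwards [hct.eventually hΓG] with z hz
    have : Γ (g z) = conj z := by simpa [hG] using hz
    simp [hg', this]
  have hright : ∀ᶠ z in 𝓝 (0 : ℂ), g (g' z) = z := hGΓ
  have hg'0 : ∀ᶠ z in 𝓝[≠] (0 : ℂ), g' z ≠ 0 := by
    filter_upwards [hright.filter_mono nhdsWithin_le_nhds, self_mem_nhdsWithin] with z h1 h2 h3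
    have h0 : g 0 = 0 := by simpa [hG] using hGd.map_zero
    rw [h3, h0] at h1
    exact h2 h1.symm
  have hg't' : Tendsto g' (𝓝[≠] 0) (𝓝[≠] 0) :=
    tendsto_nhdsWithin_iff.2 ⟨hg't.mono_left nhdsWithin_le_nhds, hg'0⟩
  have hmap : ∀ᶠ z in 𝓝 (0 : ℂ),
      g' z = conj z * Complex.exp (-conj (L (conj (g' z)))) := by
    filter_upwards [hright, hg't.eventually hgz] with z h1 h2
    rw [h1] at h2
    have h3 := congrArg conj h2
    rw [map_mul, Complex.conj_conj, ← Complex.exp_conj] at h3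
    rw [h3, Complex.exp_neg, mul_assoc, mul_inv_cancel₀ (Complex.exp_ne_zero _), mul_one]
  have hΓO : g' =O[𝓝 0] fun z => z := by
    have h1 : Γ =O[𝓝 0] fun z => z := by
      have := hΓ.analyticAt.differentiableAt.isBigO_sub
      simpa [hΓ.map_zero] using this
    refine (IsBigO.of_bound 1 (Eventually.of_forall fun z => ?_)).trans h1
    simp [hg']
  refine ⟨g', fun z => L (conj z), fun z => -conj (L (conj (g' z))), hstep,
    ⟨?_, hmap.filter_mono nhdsWithin_le_nhds, ?_⟩, hleft, hright, ?_, ?_⟩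
  · have h1 := (hct.comp (hL0.comp (hct.comp hg't))).neg
    rw [neg_zero] at h1
    exact h1.mono_left nhdsWithin_le_nhds
  · have h1 := (hstep.shift.comp_tendsto hg't').trans
      ((hΓO.pow (k + 1)).mono nhdsWithin_le_nhds)
    refine (IsBigO.of_bound 1 ?_).trans h1
    filter_upwards [hright.filter_mono nhdsWithin_le_nhds,
      (hg't.eventually hgz).filter_mono nhdsWithin_le_nhds, hg'0] with z h2 h3 h4
    rw [h2] at h3
    have h5 : conj z = g' z * Complex.exp (conj (L (conj (g' z)))) := by
      have h7 := congrArg conj h3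
      rwa [map_mul, Complex.conj_conj, ← Complex.exp_conj] at h7
    have h6 : timeShift k b (conj z) (-conj (L (conj (g' z)))) =
        -conj (timeShift k b (conj (g' z)) (L (conj (g' z)))) := by
      rw [h5, timeShift_mul_exp_neg b h4, ← timeShift_conj]; simp
    rw [h6, one_mul, Function.comp_apply]
    rw [show -conj (timeShift k b (conj (g' z)) (L (conj (g' z)))) - ((-1 / 2 : ℝ) : ℂ) =
      -conj (timeShift k b (conj (g' z)) (L (conj (g' z))) - ((1 / 2 : ℝ) : ℂ)) by
        rw [map_sub, Complex.conj_ofReal]; push_cast; ring]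
    rw [norm_neg, RCLike.norm_conj]
  · have h1 : ∀ᶠ z in 𝓝 (0 : ℂ), DifferentiableAt ℂ G z :=
      ha.eventually_analyticAt.mono fun z hz => hz.differentiableAt
    have hGt : Tendsto (fun z => conj (G (conj z))) (𝓝 0) (𝓝 0) :=
      hct.comp (hGd.tendsto.comp hct)
    filter_upwards [hct.eventually h1, hGt.eventually h1] with z h2 h3
    have h4 : DifferentiableAt ℂ (fun z => conj (G (conj z))) z := by
      have := DifferentiableAt.conj_conj h2
      simpa [Function.comp_def] using this
    refine (DifferentiableAt.comp (g := G) z h3 h4).congr_of_eventuallyEq ?_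
    exact Eventually.of_forall fun w => by simp [hG]
  · have h1 : ∀ᶠ z in 𝓝 (0 : ℂ), DifferentiableAt ℂ Γ z :=
      hΓ.analyticAt.eventually_analyticAt.mono fun z hz => hz.differentiableAt
    filter_upwards [h1, hg't.eventually h1] with z h2 h4
    have h5 : DifferentiableAt ℂ (fun w => conj (Γ (conj w))) (Γ z) := by
      have : DifferentiableAt ℂ Γ (conj (Γ z)) := h4
      have := DifferentiableAt.conj_conj this
      simpa [Function.comp_def] using this
    exact DifferentiableAt.comp (g := fun w => conj (Γ (conj w))) z h5 h2

/-! ### Adjacent petals -/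

theorem log_rot_add {k : ℕ} {θ t : ℝ} {z : ℂ} (hz : z ≠ 0)
    (h : |Complex.arg (rot k θ z) - t * Real.pi / k| < Real.pi) :
    Complex.log (rot k (θ + t) z) = Complex.log (rot k θ z) - (t * Real.pi / k : ℝ) * Complex.I := by
  have h0 := rot_ne_zero (k := k) (θ := θ) hz
  have h1 := abs_lt.1 h
  rw [add_comm, rot_add, rot]
  nth_rewrite 1 [← Complex.exp_log h0]
  rw [← Complex.exp_add, Complex.log_exp]
  · ring
  · simp only [Complex.add_im, Complex.mul_im, Complex.log_im, Complex.neg_im, Complex.neg_re,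
      Complex.ofReal_re, Complex.ofReal_im, Complex.I_re, Complex.I_im]
    linarith
  · simp only [Complex.add_im, Complex.mul_im, Complex.log_im, Complex.neg_im, Complex.neg_re,
      Complex.ofReal_re, Complex.ofReal_im, Complex.I_re, Complex.I_im]
    linarith

theorem pi_div_le {k : ℕ} (hk : 1 ≤ k) : Real.pi / k ≤ Real.pi := by
  have hk' : (1 : ℝ) ≤ k := by exact_mod_cast hk
  exact div_le_self Real.pi_pos.le hk'

section

variable {k : ℕ} {m : ℤ} {z : ℂ}

/-- Close to the direction halfway between two petals, the two branches of the logarithm. -/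
theorem log_rot_of_mid (hk : 1 ≤ k) (hz : z ≠ 0)
    (h : |Complex.arg (rot k (m + 1 / 2) z)| < Real.pi / (2 * k)) :
    Complex.log (rot k m z) =
      Complex.log (rot k (m + 1 / 2) z) + (Real.pi / (2 * k) : ℝ) * Complex.I ∧
    Complex.log (rot k (m + 1 : ℤ) z) =
      Complex.log (rot k (m + 1 / 2) z) - (Real.pi / (2 * k) : ℝ) * Complex.I := by
  have h1 := abs_lt.1 h
  have hp := pi_div_le hk
  have hk' : (0 : ℝ) < k := by exact_mod_cast hk
  have hp' : 0 < Real.pi / k := div_pos Real.pi_pos hk'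
  have e : Real.pi / (2 * k) = Real.pi / k / 2 := by field_simp
  rw [e] at h1
  constructor
  · have h2 := log_rot_add (t := -1 / 2) hz (k := k) (θ := m + 1 / 2) (by
      rw [abs_lt, show -1 / 2 * Real.pi / k = -(Real.pi / k / 2) by ring]
      constructor <;> linarith)
    rw [show (m : ℝ) + 1 / 2 + -1 / 2 = m by ring] at h2
    rw [h2]; push_cast; ring
  · have h2 := log_rot_add (t := 1 / 2) hz (k := k) (θ := m + 1 / 2) (by
      rw [abs_lt, show 1 / 2 * Real.pi / k = Real.pi / k / 2 by ring]
      constructor <;> linarith)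
    rw [show (m : ℝ) + 1 / 2 + 1 / 2 = (m + 1 : ℤ) by push_cast; ring] at h2
    rw [h2]; push_cast; ring

theorem arg_rot_of_mid (hk : 1 ≤ k) (hz : z ≠ 0)
    (h : |Complex.arg (rot k (m + 1 / 2) z)| < Real.pi / (2 * k)) :
    Complex.arg (rot k m z) = Complex.arg (rot k (m + 1 / 2) z) + Real.pi / (2 * k) ∧
    Complex.arg (rot k (m + 1 : ℤ) z) =
      Complex.arg (rot k (m + 1 / 2) z) - Real.pi / (2 * k) := by
  obtain ⟨h1, h2⟩ := log_rot_of_mid hk hz h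
  constructor
  · have := congrArg Complex.im h1
    simpa only [Complex.add_im, Complex.log_im, Complex.im_ofReal_mul, Complex.I_im, mul_one]
      using this
  · have := congrArg Complex.im h2
    simpa only [Complex.sub_im, Complex.log_im, Complex.im_ofReal_mul, Complex.I_im, mul_one]
      using this

/-- Between two consecutive petals, their time coordinates differ by a constant. -/
theorem Z_add_one_of_mid (hk : 1 ≤ k) (b : ℝ) (hz : z ≠ 0)
    (h : |Complex.arg (rot k (m + 1 / 2) z)| < Real.pi / (2 * k)) :
    Z k b (m + 1) z = Z k b m z - (b * (Real.pi / k) : ℝ) * Complex.I := by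
  obtain ⟨h1, h2⟩ := log_rot_of_mid hk hz h
  rw [Z, Z, h1, h2]
  push_cast
  ring

/-- The part of the intersection of the `m`-th and the `(m + 1)`-st petals between their central
directions. -/
def adjacentOverlap (k : ℕ) (b r R : ℝ) (m : ℤ) : Set ℂ :=
  {z | z ∈ S k b r R m ∧ z ∈ S k b r R (m + 1) ∧
    |Complex.arg (rot k (m + 1 / 2) z)| < Real.pi / (2 * k)}

theorem overlap_of_pos (b r R : ℝ) {j : ℤ} (hj : 0 < j) :
    overlap k b r R j = adjacentOverlap k b r R (j - 1) := by
  ext z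
  simp only [overlap, adjacentOverlap, Set.mem_ofPred_eq, Int.sign_eq_one_of_pos hj,
    sub_add_cancel]
  rw [show (j : ℝ) - ((1 : ℤ) : ℝ) / 2 = ((j - 1 : ℤ) : ℝ) + 1 / 2 by push_cast; ring]
  tauto

theorem overlap_of_neg (b r R : ℝ) {j : ℤ} (hj : j < 0) :
    overlap k b r R j = adjacentOverlap k b r R j := by
  ext z
  simp only [overlap, adjacentOverlap, Set.mem_ofPred_eq, Int.sign_eq_neg_one_of_neg hj,
    sub_neg_eq_add]
  rw [show (j : ℝ) - ((-1 : ℤ) : ℝ) / 2 = (j : ℝ) + 1 / 2 by push_cast; ring]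

theorem frequently_arg_rot_eq_zero (k : ℕ) (θ : ℝ) :
    ∃ᶠ z in 𝓝[≠] (0 : ℂ), Complex.arg (rot k θ z) = 0 := by
  have ht : Tendsto (fun ρ : ℝ => rot k (-θ) (ρ : ℂ)) (𝓝[>] 0) (𝓝[≠] 0) := by
    refine tendsto_nhdsWithin_iff.2 ⟨?_, ?_⟩
    · refine tendsto_zero_iff_norm_tendsto_zero.2 ?_
      simp only [norm_rot, Complex.norm_real]
      have : Continuous fun ρ : ℝ => ‖ρ‖ := continuous_norm
      have h := (this.tendsto 0).mono_left (nhdsWithin_le_nhds (s := Set.Ioi 0))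
      simpa using h
    · filter_upwards [self_mem_nhdsWithin] with ρ hρ
      have : (ρ : ℂ) ≠ 0 := by exact_mod_cast (ne_of_gt hρ)
      exact rot_ne_zero this
  refine ht.frequently (Eventually.frequently ?_)
  filter_upwards [self_mem_nhdsWithin] with ρ hρ
  rw [← rot_add, add_neg_cancel, rot_zero]
  exact Complex.arg_ofReal_of_nonneg (le_of_lt hρ)

end

namespace FatouCoordinates

variable {f : ℂ → ℂ} {k : ℕ} {b : ℝ} (T : FatouCoordinates f k b)

theorem injOn_onPetal {j : ℤ} (hj : |j| ≤ k) : Set.InjOn (T.onPetal j) (S k b T.r T.R j) :=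
  (T.Φ_injective j hj).comp (T.time_bijOn j hj).injOn (T.time_bijOn j hj).mapsTo

theorem transition_eq_translation_iff {j : ℤ} {X : Set ℂ}
    (hX : overlap k b T.r T.R j ⊆ X) (hinj : Set.InjOn (T.onPetal (source j)) X) :
    (∃ C : ℂ, ∀ W ∈ T.transitionDomain j, T.transition j W = W + C) ↔
      ∃ C : ℂ, ∀ z ∈ overlap k b T.r T.R j, T.onPetal (target j) z = T.onPetal (source j) z + C := by
  have h1 : ∀ z ∈ overlap k b T.r T.R j,
      T.transition j (T.onPetal (source j) z) = T.onPetal (target j) z := fun z hz => by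
    rw [transition, (hinj.mono hX).leftInvOn_invFunOn hz]
  refine exists_congr fun C => ⟨fun h z hz => ?_, ?_⟩
  · rw [← h1 z hz]; exact h _ ⟨z, hz, rfl⟩
  · rintro h W ⟨z, hz, rfl⟩
    rw [h1 z hz]; exact h z hz

theorem exists_add_const_comm {X : Set ℂ} {u v : ℂ → ℂ} :
    (∃ C : ℂ, ∀ z ∈ X, u z = v z + C) ↔ ∃ C : ℂ, ∀ z ∈ X, v z = u z + C := by
  constructor <;> rintro ⟨C, hC⟩ <;> refine ⟨-C, fun z hz => ?_⟩ <;> rw [hC z hz] <;> ring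

/-- The transition functions are translations if and only if any two adjacent Fatou coordinates
differ by a constant between the central directions of their petals. -/
theorem transitionsAreTranslations_iff : T.TransitionsAreTranslations ↔
    ∀ m : ℤ, -(k : ℤ) ≤ m → m < k → ∃ C : ℂ, ∀ z ∈ adjacentOverlap k b T.r T.R m,
      T.onPetal (m + 1) z = T.onPetal m z + C := by
  have key : ∀ j : ℤ, j ≠ 0 → |j| ≤ k →
      ((∃ C : ℂ, ∀ W ∈ T.transitionDomain j, T.transition j W = W + C) ↔
      ∃ C : ℂ, ∀ z ∈ overlap k b T.r T.R j,
        T.onPetal j z = T.onPetal (j - j.sign) z + C) := by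
    intro j hj0 hj
    have hj' : |j - j.sign| ≤ k := by
      rcases lt_or_gt_of_ne hj0 with h | h
      · rw [Int.sign_eq_neg_one_of_neg h]
        rw [abs_le] at hj ⊢; constructor <;> omega
      · rw [Int.sign_eq_one_of_pos h]
        rw [abs_le] at hj ⊢; constructor <;> omega
    by_cases ho : Odd j
    · have hs : source j = j - j.sign := by simp [source, ho]
      have ht : target j = j := by simp [target, ho]
      rw [T.transition_eq_translation_iff (X := S k b T.r T.R (j - j.sign)) (fun z hz => hz.2.1)
        (by rw [hs]; exact T.injOn_onPetal hj'), hs, ht]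
    · have hs : source j = j := by simp [source, ho]
      have ht : target j = j - j.sign := by simp [target, ho]
      rw [T.transition_eq_translation_iff (X := S k b T.r T.R j) (fun z hz => hz.1)
        (by rw [hs]; exact T.injOn_onPetal hj), hs, ht]
      exact exists_add_const_comm
  constructor
  · intro h m hm hmk
    rcases le_or_gt 0 m with h0 | h0
    · have h1 := (key (m + 1) (by omega) (by rw [abs_le]; constructor <;> omega)).1
        (h (m + 1) (by omega) (by rw [abs_le]; constructor <;> omega))
      rw [overlap_of_pos _ _ _ (by omega : 0 < m + 1),
        Int.sign_eq_one_of_pos (by omega : 0 < m + 1), add_sub_cancel_right] at h1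
      exact h1
    · have h1 := (key m (by omega) (by rw [abs_le]; constructor <;> omega)).1
        (h m (by omega) (by rw [abs_le]; constructor <;> omega))
      rw [overlap_of_neg _ _ _ h0, Int.sign_eq_neg_one_of_neg h0, sub_neg_eq_add] at h1
      exact exists_add_const_comm.1 h1
  · intro h j hj0 hj
    rw [key j hj0 hj]
    rw [abs_le] at hj
    rcases lt_or_gt_of_ne hj0 with h0 | h0
    · rw [overlap_of_neg _ _ _ h0, Int.sign_eq_neg_one_of_neg h0, sub_neg_eq_add]
      exact exists_add_const_comm.1 (h j hj.1 (by omega))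
    · rw [overlap_of_pos _ _ _ h0, Int.sign_eq_one_of_pos h0]
      have := h (j - 1) (by omega) (by omega)
      rwa [sub_add_cancel] at this

theorem analyticAt_antiholomorphic : AnalyticAt ℂ (fun z => T.g (conj z)) 0 :=
  T.antiholomorphic.analyticAt (Metric.ball_mem_nhds 0 T.r_pos)

theorem differentiableAt_onPetal (hk : 1 ≤ k) {j : ℤ} (hj : |j| ≤ k) {z : ℂ}
    (hz : z ∈ S k b T.r T.R j) : DifferentiableAt ℂ (T.onPetal j) z := by
  have h1 : DifferentiableAt ℂ (T.Φ j) (Z k b j z) :=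
    (T.Φ_holomorphic j hj).differentiableAt
      ((isOpen_U T.R j).mem_nhds ((T.time_bijOn j hj).mapsTo hz))
  exact h1.comp z (hasDerivAt_Z hk b hz.1 hz.2.2.1).differentiableAt

end FatouCoordinates

theorem eventually_mem_S_of_sector {k : ℕ} (hk : 1 ≤ k) (b R : ℝ) {r : ℝ} (hr : 0 < r) :
    ∀ᶠ z in 𝓝[≠] (0 : ℂ), ∀ j : ℤ, |Complex.arg (rot k j z)| ≤ 3 * Real.pi / (4 * k) →
      z ∈ S k b r R j := by
  have hk' : (0 : ℝ) < k := by exact_mod_cast hk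
  have hr' : ∀ᶠ z in 𝓝 (0 : ℂ), ‖z‖ < r :=
    continuous_norm.continuousAt.eventually_lt_const (by simpa using hr)
  filter_upwards [eventually_mem_U_of_sector hk b R, hr'.filter_mono nhdsWithin_le_nhds,
    self_mem_nhdsWithin] with z h1 h2 h3 j hj
  refine ⟨h3, h2, hj.trans_lt ?_, h1 j hj⟩
  rw [div_lt_div_iff₀ (by positivity) hk']
  nlinarith [Real.pi_pos, mul_pos Real.pi_pos hk']

/-! ### Gluing the Fatou coordinates -/

section

variable {k : ℕ} {z : ℂ}

/-- The closed sectors of half-angle `π / (2 k)` around the central directions cover the plane. -/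
theorem exists_abs_arg_rot_le (hk : 1 ≤ k) (hz : z ≠ 0) :
    ∃ j : ℤ, |j| ≤ k ∧ |Complex.arg (rot k j z)| ≤ Real.pi / (2 * k) := by
  have hk' : (0 : ℝ) < k := by exact_mod_cast hk
  have hπ := Real.pi_pos
  set x : ℝ := k * Complex.arg z / Real.pi with hx
  have hax : Complex.arg z = x * (Real.pi / k) := by rw [hx]; field_simp
  have hxk : |x| ≤ k := by
    rw [hx, abs_div, abs_mul, Nat.abs_cast, abs_of_pos hπ, div_le_iff₀ hπ]
    exact mul_le_mul_of_nonneg_left (Complex.abs_arg_le_pi z) hk'.le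
  have h1 := abs_sub_round x
  have hjk : |round x| ≤ k := by
    have h2 := abs_le.1 hxk
    have h3 := abs_le.1 h1
    have h4 : (round x : ℝ) < (k + 1 : ℤ) := by push_cast; linarith
    have h5 : ((-(k + 1) : ℤ) : ℝ) < (round x : ℝ) := by push_cast; linarith
    have h6 := Int.cast_lt.1 h4
    have h7 := Int.cast_lt.1 h5
    rw [abs_le]; constructor <;> omega
  have hp : Real.pi / k ≤ Real.pi := pi_div_le hk
  have hp0 : 0 < Real.pi / k := by positivity
  have h8 : |Complex.arg z - round x * (Real.pi / k)| ≤ Real.pi / (2 * k) := by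
    rw [hax, ← sub_mul, abs_mul, abs_of_pos hp0]
    calc |x - round x| * (Real.pi / k) ≤ 1 / 2 * (Real.pi / k) := by gcongr
      _ = Real.pi / (2 * k) := by field_simp
  refine ⟨round x, hjk, ?_⟩
  have h9 := log_rot_add (k := k) (θ := 0) (t := round x) hz (by
    rw [rot_zero, mul_div_assoc]
    refine h8.trans_lt ?_
    rw [show Real.pi / (2 * k) = Real.pi / k / 2 by field_simp]
    linarith)
  rw [zero_add, rot_zero] at h9
  have h10 := congrArg Complex.im h9
  simp only [Complex.sub_im, Complex.log_im, Complex.im_ofReal_mul, Complex.I_im, mul_one] at h10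
  rw [h10, mul_div_assoc]
  exact h8

theorem exists_int_arg_rot (hz : z ≠ 0) (θ θ' : ℝ) : ∃ n : ℤ,
    Complex.arg (rot k θ z) + θ * Real.pi / k =
      Complex.arg (rot k θ' z) + θ' * Real.pi / k + n * (2 * Real.pi) := by
  have key : ∀ θ : ℝ, (‖z‖ : ℂ) *
      Complex.exp ((Complex.arg (rot k θ z) + θ * Real.pi / k : ℝ) * Complex.I) = z := by
    intro θ
    have h1 := Complex.norm_mul_exp_arg_mul_I (rot k θ z)
    rw [norm_rot] at h1
    rw [Complex.ofReal_add, add_mul, Complex.exp_add, ← mul_assoc, h1, rot, mul_right_comm,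
      ← Complex.exp_add, ← add_mul]
    simp
  have hz' : (‖z‖ : ℂ) ≠ 0 := by exact_mod_cast norm_ne_zero_iff.2 hz
  have h1 := mul_left_cancel₀ hz' ((key θ).trans (key θ').symm)
  obtain ⟨n, hn⟩ := Complex.exp_eq_exp_iff_exists_int.1 h1
  refine ⟨n, ?_⟩
  have := congrArg Complex.im hn
  simpa using this

theorem abs_arg_rot_mid_lt (hk : 1 ≤ k) (hz : z ≠ 0) {m : ℤ}
    (h : |Complex.arg (rot k m z)| < 3 * Real.pi / (4 * k))
    (h' : |Complex.arg (rot k (m + 1 : ℤ) z)| < 3 * Real.pi / (4 * k))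
    (he : Complex.arg (rot k (m + 1 : ℤ) z) = Complex.arg (rot k m z) - Real.pi / k) :
    |Complex.arg (rot k (m + 1 / 2) z)| < Real.pi / (2 * k) := by
  have hk' : (0 : ℝ) < k := by exact_mod_cast hk
  have hp : Real.pi / k ≤ Real.pi := pi_div_le hk
  have hp0 : 0 < Real.pi / k := div_pos Real.pi_pos hk'
  have e1 : 3 * Real.pi / (4 * k) = 3 / 4 * (Real.pi / k) := by field_simp
  have e2 : Real.pi / (2 * k) = Real.pi / k / 2 := by field_simp
  rw [e1, abs_lt] at h h'
  rw [he] at h'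
  have h9 := log_rot_add (k := k) (θ := m) (t := 1 / 2) hz (by
    rw [show 1 / 2 * Real.pi / k = Real.pi / k / 2 by ring, abs_lt]
    constructor <;> linarith [h.1, h.2, h'.1, h'.2])
  have h10 := congrArg Complex.im h9
  simp only [Complex.sub_im, Complex.log_im, Complex.im_ofReal_mul, Complex.I_im, mul_one] at h10
  rw [h10, e2, abs_lt, show 1 / 2 * Real.pi / k = Real.pi / k / 2 by ring]
  constructor <;> linarith [h.1, h.2, h'.1, h'.2]

/-- Values attached to the open sectors of half-angle `3 π / (4 k)` around the central directions,
and equal for consecutive sectors, are equal. -/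
theorem eq_of_sectors (hk : 1 ≤ k) (hz : z ≠ 0) {D : ℤ → ℂ}
    (hD : ∀ m : ℤ, -(k : ℤ) ≤ m → m < k → |Complex.arg (rot k m z)| < 3 * Real.pi / (4 * k) →
      |Complex.arg (rot k (m + 1 : ℤ) z)| < 3 * Real.pi / (4 * k) →
      |Complex.arg (rot k (m + 1 / 2) z)| < Real.pi / (2 * k) → D (m + 1) = D m)
    (hlast : |Complex.arg (rot k (k : ℤ) z)| < 3 * Real.pi / (4 * k) → D (-k) = D k)
    {j j' : ℤ} (hj : |j| ≤ k) (hj' : |j'| ≤ k)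
    (h : |Complex.arg (rot k j z)| < 3 * Real.pi / (4 * k))
    (h' : |Complex.arg (rot k j' z)| < 3 * Real.pi / (4 * k)) : D j = D j' := by
  have hk' : (0 : ℝ) < k := by exact_mod_cast hk
  have hp0 : 0 < Real.pi / k := div_pos Real.pi_pos hk'
  have e1 : 3 * Real.pi / (4 * k) = 3 / 4 * (Real.pi / k) := by field_simp
  have hrot := LocalDynamics.rot_natCast_neg k
  -- consecutive sectors modulo `2 k`
  have key : ∀ j j' n : ℤ, |j| ≤ k → |j'| ≤ k →
      |Complex.arg (rot k j z)| < 3 * Real.pi / (4 * k) →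
      |Complex.arg (rot k j' z)| < 3 * Real.pi / (4 * k) →
      Complex.arg (rot k j z) = Complex.arg (rot k j' z) - Real.pi / k →
      j = j' + 1 + 2 * k * n → D j = D j' := by
    intro j j' n hj hj' h h' ha hn
    rw [abs_le] at hj hj'
    have step : ∀ m : ℤ, -(k : ℤ) ≤ m → m < k →
        |Complex.arg (rot k m z)| < 3 * Real.pi / (4 * k) →
        |Complex.arg (rot k (m + 1 : ℤ) z)| < 3 * Real.pi / (4 * k) →
        Complex.arg (rot k (m + 1 : ℤ) z) = Complex.arg (rot k m z) - Real.pi / k →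
        D (m + 1) = D m := fun m h1 h2 h3 h4 h5 =>
      hD m h1 h2 h3 h4 (abs_arg_rot_mid_lt hk hz h3 h4 h5)
    have hn1 : n = 0 ∨ n = -1 := by
      have : n < 1 := by by_contra hc; nlinarith
      have : -2 < n := by by_contra hc; nlinarith
      omega
    rcases hn1 with rfl | rfl
    · have e : j = j' + 1 := by linarith
      subst e
      exact step j' (by omega) (by omega) h' h ha
    · rcases (by omega : j' = k - 1 ∨ j' = k) with e | e
      · have e2 : j = -k := by linarith
        subst e2
        rw [hrot] at h ha
        have e3 : j' + 1 = k := by omega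
        rw [hlast h, ← e3]
        refine step j' (by omega) (by omega) h' (by rw [e3]; exact h) (by rw [e3]; exact ha)
      · have e2 : j = -k + 1 := by linarith
        subst e2 e
        rw [← hlast h']
        rw [← hrot] at h' ha
        exact step (-k) (by omega) (by omega) h' h ha
  obtain ⟨n, hn⟩ := exists_int_arg_rot (k := k) hz j j'
  -- the directions `j` and `j'` are less than `3 / 2` apart modulo `2 k`
  have hd : ((j - j' - 2 * k * n : ℤ) : ℝ) * (Real.pi / k) =
      Complex.arg (rot k j' z) - Complex.arg (rot k j z) := by
    have : (n : ℝ) * (2 * Real.pi) = 2 * k * n * (Real.pi / k) := by field_simp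
    rw [this, mul_div_assoc, mul_div_assoc] at hn
    push_cast
    linarith
  have h1 := abs_lt.1 (e1 ▸ h)
  have h2 := abs_lt.1 (e1 ▸ h')
  have hlt : ((j - j' - 2 * k * n : ℤ) : ℝ) < 3 / 2 := by
    by_contra hc
    push Not at hc
    have := mul_le_mul_of_nonneg_right hc hp0.le
    linarith [h1.1, h2.2]
  have hgt : -(3 / 2) < ((j - j' - 2 * k * n : ℤ) : ℝ) := by
    by_contra hc
    push Not at hc
    have := mul_le_mul_of_nonneg_right hc hp0.le
    linarith [h1.2, h2.1]
  have hlt' : j - j' - 2 * k * n < 2 := by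
    have : ((j - j' - 2 * k * n : ℤ) : ℝ) < ((2 : ℤ) : ℝ) := by push_cast at hlt ⊢; linarith
    exact Int.cast_lt.1 this
  have hgt' : -2 < j - j' - 2 * k * n := by
    have : ((-2 : ℤ) : ℝ) < ((j - j' - 2 * k * n : ℤ) : ℝ) := by push_cast at hgt ⊢; linarith
    exact Int.cast_lt.1 this
  rcases (by omega : j - j' - 2 * k * n = 0 ∨ j - j' - 2 * k * n = 1 ∨
    j - j' - 2 * k * n = -1) with hc | hc | hc
  · rw [abs_le] at hj hj'
    have hn1 : n = 0 ∨ n = 1 ∨ n = -1 := by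
      have : n < 2 := by by_contra hc; nlinarith
      have : -2 < n := by by_contra hc; nlinarith
      omega
    rcases hn1 with rfl | rfl | rfl
    · have e : j = j' := by linarith
      rw [e]
    · have e : j = k := by omega
      have e' : j' = -k := by omega
      subst e e'
      exact (hlast h).symm
    · have e : j' = k := by omega
      have e' : j = -k := by omega
      subst e e'
      exact hlast h'
  · rw [hc] at hd
    refine key j j' n hj hj' h h' ?_ (by linarith)
    push_cast at hd; linarith
  · rw [hc] at hd
    refine (key j' j (-n) hj' hj h' h ?_ (by linarith)).symm
    push_cast at hd; linarith

end

namespace FatouCoordinates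

variable {f : ℂ → ℂ} {k : ℕ} {b : ℝ} {g' ℓ ℓ' : ℂ → ℂ}

theorem onPetal_natCast_neg (T : FatouCoordinates f k b) {z : ℂ} (hz : z ∈ S k b T.r T.R k) :
    T.onPetal (-k) z = T.onPetal k z := by
  rw [onPetal, onPetal, LocalDynamics.Z_natCast_neg]
  exact T.Φ_last ((T.time_bijOn k (by simp)).mapsTo hz)

/-- Near the origin, the Fatou coordinates differ from the time coordinates by almost constant
functions, away from the edges of the petals. -/
theorem exists_sector_asymptotic (T : FatouCoordinates f k b) (hk : 1 ≤ k)
    (h : LocalDynamics k b T.g g' ℓ ℓ') : ∃ c : ℤ → ℂ, c (-k) = c k ∧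
      ∀ ε > 0, ∀ᶠ z in 𝓝[≠] (0 : ℂ), ∀ j : ℤ, |j| ≤ k →
        |Complex.arg (rot k j z)| ≤ 3 * Real.pi / (4 * k) →
        z ∈ S k b T.r T.R j ∧ ‖T.onPetal j z - Z k b j z - c j‖ ≤ ε := by
  choose! c₀ hc₀ using fun (j : ℤ) (hj : |j| ≤ k) => T.exists_asymptotic hk h hj
  have hone : ∀ j : ℤ, |j| ≤ k → ∀ ε > 0, ∀ᶠ z in 𝓝[≠] (0 : ℂ),
      |Complex.arg (rot k j z)| ≤ 3 * Real.pi / (4 * k) →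
        ‖T.onPetal j z - Z k b j z - c₀ j‖ ≤ ε := by
    intro j hj ε hε
    obtain ⟨R, hR⟩ := (hc₀ j hj ε hε).exists
    filter_upwards [eventually_mem_U_of_sector hk b R] with z hz ha
    exact hR _ (hz j ha)
  refine ⟨fun j => if j = -k then c₀ k else c₀ j, by simp, fun ε hε => ?_⟩
  have hall : ∀ᶠ z in 𝓝[≠] (0 : ℂ), ∀ j ∈ Finset.Icc (-(k : ℤ)) k,
      |Complex.arg (rot k j z)| ≤ 3 * Real.pi / (4 * k) →
        ‖T.onPetal j z - Z k b j z - c₀ j‖ ≤ ε :=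
    (Finset.eventually_all _).2 fun j hj => hone j (abs_le.2 (Finset.mem_Icc.1 hj)) ε hε
  filter_upwards [hall, eventually_mem_S_of_sector hk b T.R T.r_pos] with z h1 h2 j hj ha
  refine ⟨h2 j ha, ?_⟩
  by_cases hjk : j = -k
  · subst hjk
    rw [LocalDynamics.rot_natCast_neg] at ha
    rw [T.onPetal_natCast_neg (h2 k ha), LocalDynamics.Z_natCast_neg]
    simpa using h1 k (by simp) ha
  · rw [if_neg hjk]
    exact h1 j (Finset.mem_Icc.2 (abs_le.1 hj)) ha

/-- If the transition functions are translations, the normalized differences between Fatou and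
time coordinates agree on the overlap of consecutive petals: they differ by a constant, and both
tend to `0` at the origin. -/
theorem eq_of_adjacent (T : FatouCoordinates f k b) (hk : 1 ≤ k)
    (hT : T.TransitionsAreTranslations) {c : ℤ → ℂ}
    (hc : ∀ ε > 0, ∀ᶠ z in 𝓝[≠] (0 : ℂ), ∀ j : ℤ, |j| ≤ k →
        |Complex.arg (rot k j z)| ≤ 3 * Real.pi / (4 * k) →
        z ∈ S k b T.r T.R j ∧ ‖T.onPetal j z - Z k b j z - c j‖ ≤ ε)
    {m : ℤ} (hm : -(k : ℤ) ≤ m) (hmk : m < k) {z : ℂ} (hz : z ∈ adjacentOverlap k b T.r T.R m) :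
    T.onPetal (m + 1) z - Z k b (m + 1) z - c (m + 1) = T.onPetal m z - Z k b m z - c m := by
  obtain ⟨C, hC⟩ := T.transitionsAreTranslations_iff.1 hT m hm hmk
  have hk' : (0 : ℝ) < k := by exact_mod_cast hk
  have hp0 : 0 < Real.pi / k := div_pos Real.pi_pos hk'
  have e1 : 3 * Real.pi / (4 * k) = 3 / 4 * (Real.pi / k) := by field_simp
  have e2 : Real.pi / (2 * k) = Real.pi / k / 2 := by field_simp
  set d : ℂ := C + (b * (Real.pi / k) : ℝ) * Complex.I - c (m + 1) + c m with hd
  have hdiff : ∀ w ∈ adjacentOverlap k b T.r T.R m,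
      T.onPetal (m + 1) w - Z k b (m + 1) w - c (m + 1) -
        (T.onPetal m w - Z k b m w - c m) = d := fun w hw => by
    rw [hC w hw, Z_add_one_of_mid hk b hw.1.1 hw.2.2, hd]; ring
  have hd0 : d = 0 := by
    refine norm_le_zero_iff.1 (le_of_forall_pos_le_add fun ε hε => ?_)
    obtain ⟨w, hw0, hw, hw'⟩ := ((frequently_arg_rot_eq_zero k (m + 1 / 2)).and_eventually
      ((hc (ε / 2) (half_pos hε)).and self_mem_nhdsWithin)).exists
    have hw1 : w ≠ 0 := hw'
    have hmid : |Complex.arg (rot k (m + 1 / 2) w)| < Real.pi / (2 * k) := by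
      rw [hw0, abs_zero, e2]; linarith
    obtain ⟨a1, a2⟩ := arg_rot_of_mid hk hw1 hmid
    obtain ⟨b1, b2⟩ := hw m (abs_le.2 ⟨hm, hmk.le⟩) (by
      rw [a1, hw0, e1, e2, zero_add, abs_of_pos (by linarith)]; linarith)
    obtain ⟨b3, b4⟩ := hw (m + 1) (abs_le.2 ⟨by omega, by omega⟩) (by
      rw [a2, hw0, e1, e2, zero_sub, abs_neg, abs_of_pos (by linarith)]; linarith)
    rw [← hdiff w ⟨b1, b3, hmid⟩]
    refine (norm_sub_le _ _).trans ?_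
    linarith
  have := hdiff z hz
  rw [hd0] at this
  exact sub_eq_zero.1 this

/-- If the transition functions are translations, the differences between Fatou and time
coordinates are, up to constants, one and the same holomorphic function near the origin. -/
theorem exists_analytic_difference (T : FatouCoordinates f k b) (hk : 1 ≤ k)
    (h : LocalDynamics k b T.g g' ℓ ℓ') (hT : T.TransitionsAreTranslations) :
    ∃ (δ : ℂ → ℂ) (c : ℤ → ℂ), AnalyticAt ℂ δ 0 ∧ δ 0 = 0 ∧
      ∀ᶠ z in 𝓝[≠] (0 : ℂ), ∀ j : ℤ, |j| ≤ k →
        |Complex.arg (rot k j z)| < 3 * Real.pi / (4 * k) →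
        z ∈ S k b T.r T.R j ∧ T.onPetal j z = Z k b j z + δ z + c j := by
  obtain ⟨c, hck, hc⟩ := T.exists_sector_asymptotic hk h
  have hk' : (0 : ℝ) < k := by exact_mod_cast hk
  have hp0 : 0 < Real.pi / k := div_pos Real.pi_pos hk'
  have e1 : 3 * Real.pi / (4 * k) = 3 / 4 * (Real.pi / k) := by field_simp
  have e2 : Real.pi / (2 * k) = Real.pi / k / 2 := by field_simp
  -- for each `z`, a petal whose axis is at distance at most `π / (2 k)` from the direction of
  -- `z`
  choose! sel hsel hsel' using fun (z : ℂ) (hz : z ≠ 0) => exists_abs_arg_rot_le (k := k) hk hz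
  have hsec : ∀ z ≠ 0, |Complex.arg (rot k (sel z) z)| < 3 * Real.pi / (4 * k) := fun z hz =>
    (hsel' z hz).trans_lt (by rw [e1, e2]; linarith)
  set D : ℤ → ℂ → ℂ := fun j z => T.onPetal j z - Z k b j z - c j with hD
  set δ : ℂ → ℂ := fun z => if z = 0 then 0 else D (sel z) z with hδ
  -- the values on different sectors agree
  have hglue : ∀ᶠ z in 𝓝[≠] (0 : ℂ), ∀ j : ℤ, |j| ≤ k →
      |Complex.arg (rot k j z)| < 3 * Real.pi / (4 * k) →
      z ∈ S k b T.r T.R j ∧ δ z = D j z := by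
    filter_upwards [hc 1 one_pos, self_mem_nhdsWithin] with z hz hz0 j hj ha
    have hz0' : z ≠ 0 := hz0
    refine ⟨(hz j hj ha.le).1, ?_⟩
    simp only [hδ, if_neg hz0']
    refine eq_of_sectors (D := fun j => D j z) hk hz0' (fun m hm hmk h1 h2 h3 => ?_)
      (fun h1 => ?_) (hsel z hz0') hj (hsec z hz0') ha
    · exact T.eq_of_adjacent hk hT hc hm hmk
        ⟨(hz m (abs_le.2 ⟨hm, hmk.le⟩) h1.le).1,
          (hz (m + 1) (abs_le.2 ⟨by omega, by omega⟩) h2.le).1, h3⟩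
    · simp only [hD]
      rw [T.onPetal_natCast_neg (hz k (by simp) h1.le).1, LocalDynamics.Z_natCast_neg, hck]
  refine ⟨δ, c, ?_, by simp [hδ], ?_⟩
  -- removable singularity
  · refine Complex.analyticAt_of_differentiable_on_punctured_nhds_of_continuousAt ?_ ?_
    · filter_upwards [eventually_eventually_nhdsWithin.2 hglue, self_mem_nhdsWithin] with z hz hz0
      have hz0' : z ≠ 0 := hz0
      rw [IsOpen.nhdsWithin_eq isOpen_compl_singleton hz0] at hz
      have hzS := (hz.self_of_nhds (sel z) (hsel z hz0') (hsec z hz0')).1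
      have hslit : rot k (sel z) z ∈ Complex.slitPlane :=
        mem_slitPlane_of_abs_arg_lt hk (rot_ne_zero hz0') hzS.2.2.1
      have hcont : ContinuousAt (fun w => |Complex.arg (rot k (sel z) w)|) z := by
        have h1 : ContinuousAt (fun w => rot k (sel z) w) z := by
          unfold rot; fun_prop
        exact ((Complex.continuousAt_arg hslit).comp h1).abs
      have hd : DifferentiableAt ℂ (D (sel z)) z :=
        ((T.differentiableAt_onPetal hk (hsel z hz0') hzS).sub
          (hasDerivAt_Z hk b hz0' hzS.2.2.1).differentiableAt).sub_const _
      refine hd.congr_of_eventuallyEq ?_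
      filter_upwards [hz, hcont.eventually_lt_const (hsec z hz0')] with w h1 h2
      exact (h1 (sel z) (hsel z hz0') h2).2
    · have h0 : δ 0 = 0 := by simp [hδ]
      rw [continuousAt_iff_punctured_nhds, h0, NormedAddGroup.tendsto_nhds_zero]
      intro ε hε
      filter_upwards [hc (ε / 2) (half_pos hε), self_mem_nhdsWithin] with z hz hz0
      have hz0' : z ≠ 0 := hz0
      simp only [hδ, if_neg hz0']
      exact ((hz (sel z) (hsel z hz0') (hsec z hz0').le).2).trans_lt (half_lt_self hε)
  · filter_upwards [hglue] with z hz j hj ha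
    refine ⟨(hz j hj ha).1, ?_⟩
    rw [(hz j hj ha).2]
    simp only [hD]
    ring

end FatouCoordinates

/-! ### From translations to the normal form -/

section

variable {k : ℕ} {b : ℝ} {z : ℂ}

theorem timeShift_add (b : ℝ) (hz : z ≠ 0) (l l' : ℂ) :
    timeShift k b z (l + l') = timeShift k b z l + timeShift k b (z * Complex.exp l) l' := by
  rcases eq_or_ne (k : ℂ) 0 with hk | hk
  · simp [timeShift, hk]; ring
  rw [timeShift, timeShift, timeShift, mul_pow, ← Complex.exp_nat_mul, mul_add, neg_add,
    Complex.exp_add, Complex.exp_neg (k * l)]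
  have h1 := pow_ne_zero k hz
  have h2 := Complex.exp_ne_zero (k * l)
  field_simp
  ring

/-- The effect of a small multiplicative perturbation on the time coordinates. -/
theorem Z_mul_exp (b : ℝ) (hz : z ≠ 0) {j : ℤ} {l : ℂ}
    (h : |Complex.arg (rot k j z) + l.im| < Real.pi) :
    Complex.arg (rot k j (z * Complex.exp l)) = Complex.arg (rot k j z) + l.im ∧
      Z k b j (z * Complex.exp l) = Z k b j z + timeShift k b z l := by
  have h0 := rot_ne_zero (k := k) (θ := j) hz
  have h1 := abs_lt.1 h
  have hlog : Complex.log (rot k j (z * Complex.exp l)) = Complex.log (rot k j z) + l := by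
    rw [rot_mul]
    nth_rewrite 1 [← Complex.exp_log h0]
    rw [← Complex.exp_add, Complex.log_exp]
    · simpa [Complex.log_im] using h1.1
    · simpa [Complex.log_im] using h1.2.le
  refine ⟨?_, ?_⟩
  · have := congrArg Complex.im hlog
    simpa [Complex.log_im] using this
  · rw [Z, Z, hlog, neg_one_div_mul_exp, timeShift]
    ring

/-- A small logarithmic displacement is determined by the time that it takes. -/
theorem eq_of_timeShift_eq (hk : 1 ≤ k) (b : ℝ) : ∃ δ > 0, ∀ z l l' : ℂ, z ≠ 0 → ‖z‖ < δ →
    ‖l‖ < δ → ‖l'‖ < δ → timeShift k b z l = timeShift k b z l' → l = l' := by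
  obtain ⟨δ, hδ, h⟩ := logShift_injective hk b
  refine ⟨min δ 1, by positivity, fun z l l' hz h1 h2 h3 he => ?_⟩
  refine h (z ^ k) l l' ?_ (h2.trans_le (min_le_left _ _)) (h3.trans_le (min_le_left _ _)) ?_
  · rw [norm_pow]
    refine (pow_le_of_le_one (norm_nonneg _) (h1.le.trans (min_le_right _ _))
      (by omega : k ≠ 0)).trans_lt (h1.trans_le (min_le_left _ _))
  · rw [← pow_mul_timeShift b hz, ← pow_mul_timeShift b hz, he]

end

namespace FatouCoordinates

variable {f : ℂ → ℂ} {k : ℕ} {b : ℝ} {g' ℓ ℓ' : ℂ → ℂ}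

/-- The glued difference `δ` between Fatou and time coordinates satisfies the functional equation
expressing that the flow in the time `δ` conjugates the germ to the normal form. -/
theorem difference_functional_equation (T : FatouCoordinates f k b) (hk : 1 ≤ k)
    (h : LocalDynamics k b T.g g' ℓ ℓ') {δ : ℂ → ℂ} {c : ℤ → ℂ} (hδ : AnalyticAt ℂ δ 0)
    (hδ0 : δ 0 = 0)
    (hc : ∀ᶠ z in 𝓝[≠] (0 : ℂ), ∀ j : ℤ, |j| ≤ k →
        |Complex.arg (rot k j z)| < 3 * Real.pi / (4 * k) →
        z ∈ S k b T.r T.R j ∧ T.onPetal j z = Z k b j z + δ z + c j) :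
    ∀ᶠ z in 𝓝[≠] (0 : ℂ),
      timeShift k b (conj z) (ℓ z) + δ (T.g z) = conj (δ z) + 1 / 2 := by
  have hk' : (0 : ℝ) < k := by exact_mod_cast hk
  have hp := pi_div_le hk
  have hp0 : 0 < Real.pi / k := div_pos Real.pi_pos hk'
  have e1 : 3 * Real.pi / (4 * k) = 3 / 4 * (Real.pi / k) := by field_simp
  have e2 : Real.pi / (2 * k) = Real.pi / k / 2 := by field_simp
  have hδt : Tendsto δ (𝓝[≠] 0) (𝓝 0) := by
    have := hδ.continuousAt.tendsto
    rw [hδ0] at this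
    exact this.mono_left nhdsWithin_le_nhds
  have hct : Tendsto (fun z : ℂ => conj z) (𝓝 0) (𝓝 0) := by
    simpa using Complex.continuous_conj.tendsto 0
  have hgt : Tendsto T.g (𝓝[≠] 0) (𝓝[≠] 0) := by
    have h1 : Tendsto (fun z => conj z * Complex.exp (ℓ z)) (𝓝[≠] 0) (𝓝 0) := by
      have h2 := (Complex.continuous_exp.tendsto 0).comp h.step.tendsto
      simpa using (hct.mono_left nhdsWithin_le_nhds).mul h2
    refine tendsto_nhdsWithin_iff.2 ⟨h1.congr' ?_, ?_⟩
    · filter_upwards [h.step.map_eq] with z hz using hz.symm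
    · filter_upwards [h.step.map_eq, self_mem_nhdsWithin] with z hz hz0
      have hz0' : z ≠ 0 := hz0
      change T.g z ≠ 0
      rw [hz]
      exact mul_ne_zero ((map_ne_zero _).2 hz0') (Complex.exp_ne_zero _)
  have hsmall : ∀ᶠ z in 𝓝[≠] (0 : ℂ), ‖ℓ z‖ < Real.pi / k / 4 :=
    (tendsto_zero_iff_norm_tendsto_zero.1 h.step.tendsto).eventually_lt_const (by positivity)
  -- the equation up to a constant depending on the sector
  have hsector : ∀ᶠ z in 𝓝[≠] (0 : ℂ), ∀ j : ℤ, |j| ≤ k →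
      |Complex.arg (rot k (-j : ℤ) z)| ≤ Real.pi / (2 * k) →
      timeShift k b (conj z) (ℓ z) + δ (T.g z) + c j = conj (δ z) + conj (c (-j)) + 1 / 2 := by
    filter_upwards [hc, hgt.eventually hc, hsmall, h.step.map_eq, self_mem_nhdsWithin]
      with z h1 h2 h3 h4 hz0 j hj ha
    have hz0' : z ≠ 0 := hz0
    have hcz : conj z ≠ 0 := (map_ne_zero _).2 hz0'
    rw [e2] at ha
    have ha1 : |Complex.arg (rot k (-j : ℤ) z)| < Real.pi / k := by linarith
    have harg : Complex.arg (rot k j (conj z)) = -Complex.arg (rot k (-j : ℤ) z) := by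
      have := congrArg Complex.im (arg_conj_rot hk ha1).2
      simpa [Complex.log_im] using this
    have him : |(ℓ z).im| < Real.pi / k / 4 := (Complex.abs_im_le_norm _).trans_lt h3
    have hsum : |Complex.arg (rot k j (conj z)) + (ℓ z).im| < 3 / 4 * (Real.pi / k) := by
      rw [harg]
      refine (abs_add_le _ _).trans_lt ?_
      rw [abs_neg]; linarith
    obtain ⟨h5, h6⟩ := Z_mul_exp b hcz (j := j) (l := ℓ z) (by linarith)
    rw [← h4] at h5 h6
    obtain ⟨h7, h8⟩ := h2 j hj (by rw [h5, e1]; exact hsum)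
    obtain ⟨h9, h10⟩ := h1 (-j) (by rwa [abs_neg]) (by rw [e1]; linarith)
    have h11 := T.Φ_map j hj z h9 h7
    change T.onPetal j (T.g z) = conj (T.onPetal (-j) z) + 1 / 2 at h11
    rw [h8, h10, h6, Z_conj hk ha1, map_add, map_add] at h11
    linear_combination h11
  have hlim : Tendsto (fun z => timeShift k b (conj z) (ℓ z) + δ (T.g z) - conj (δ z) - 1 / 2)
      (𝓝[≠] 0) (𝓝 0) := by
    have h1 := h.step.tendsto_shift
    have h2 : Tendsto (fun z => conj (δ z)) (𝓝[≠] 0) (𝓝 0) := hct.comp hδt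
    have h3 := (h1.add (hδt.comp hgt)).sub h2
    simp only [add_zero, sub_zero] at h3
    refine h3.congr fun z => ?_
    simp only [Function.comp_apply]
    push_cast; ring
  -- letting `z` tend to `0` along the axis of a petal
  have hconst : ∀ j : ℤ, |j| ≤ k → c j = conj (c (-j)) := by
    intro j hj
    refine (sub_eq_zero.1 (norm_le_zero_iff.1 (le_of_forall_pos_le_add fun ε hε => ?_))).symm
    obtain ⟨z, hz0, hz, hz'⟩ := ((frequently_arg_rot_eq_zero k ((-j : ℤ) : ℝ)).and_eventually
      (hsector.and ((tendsto_zero_iff_norm_tendsto_zero.1 hlim).eventually_lt_const hε))).exists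
    have h1 := hz j hj (by rw [hz0, abs_zero, e2]; linarith)
    have h2 : conj (c (-j)) - c j =
        timeShift k b (conj z) (ℓ z) + δ (T.g z) - conj (δ z) - 1 / 2 := by
      linear_combination -h1
    rw [h2, zero_add]
    exact hz'.le
  filter_upwards [hsector, self_mem_nhdsWithin] with z h1 hz0
  obtain ⟨i, hi, ha⟩ := exists_abs_arg_rot_le (k := k) hk hz0
  have h2 := h1 (-i) (by rwa [abs_neg]) (by rwa [neg_neg])
  rw [hconst (-i) (by rwa [abs_neg])] at h2
  linear_combination h2

/-- If the transition functions are translations, `z ↦ v^{δ(z)}(z)` conjugates the germ to the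
normal form, where `δ` is the difference between Fatou and time coordinates glued over all the
petals. -/
theorem isConjugateToNormalForm_of_translations (T : FatouCoordinates f k b) (hk : 1 ≤ k)
    (h : LocalDynamics k b T.g g' ℓ ℓ') (hT : T.TransitionsAreTranslations) :
    IsConjugateToNormalForm f k b := by
  obtain ⟨δ, c, hδ, hδ0, hc⟩ := T.exists_analytic_difference hk h hT
  have hfe := T.difference_functional_equation hk h hδ hδ0 hc
  obtain ⟨m, hm0, hh, hm⟩ := exists_flow_along hk b hδ
  obtain ⟨φ, hφ⟩ := exists_isTimeMap hk b
  obtain ⟨n, hn0, hφn, hn⟩ := hφ.exists_log hk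
  obtain ⟨ε, hε, hinj⟩ := eq_of_timeShift_eq hk b
  set h₁ : ℂ → ℂ := fun z => z * Complex.exp (m z) with hh₁
  have hφ0 : φ 0 = 0 := by simpa using hφn.self_of_nhds
  have hct : Tendsto (fun z : ℂ => conj z) (𝓝 0) (𝓝 0) := by
    simpa using Complex.continuous_conj.tendsto 0
  have hgan := T.analyticAt_antiholomorphic
  have hg0 : T.g 0 = 0 := by
    by_contra hne
    have h5 : Tendsto T.g (𝓝[≠] 0) (𝓝 0) := by
      have h6 := (Complex.continuous_exp.tendsto 0).comp h.step.tendsto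
      have h7 : Tendsto (fun z => conj z * Complex.exp (ℓ z)) (𝓝[≠] 0) (𝓝 0) := by
        simpa using (hct.mono_left nhdsWithin_le_nhds).mul h6
      refine h7.congr' ?_
      filter_upwards [h.step.map_eq] with z hz using hz.symm
    have h8 : ContinuousAt T.g 0 := by
      have := ContinuousAt.comp (f := fun z : ℂ => conj z) (g := fun z => T.g (conj z)) (x := 0)
        (by simpa using hgan.continuousAt) Complex.continuous_conj.continuousAt
      simpa [Function.comp_def] using this
    exact hne (tendsto_nhds_unique (h8.tendsto.mono_left nhdsWithin_le_nhds) h5)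
  have hgt : Tendsto T.g (𝓝 0) (𝓝 0) := by
    have := ContinuousAt.comp (f := fun z : ℂ => conj z) (g := fun z => T.g (conj z)) (x := 0)
        (by simpa using hgan.continuousAt) Complex.continuous_conj.continuousAt
    simpa [Function.comp_def, ContinuousAt, hg0] using this
  have hgne : ∀ᶠ z in 𝓝[≠] (0 : ℂ), T.g z ≠ 0 := by
    filter_upwards [h.step.map_eq, self_mem_nhdsWithin] with z hz hz0
    have hz0' : z ≠ 0 := hz0
    rw [hz]
    exact mul_ne_zero ((map_ne_zero _).2 hz0') (Complex.exp_ne_zero _)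
  have hgt' : Tendsto T.g (𝓝[≠] 0) (𝓝[≠] 0) :=
    tendsto_nhdsWithin_iff.2 ⟨hgt.mono_left nhdsWithin_le_nhds, hgne⟩
  have hht : Tendsto h₁ (𝓝[≠] 0) (𝓝[≠] 0) := by
    refine tendsto_nhdsWithin_iff.2 ⟨hh.tendsto.mono_left nhdsWithin_le_nhds, ?_⟩
    filter_upwards [self_mem_nhdsWithin] with z hz0
    have hz0' : z ≠ 0 := hz0
    exact mul_ne_zero hz0' (Complex.exp_ne_zero _)
  have hm0' := hm0.mono_left (nhdsWithin_le_nhds (s := {(0 : ℂ)}ᶜ))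
  have ht1 : Tendsto (fun z => ℓ z + m (T.g z)) (𝓝[≠] 0) (𝓝 0) := by
    simpa using h.step.tendsto.add (hm0'.comp hgt')
  have ht2 : Tendsto (fun z => conj (m z + n (h₁ z))) (𝓝[≠] 0) (𝓝 0) := by
    have : Tendsto (fun z => m z + n (h₁ z)) (𝓝[≠] 0) (𝓝 0) := by
      simpa using hm0'.add (hn0.comp (hht.mono_right nhdsWithin_le_nhds))
    exact hct.comp this
  -- both sides are reached from `conj z` by small displacements which take the same time, by
  -- the functional equation of `δ`
  have hconj : ∀ᶠ z in 𝓝[≠] (0 : ℂ), h₁ (T.g z) = conj (φ (h₁ z)) := by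
    filter_upwards [hfe, hm, hgt'.eventually hm, hht.eventually hn,
      (hh.tendsto.eventually hφn).filter_mono nhdsWithin_le_nhds, h.step.map_eq,
      (tendsto_zero_iff_norm_tendsto_zero.1 ht1).eventually_lt_const hε,
      (tendsto_zero_iff_norm_tendsto_zero.1 ht2).eventually_lt_const hε,
      ((continuous_norm.tendsto' (0 : ℂ) 0 (by simp)).mono_left
        nhdsWithin_le_nhds).eventually_lt_const hε, self_mem_nhdsWithin]
      with z a1 a2 a3 a4 a5 a6 a7 a8 a9 hz0
    have hz0' : z ≠ 0 := hz0
    have hcz : conj z ≠ 0 := (map_ne_zero _).2 hz0'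
    have key : ℓ z + m (T.g z) = conj (m z + n (h₁ z)) := by
      refine hinj (conj z) _ _ hcz (by simpa using a9) a7 a8 ?_
      rw [timeShift_conj, timeShift_add b hcz, timeShift_add b hz0', ← a6, a3, a2]
      change _ = conj (δ z + timeShift k b (h₁ z) (n (h₁ z)))
      rw [a4, a1, map_add, conj_half]
    change T.g z * Complex.exp (m (T.g z)) = conj (φ (h₁ z))
    have a5' : φ (h₁ z) = h₁ z * Complex.exp (n (h₁ z)) := a5
    rw [a5', a6, mul_assoc, ← Complex.exp_add, ← a6, key, hh₁, map_mul, map_mul, ← Complex.exp_conj,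
      ← Complex.exp_conj, map_add, Complex.exp_add]
    ring
  have hconj' : ∀ᶠ z in 𝓝 (0 : ℂ), h₁ (T.g z) = conj (φ (h₁ z)) := by
    rw [eventually_nhdsWithin_iff] at hconj
    filter_upwards [hconj] with z hz
    rcases eq_or_ne z 0 with rfl | hz0
    · have h0 : h₁ 0 = 0 := hh.map_zero
      rw [hg0, h0, hφ0, map_zero]
    · exact hz hz0
  refine ⟨φ, hφ, fun z => h₁ (T.p z), hh.comp T.conj_p.1, ?_⟩
  filter_upwards [T.conj_p.2, T.conj_p.1.tendsto.eventually hconj'] with z h1 h2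
  rw [h1, h2]

end FatouCoordinates

/-! ### From the normal form to translations -/

theorem eventually_forall_mem_S {k : ℕ} (hk : 1 ≤ k) (b r : ℝ) {Q : ℂ → Prop}
    (hQ : ∀ᶠ z in 𝓝[≠] (0 : ℂ), Q z) :
    ∀ᶠ R in atTop, ∀ j : ℤ, ∀ z ∈ S k b r R j, Q z := by
  rw [eventually_nhdsWithin_iff] at hQ
  obtain ⟨ρ, hρ, hb⟩ := Metric.eventually_nhds_iff_ball.1 hQ
  filter_upwards [eventually_norm_lt_of_mem_S hk b r hρ] with R hR j z hz
  exact hb z (mem_ball_zero_iff.2 (hR j z hz)) hz.1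

/-- `H` conjugates the germ `γ` to the half-translation by `ε / 2` in the time coordinate, composed
with the complex conjugation. -/
structure HalfConjugacy (k : ℕ) (b : ℝ) (γ H μ : ℂ → ℂ) (ε : ℝ) : Prop where
  tendsto : Tendsto μ (𝓝[≠] 0) (𝓝 0)
  map_eq : ∀ᶠ z in 𝓝[≠] (0 : ℂ), H (γ z) = conj (H z) * Complex.exp (μ z)
  shift : ∀ᶠ z in 𝓝[≠] (0 : ℂ), timeShift k b (conj (H z)) (μ z) = (ε / 2 : ℝ)

theorem tendsto_conj_punctured : Tendsto (fun z : ℂ => conj z) (𝓝[≠] 0) (𝓝[≠] 0) := by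
  refine tendsto_nhdsWithin_iff.2 ⟨?_, ?_⟩
  · have h : Tendsto (fun z : ℂ => conj z) (𝓝 0) (𝓝 0) := by
      simpa using Complex.continuous_conj.tendsto 0
    exact h.mono_left nhdsWithin_le_nhds
  · filter_upwards [self_mem_nhdsWithin] with z hz
    simpa using hz

theorem HalfStep.tendsto_punctured {k : ℕ} {b : ℝ} {γ ℓ : ℂ → ℂ} {ε : ℝ}
    (h : HalfStep k b γ ℓ ε) : Tendsto γ (𝓝[≠] 0) (𝓝[≠] 0) := by
  have hct := tendsto_nhdsWithin_iff.1 tendsto_conj_punctured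
  have h1 : Tendsto (fun z => conj z * Complex.exp (ℓ z)) (𝓝[≠] 0) (𝓝 0) := by
    have h2 := (Complex.continuous_exp.tendsto 0).comp h.tendsto
    simpa using hct.1.mul h2
  refine tendsto_nhdsWithin_iff.2 ⟨h1.congr' ?_, ?_⟩
  · filter_upwards [h.map_eq] with z hz using hz.symm
  · filter_upwards [h.map_eq, self_mem_nhdsWithin] with z hz hz0
    have hz0' : z ≠ 0 := hz0
    change γ z ≠ 0
    rw [hz]
    exact mul_ne_zero ((map_ne_zero _).2 hz0') (Complex.exp_ne_zero _)

theorem IsHolomorphicDiffeo.tendsto_punctured {H : ℂ → ℂ} (hH : IsHolomorphicDiffeo H) :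
    Tendsto H (𝓝[≠] 0) (𝓝[≠] 0) := by
  obtain ⟨H', hH', hl, -⟩ := hH.exists_inverse
  refine tendsto_nhdsWithin_iff.2 ⟨hH.tendsto.mono_left nhdsWithin_le_nhds, ?_⟩
  filter_upwards [hl.filter_mono nhdsWithin_le_nhds, self_mem_nhdsWithin] with z h1 h2 h3
  have h4 : H z = 0 := h3
  rw [h4, hH'.map_zero] at h1
  exact h2 h1.symm

/-- A conjugacy to the normal form is one for the germ and for its inverse. -/
theorem LocalDynamics.exists_halfConjugacy {k : ℕ} {b : ℝ} {g g' ℓ ℓ' H φ : ℂ → ℂ}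
    (hk : 1 ≤ k) (h : LocalDynamics k b g g' ℓ ℓ') (hH : IsHolomorphicDiffeo H)
    (hφ : IsTimeMap k b (1 / 2) φ) (hc : ∀ᶠ z in 𝓝 (0 : ℂ), H (g z) = conj (φ (H z))) (j : ℤ) :
    ∃ μ, HalfConjugacy k b (contractingBranch g g' j) H μ (par j) := by
  obtain ⟨n, hn0, hφn, hn⟩ := hφ.exists_log hk
  have hHt := hH.tendsto_punctured
  have hct := (tendsto_nhdsWithin_iff.1 tendsto_conj_punctured).1
  have hct' : Tendsto (fun z : ℂ => conj z) (𝓝 0) (𝓝 0) := by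
    simpa using Complex.continuous_conj.tendsto 0
  have hg : HalfConjugacy k b g H (fun z => conj (n (H z))) 1 := by
    refine ⟨hct'.comp (hn0.comp (hHt.mono_right nhdsWithin_le_nhds)), ?_, ?_⟩
    · filter_upwards [hc.filter_mono nhdsWithin_le_nhds,
        (hH.tendsto.eventually hφn).filter_mono nhdsWithin_le_nhds] with z h1 h2
      rw [h1, h2, map_mul, ← Complex.exp_conj]
    · filter_upwards [hHt.eventually hn] with z h1
      rw [timeShift_conj, h1, conj_half]
      push_cast; ring
  by_cases hj : Odd j
  · rw [contractingBranch, par, if_pos hj, if_pos hj]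
    exact ⟨_, hg⟩
  · rw [contractingBranch, par, if_neg hj, if_neg hj]
    have hg't := h.step_inv.tendsto_punctured
    have hmap : ∀ᶠ z in 𝓝[≠] (0 : ℂ),
        conj (H z) = H (g' z) * Complex.exp (n (H (g' z))) := by
      filter_upwards [hg't.eventually hg.map_eq, h.right_inv.filter_mono nhdsWithin_le_nhds]
        with z h1 h2
      rw [h2] at h1
      rw [h1, map_mul, Complex.conj_conj, ← Complex.exp_conj, Complex.conj_conj]
    refine ⟨fun z => -n (H (g' z)), ?_, ?_, ?_⟩
    · have := (hn0.comp ((hHt.mono_right nhdsWithin_le_nhds).comp hg't)).neg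
      rwa [neg_zero] at this
    · filter_upwards [hmap] with z h1
      rw [h1, mul_assoc, ← Complex.exp_add, add_neg_cancel, Complex.exp_zero, mul_one]
    · filter_upwards [hmap, hg't.eventually (hHt.eventually hn),
        hg't.eventually (tendsto_nhdsWithin_iff.1 hHt).2] with z h1 h2 h3
      rw [h1, timeShift_mul_exp_neg b h3, h2]
      push_cast; ring

/-- The variation of the time coordinate under the diffeomorphism `H(z) = lam * z * exp (ω z)`, up
to the constant `b * log lam`. -/
noncomputable def timeChange (k : ℕ) (b : ℝ) (H ω : ℂ → ℂ) (z : ℂ) : ℂ :=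
  1 / (k * z ^ k) - 1 / (k * H z ^ k) + b * ω z

theorem IsHolomorphicDiffeo.exists_log {H : ℂ → ℂ} (hH : IsHolomorphicDiffeo H) :
    ∃ ω : ℂ → ℂ, Tendsto ω (𝓝[≠] 0) (𝓝 0) ∧
      (∀ᶠ z in 𝓝[≠] (0 : ℂ), DifferentiableAt ℂ ω z) ∧
      ∀ᶠ z in 𝓝[≠] (0 : ℂ), H z = deriv H 0 * z * Complex.exp (ω z) := by
  set lam := deriv H 0 with hlam
  have hl0 : lam ≠ 0 := hH.deriv_ne_zero
  have ht : Tendsto (fun z => H z / (lam * z)) (𝓝[≠] 0) (𝓝 1) := by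
    have h1 := hasDerivAt_iff_tendsto_slope.1 hH.analyticAt.differentiableAt.hasDerivAt
    have h2 := h1.div_const lam
    rw [div_self hl0] at h2
    refine h2.congr' ?_
    filter_upwards [self_mem_nhdsWithin] with z hz
    have hz0 : z ≠ 0 := hz
    rw [slope_def_field, hH.map_zero, sub_zero, sub_zero, div_div, mul_comm z]
  refine ⟨fun z => Complex.log (H z / (lam * z)), ?_, ?_, ?_⟩
  · have h1 : ContinuousAt Complex.log 1 := continuousAt_clog (by simp)
    have h2 := h1.tendsto.comp ht
    rwa [Complex.log_one] at h2
  · have h1 : ∀ᶠ z in 𝓝[≠] (0 : ℂ), H z / (lam * z) ∈ Complex.slitPlane :=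
      ht.eventually (Complex.isOpen_slitPlane.mem_nhds (by simp))
    filter_upwards [h1, hH.analyticAt.eventually_analyticAt.filter_mono nhdsWithin_le_nhds,
      self_mem_nhdsWithin] with z h2 h3 h4
    have hz0 : z ≠ 0 := h4
    exact (h3.differentiableAt.div (by fun_prop) (mul_ne_zero hl0 hz0)).clog h2
  · have h1 : ∀ᶠ z in 𝓝[≠] (0 : ℂ), H z / (lam * z) ≠ 0 := ht.eventually_ne one_ne_zero
    filter_upwards [h1, self_mem_nhdsWithin] with z h2 h3
    have hz0 : z ≠ 0 := h3
    rw [Complex.exp_log h2]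
    field_simp

/-- A conjugacy to the normal form transforms the time coordinates into Fatou coordinates. -/
theorem HalfConjugacy.timeChange_eq {k : ℕ} {b : ℝ} {γ ℓ H μ ω : ℂ → ℂ} {ε : ℝ}
    (h : HalfConjugacy k b γ H μ ε) (hγ : HalfStep k b γ ℓ ε) (hH : IsHolomorphicDiffeo H)
    (hω0 : Tendsto ω (𝓝[≠] 0) (𝓝 0))
    (hω : ∀ᶠ z in 𝓝[≠] (0 : ℂ), H z = deriv H 0 * z * Complex.exp (ω z)) :
    ∀ᶠ z in 𝓝[≠] (0 : ℂ), timeChange k b H ω (γ z) =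
      conj (timeChange k b H ω z) + (ε / 2 : ℝ) - timeShift k b (conj z) (ℓ z) := by
  set lam := deriv H 0 with hlam
  have hl0 : lam ≠ 0 := hH.deriv_ne_zero
  have hγt := hγ.tendsto_punctured
  have hct : Tendsto (fun z : ℂ => conj z) (𝓝 0) (𝓝 0) := by
    simpa using Complex.continuous_conj.tendsto 0
  have hA : Tendsto (fun z => ℓ z + ω (γ z)) (𝓝[≠] 0) (𝓝 0) := by
    simpa using hγ.tendsto.add (hω0.comp hγt)
  have hB : Tendsto (fun z => conj (ω z) + μ z) (𝓝[≠] 0) (𝓝 0) := by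
    simpa using (hct.comp hω0).add h.tendsto
  have heq : ∀ᶠ z in 𝓝[≠] (0 : ℂ), lam * Complex.exp (ℓ z + ω (γ z)) =
      conj lam * Complex.exp (conj (ω z) + μ z) := by
    filter_upwards [hω, hγt.eventually hω, h.map_eq, hγ.map_eq, self_mem_nhdsWithin]
      with z h1 h2 h3 h4 h5
    have hz0 : conj z ≠ 0 := (map_ne_zero _).2 h5
    rw [h2, h1, map_mul, map_mul, ← Complex.exp_conj] at h3
    rw [Complex.exp_add, Complex.exp_add]
    refine mul_left_cancel₀ hz0 ?_
    linear_combination h3 - lam * Complex.exp (ω (γ z)) * h4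
  -- the multiplier of `H` is real
  have hreal : lam = conj lam := by
    have h1 := ((Complex.continuous_exp.tendsto 0).comp hA).const_mul lam
    have h2 := ((Complex.continuous_exp.tendsto 0).comp hB).const_mul (conj lam)
    rw [Complex.exp_zero, mul_one] at h1 h2
    exact tendsto_nhds_unique (h1.congr' heq) h2
  have hsmall : ∀ {u : ℂ → ℂ}, Tendsto u (𝓝[≠] 0) (𝓝 0) →
      ∀ᶠ z in 𝓝[≠] (0 : ℂ), |(u z).im| < Real.pi := fun hu => by
    filter_upwards [(tendsto_zero_iff_norm_tendsto_zero.1 hu).eventually_lt_const Real.pi_pos]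
      with z hz
    exact (Complex.abs_im_le_norm _).trans_lt hz
  filter_upwards [heq, hsmall hA, hsmall hB, h.map_eq, h.shift, hγ.map_eq] with z h1 h2 h3 h4 h5 h6
  have hsum : ℓ z + ω (γ z) = conj (ω z) + μ z := by
    rw [← hreal] at h1
    have h2' := abs_lt.1 h2
    have h3' := abs_lt.1 h3
    exact Complex.exp_inj_of_neg_pi_lt_of_le_pi h2'.1 h2'.2.le h3'.1 h3'.2.le
      (mul_left_cancel₀ hl0 h1)
  have e1 := neg_one_div_mul_exp (k := k) (conj z) (ℓ z)
  have e2 := neg_one_div_mul_exp (k := k) (conj (H z)) (μ z)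
  rw [← h6] at e1
  rw [← h4] at e2
  rw [timeShift] at h5 ⊢
  have e3 : conj (timeChange k b H ω z) =
      1 / (k * conj z ^ k) - 1 / (k * conj (H z) ^ k) + b * conj (ω z) := by
    simp [timeChange]
  rw [e3, timeChange]
  rw [neg_div, neg_div] at e1 e2
  linear_combination b * hsum - e1 + e2 + h5

/-- A change of coordinate modifies the time coordinate by at most a multiple of it. -/
theorem exists_norm_timeChange_le {k : ℕ} (hk : 1 ≤ k) (b : ℝ) {H ω : ℂ → ℂ}
    (hH : IsHolomorphicDiffeo H) (hω0 : Tendsto ω (𝓝[≠] 0) (𝓝 0))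
    (hω : ∀ᶠ z in 𝓝[≠] (0 : ℂ), H z = deriv H 0 * z * Complex.exp (ω z)) :
    ∃ C, ∀ᶠ z in 𝓝[≠] (0 : ℂ), ‖timeChange k b H ω z‖ * ‖z‖ ^ k ≤ C := by
  have hk0 : (k : ℂ) ≠ 0 := by exact_mod_cast (by omega : k ≠ 0)
  set lam := deriv H 0 with hlam
  have hl0 : lam ≠ 0 := hH.deriv_ne_zero
  have hz : Tendsto (fun z : ℂ => z) (𝓝[≠] 0) (𝓝 0) := nhdsWithin_le_nhds
  obtain ⟨L, h1⟩ : ∃ L, Tendsto (fun z => 1 / (k : ℂ) -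
      1 / (k * (lam * Complex.exp (ω z)) ^ k) + b * ω z * z ^ k) (𝓝[≠] 0) (𝓝 L) := by
    refine ⟨1 / (k : ℂ) - 1 / (k * (lam * Complex.exp 0) ^ k) + b * 0 * 0 ^ k, ?_⟩
    refine Tendsto.add (Tendsto.sub tendsto_const_nhds ?_)
      ((hω0.const_mul _).mul (hz.pow k))
    refine Tendsto.div tendsto_const_nhds ((((Complex.continuous_exp.tendsto 0).comp
      hω0).const_mul lam).pow k |>.const_mul _) ?_
    exact mul_ne_zero hk0 (pow_ne_zero k (mul_ne_zero hl0 (Complex.exp_ne_zero _)))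
  refine ⟨‖L‖ + 1, ?_⟩
  filter_upwards [h1.norm.eventually_le_const (lt_add_one _), hω, self_mem_nhdsWithin]
    with z h2 h3 h4
  have hz0 : z ≠ 0 := h4
  refine le_trans (le_of_eq ?_) h2
  rw [← norm_pow, ← norm_mul, timeChange, h3]
  congr 1
  have hE : lam * Complex.exp (ω z) ≠ 0 := mul_ne_zero hl0 (Complex.exp_ne_zero _)
  rw [mul_right_comm lam z, mul_pow _ z]
  generalize lam * Complex.exp (ω z) = E at hE
  field_simp

/-! ### Fatou coordinates of a germ conjugate to the normal form -/

namespace FatouCoordinates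

variable {f : ℂ → ℂ} {k : ℕ} {b : ℝ} {g' ℓ ℓ' H ω : ℂ → ℂ}

/-- If the germ is conjugate to the normal form by `H`, its Fatou coordinates are, deep in the
petals and up to constants, the time coordinates modified by `H`. -/
theorem exists_onPetal_eq (T : FatouCoordinates f k b) (hk : 1 ≤ k)
    (h : LocalDynamics k b T.g g' ℓ ℓ') (hH : IsHolomorphicDiffeo H)
    (hω0 : Tendsto ω (𝓝[≠] 0) (𝓝 0)) (hωd : ∀ᶠ z in 𝓝[≠] (0 : ℂ), DifferentiableAt ℂ ω z)
    (hω : ∀ᶠ z in 𝓝[≠] (0 : ℂ), H z = deriv H 0 * z * Complex.exp (ω z))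
    {j : ℤ} (hj : |j| ≤ k)
    (hμ : ∃ μ, HalfConjugacy k b (contractingBranch T.g g' j) H μ (par j)) :
    ∃ R C, ∀ z ∈ S k b T.r R j, T.onPetal j z = Z k b j z + timeChange k b H ω z + C := by
  obtain ⟨μ, hμ⟩ := hμ
  set γ := contractingBranch T.g g' j with hγ
  have hstep := (h.branch j).1
  have hΔ := hμ.timeChange_eq hstep hH hω0 hω
  obtain ⟨C, hC⟩ := exists_norm_timeChange_le hk b hH hω0 hω
  obtain ⟨R', R, Φ, c, hR', -, hΦ, hpet, hΦT⟩ := T.exists_eq_normalized hk h hj 0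
  have hbij := T.time_bijOn j hj
  have hk0 : (k : ℂ) ≠ 0 := by exact_mod_cast (by omega : k ≠ 0)
  have hdiff : ∀ᶠ z in 𝓝[≠] (0 : ℂ), DifferentiableAt ℂ (timeChange k b H ω) z := by
    filter_upwards [hωd, hH.analyticAt.eventually_analyticAt.filter_mono nhdsWithin_le_nhds,
      (tendsto_nhdsWithin_iff.1 hH.tendsto_punctured).2, self_mem_nhdsWithin] with z h1 h2 h3 h4
    have hz0 : z ≠ 0 := h4
    have h3' : H z ≠ 0 := h3
    have h5 := h2.differentiableAt
    have d1 : DifferentiableAt ℂ (fun z : ℂ => 1 / ((k : ℂ) * z ^ k)) z :=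
      DifferentiableAt.div (by fun_prop) (by fun_prop) (mul_ne_zero hk0 (pow_ne_zero k hz0))
    have d2 : DifferentiableAt ℂ (fun z : ℂ => 1 / ((k : ℂ) * H z ^ k)) z :=
      DifferentiableAt.div (by fun_prop) (by fun_prop) (mul_ne_zero hk0 (pow_ne_zero k h3'))
    exact (d1.sub d2).add (h1.const_mul _)
  obtain ⟨R₂, h1, h2, h3, h4, h5, h6, h7⟩ :=
    ((eventually_forall_mem_S hk b T.r (((hΔ.and
        (hstep.tendsto_punctured.eventually hΔ)).and hC).and hdiff)).and
      ((hstep.eventually_two_steps hk T.r_pos).and ((eventually_le_norm_Z hk b T.r).and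
      ((eventually_forall_mem_S hk b T.r (differentiableAt_invFunOn_Z hk)).and
      ((eventually_ge_atTop R).and ((eventually_ge_atTop R').and
        (eventually_ge_atTop (T.R + 2)))))))).exists
  have h2 := h2 j rfl R₂ le_rfl
  set ψ := Function.invFunOn (Z k b j) (S k b T.r T.R j) with hψ
  have hmem : ∀ X ∈ basicPetal R₂, ψ (par j * X) ∈ S k b T.r R₂ j ∧
      (par j : ℂ) * Z k b j (ψ (par j * X)) = X := fun X hX =>
    invFunOn_Z_mem hbij (by linarith) hX
  have hinv : ∀ z ∈ S k b T.r T.R j, ψ (Z k b j z) = z := fun z hz =>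
    hbij.injOn.leftInvOn_invFunOn hz
  have hpar : (par j : ℂ) * par j = 1 := by rw [← Complex.ofReal_mul, par_mul_self]; simp
  -- the time coordinate modified by `H` conjugates the dynamics to the unit translation and has
  -- linear growth, so that it is the Fatou coordinate up to a constant
  set Ψ : ℂ → ℂ := fun X => par j * (Z k b j (ψ (par j * X)) + timeChange k b H ω (ψ (par j * X)))
    with hΨ
  have hΨd : DifferentiableOn ℂ Ψ (basicPetal R₂) := by
    intro X hX
    obtain ⟨hz, hzX⟩ := hmem X hX
    have hzT := S_anti (by linarith : T.R ≤ R₂) j hz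
    have hW : (par j : ℂ) * X = Z k b j (ψ (par j * X)) := by
      rw [hbij.surjOn.rightInvOn_invFunOn (par_mul_mem_U (basicPetal_anti (by linarith) hX))]
    have d1 : DifferentiableAt ℂ ψ (par j * X) := by
      rw [hW]; exact h4 j _ hz T.r T.R j hbij hzT
    have d2 : DifferentiableAt ℂ (fun X : ℂ => ψ (par j * X)) X :=
      DifferentiableAt.comp (g := ψ) X d1 (by fun_prop)
    have d3 := (hasDerivAt_Z hk b hz.1 hz.2.2.1).differentiableAt
    have d4 := (h1 j _ hz).2
    have d5 : DifferentiableAt ℂ (fun z => Z k b j z + timeChange k b H ω z) (ψ (par j * X)) :=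
      d3.add d4
    exact ((DifferentiableAt.comp (g := fun z => Z k b j z + timeChange k b H ω z) X d5
      d2).const_mul _).differentiableWithinAt
  have hΨF : ∀ X ∈ basicPetal R₂, petalMap k b T.r T.R j γ X ∈ basicPetal R₂ →
      Ψ (petalMap k b T.r T.R j γ X) = Ψ X + 1 := by
    intro X hX _
    obtain ⟨hz, hzX⟩ := hmem X hX
    obtain ⟨p1, p2, p3, p4⟩ := h2 _ hz
    obtain ⟨⟨⟨q1, q2⟩, -⟩, -⟩ := h1 j _ hz
    have hzT := S_anti (by linarith : T.R ≤ R₂) j hz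
    have hFX : petalMap k b T.r T.R j γ X =
        par j * Z k b j (γ (γ (ψ (par j * X)))) := by
      nth_rewrite 1 [← hzX]
      exact petalMap_apply hbij hzT
    have hγT := S_anti (by linarith : T.R ≤ R₂ - 2) j p2
    rw [← hγ] at p3 p4 hγT q2
    have hψγ : ψ (Z k b j (γ (γ (ψ (par j * X))))) = γ (γ (ψ (par j * X))) := hinv _ hγT
    simp only [hΨ]
    rw [hFX, par_mul_par_mul, hψγ, p4, q2, p3, q1]
    simp only [map_add, map_sub, Complex.conj_conj, Complex.conj_ofReal]
    push_cast
    linear_combination hpar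
  have hΨb : ∀ X ∈ basicPetal R₂, ‖Ψ X‖ ≤ 0 + (1 + 2 * k * C) * ‖X‖ := by
    intro X hX
    obtain ⟨hz, hzX⟩ := hmem X hX
    obtain ⟨⟨-, q3⟩, -⟩ := h1 j _ hz
    have q4 := h3 j _ hz
    have hnorm : ‖Z k b j (ψ (par j * X))‖ = ‖X‖ := by
      nth_rewrite 2 [← hzX]
      rw [norm_mul, norm_par, one_mul]
    rw [hnorm] at q4
    have hn : ‖Ψ X‖ ≤ ‖X‖ + ‖timeChange k b H ω (ψ (par j * X))‖ := by
      simp only [hΨ]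
      rw [norm_mul, norm_par, one_mul, ← hnorm]
      exact norm_add_le _ _
    set t := ‖timeChange k b H ω (ψ (par j * X))‖ with ht
    have ht0 : 0 ≤ t := norm_nonneg _
    have h8 : t ≤ 2 * k * C * ‖X‖ := by
      calc t = t * 1 := (mul_one t).symm
        _ ≤ t * (2 * k * ‖X‖ * ‖ψ (par j * X)‖ ^ k) := by gcongr
        _ = 2 * k * ‖X‖ * (t * ‖ψ (par j * X)‖ ^ k) := by ring
        _ ≤ 2 * k * ‖X‖ * C := by gcongr
        _ = 2 * k * C * ‖X‖ := by ring
    linarith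
  obtain ⟨d, hd⟩ := hΦ.eq_add_const h5 hΨd hΨF (Or.inr ⟨_, _, hΨb⟩)
  refine ⟨R₂, par j * (c - d), fun z hz => ?_⟩
  have hzT := S_anti (by linarith : T.R ≤ R₂) j hz
  have hX : (par j : ℂ) * Z k b j z ∈ basicPetal R₂ := mem_U_iff.1 hz.2.2.2
  have e1 := hΦT _ (basicPetal_anti h5 hX)
  have e2 := hd _ hX
  simp only [hΨ, par_mul_par_mul, hinv z hzT] at e1 e2
  have e3 : (par j : ℂ) * T.onPetal j z =
      par j * (Z k b j z + timeChange k b H ω z) + (c - d) := by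
    rw [onPetal, e1, e2]; ring
  have e4 := congrArg (fun w => (par j : ℂ) * w) e3
  simp only [mul_add, par_mul_par_mul] at e4
  exact e4

end FatouCoordinates

/-- A connected part of the intersection of a petal with a translate of the opposite petal. -/
def stripRegion (R s d : ℝ) : Set ℂ :=
  {W | R < -s * W.im ∧ R < -s * (W.im - d)} ∪ {W | R < -s * W.im ∧ R < -s * W.re} ∪
    {W | R < s * W.re ∧ R < -s * (W.im - d)}

theorem isOpen_stripRegion (R s d : ℝ) : IsOpen (stripRegion R s d) := by
  have him := Complex.continuous_im
  have hre := Complex.continuous_re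
  refine IsOpen.union (IsOpen.union ?_ ?_) ?_
  all_goals
    refine IsOpen.and (isOpen_lt continuous_const ?_) (isOpen_lt continuous_const ?_) <;> fun_prop

theorem isPreconnected_stripRegion (R d : ℝ) {s : ℝ} (hs : s = 1 ∨ s = -1) :
    IsPreconnected (stripRegion R s d) := by
  have hss : s * s = 1 := by rcases hs with rfl | rfl <;> norm_num
  have hconv : ∀ (u v : ℂ →ₗ[ℝ] ℝ) (A B : ℝ), IsPreconnected {W : ℂ | A < u W ∧ B < v W} := by
    intro u v A B
    have h1 : Convex ℝ {W : ℂ | A < u W} := convex_halfSpace_gt u.isLinear A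
    have h2 : Convex ℝ {W : ℂ | B < v W} := convex_halfSpace_gt v.isLinear B
    exact (h1.inter h2).isPreconnected
  have c1 : IsPreconnected {W : ℂ | R < -s * W.im ∧ R < -s * (W.im - d)} := by
    convert hconv (-s • Complex.imLm) (-s • Complex.imLm) R (R - s * d) using 2
    ext W
    simp only [LinearMap.smul_apply, Complex.imLm_coe, smul_eq_mul]
    constructor <;> rintro ⟨h1, h2⟩ <;> constructor <;> linarith
  have c2 : IsPreconnected {W : ℂ | R < -s * W.im ∧ R < -s * W.re} := by
    exact hconv (-s • Complex.imLm) (-s • Complex.reLm) R R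
  have c3 : IsPreconnected {W : ℂ | R < s * W.re ∧ R < -s * (W.im - d)} := by
    convert hconv (s • Complex.reLm) (-s • Complex.imLm) R (R - s * d) using 2
    ext W
    simp only [LinearMap.smul_apply, Complex.imLm_coe, Complex.reLm_coe, smul_eq_mul]
    constructor <;> rintro ⟨h1, h2⟩ <;> constructor <;> linarith
  have e1 : ∀ x : ℝ, -s * (-s * x) = x := fun x => by linear_combination x * hss
  have e2 : ∀ x : ℝ, s * (s * x) = x := fun x => by linear_combination x * hss
  have hsd : |s * d| = |d| := by
    rw [abs_mul]; rcases hs with rfl | rfl <;> norm_num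
  set M : ℝ := |R| + |d| + 1 with hM
  have hR := le_abs_self R
  have hd := abs_le.1 hsd.le
  have hM1 : R < M := by have := abs_nonneg d; linarith
  have hM2 : R < M + s * d := by linarith [hd.1]
  have hmem : ∀ x : ℝ, (⟨x, -s * M⟩ : ℂ) ∈ {W : ℂ | R < -s * W.im ∧ R < -s * (W.im - d)} :=
    fun x => ⟨by simpa only [e1] using hM1, by rw [mul_sub, e1]; linarith⟩
  refine IsPreconnected.union (⟨s * M, -s * M⟩ : ℂ) (Or.inl (hmem _)) ?_ ?_ c3
  · exact ⟨by simpa only [e2] using hM1, by simp only; rw [mul_sub, e1]; linarith⟩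
  · exact IsPreconnected.union (⟨-s * M, -s * M⟩ : ℂ) (hmem _)
      ⟨by simpa only [e1] using hM1, by simpa only [e1] using hM1⟩ c1 c2

theorem par_add_one (m : ℤ) : par (m + 1) = -par m := by
  unfold par
  rcases Int.even_or_odd m with he | ho
  · have h1 : ¬ Odd m := Int.not_odd_iff_even.2 he
    have h2 : Odd (m + 1) := he.add_one
    simp [h1, h2]
  · have h2 : ¬ Odd (m + 1) := Int.not_odd_iff_even.2 ho.add_one
    simp [ho, h2]

theorem stripRegion_subset {R d : ℝ} {m : ℤ} {W : ℂ} (h : W ∈ stripRegion R (par m) d) :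
    W ∈ U R m ∧ W - d * Complex.I ∈ U R (m + 1) := by
  have habs : ∀ y : ℝ, R < -par m * y → R < |y| := fun y hy => by
    refine hy.trans_le ((le_abs_self _).trans ?_)
    rw [abs_mul, abs_neg, abs_par, one_mul]
  rw [mem_U_iff, mem_U_iff, par_add_one]
  simp only [basicPetal, Set.mem_ofPred_eq, Complex.re_ofReal_mul, Complex.im_ofReal_mul,
    Complex.sub_im, Complex.sub_re, Complex.I_im, Complex.I_re, mul_one, mul_zero, sub_zero,
    abs_mul, abs_neg, abs_par, one_mul]
  rcases h with (⟨h1, h2⟩ | ⟨h1, h2⟩) | ⟨h1, h2⟩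
  · exact ⟨Or.inl (habs _ h1), Or.inl (habs _ h2)⟩
  · exact ⟨Or.inl (habs _ h1), Or.inr h2⟩
  · exact ⟨Or.inr h1, Or.inl (habs _ h2)⟩

/-- The time coordinate of the `m`-th petal maps the overlap with the next one into a connected
region. On the overlap the leading term of the time coordinate lies in one half-plane, and the
bound on `R` makes the logarithmic term too small for `W` to cross the strip `|Im W| ≤ R` to the
other side. -/
theorem Z_mem_stripRegion {k : ℕ} (hk : 1 ≤ k) {b r R : ℝ} {m : ℤ} (hR : 2 * Real.pi * |b| / k < R)
    {z : ℂ} (hz : z ∈ adjacentOverlap k b r R m) :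
    Z k b m z ∈ stripRegion R (par m) (b * (Real.pi / k)) := by
  obtain ⟨hzm, hzm', hmid⟩ := hz
  have hz0 := hzm.1
  have hk' : (0 : ℝ) < k := by exact_mod_cast hk
  have hp0 : 0 < Real.pi / k := div_pos Real.pi_pos hk'
  have e2 : Real.pi / (2 * k) = Real.pi / k / 2 := by field_simp
  obtain ⟨harg, -⟩ := arg_rot_of_mid hk hz0 hmid
  have hW := hzm.2.2.2
  have hW' := hzm'.2.2.2
  rw [Z_add_one_of_mid hk b hz0 hmid] at hW'
  rw [mem_U_iff] at hW
  rw [mem_U_iff, par_add_one] at hW'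
  set W := Z k b m z with hWdef
  set t := Complex.arg (rot k m z) with ht
  have ht0 : 0 < t ∧ t < Real.pi / k := by
    have := abs_lt.1 hmid
    rw [e2] at this
    rw [harg, e2]
    constructor <;> linarith [this.1, this.2]
  -- the leading term of the time coordinate lies in one half-plane
  have hlead : 0 < -par m * (W.im - b * t) := by
    have h1 : (W.im - b * t) = (-1 / (k * z ^ k) : ℂ).im := by
      rw [hWdef, Z, Complex.add_im, Complex.im_ofReal_mul, Complex.log_im]; ring
    have h2 : par m * (-1 / (k * z ^ k) : ℂ).im = (slitCoord k m z).im := by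
      rw [slitCoord_eq hk, Complex.im_ofReal_mul]
    have h3 := congrArg Complex.im (natCast_mul_slitCoord (j := m) hk hz0)
    have h4 : ((k : ℂ) * slitCoord k m z).im = k * (slitCoord k m z).im := by
      simp
    have h5 : (-((k : ℂ) * Complex.log (rot k m z))).im = -(k * t) := by
      simp [Complex.log_im, ht]
    rw [h4, Complex.exp_im, h5, Real.sin_neg] at h3
    have h6 : 0 < Real.sin (k * t) := by
      refine Real.sin_pos_of_pos_of_lt_pi (mul_pos hk' ht0.1) ?_
      have := mul_lt_mul_of_pos_left ht0.2 hk'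
      rwa [mul_div_cancel₀ _ hk'.ne'] at this
    have h7 : k * (slitCoord k m z).im < 0 := by
      rw [h3]
      have := mul_pos (Real.exp_pos (-((k : ℂ) * Complex.log (rot k m z))).re) h6
      linarith
    have h8 : (slitCoord k m z).im < 0 := by
      by_contra hc
      push Not at hc
      have := mul_nonneg hk'.le hc
      linarith
    rw [h1, neg_mul, h2]
    linarith
  have hbR : |b| * (Real.pi / k) ≤ R / 2 := by
    have : 2 * Real.pi * |b| / k = 2 * (|b| * (Real.pi / k)) := by ring
    linarith
  have hR0 : 0 ≤ R := by
    have := mul_nonneg (abs_nonneg b) hp0.le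
    linarith
  have hsmall : ∀ u : ℝ, |u| ≤ Real.pi / k → -R ≤ -par m * (b * u) := fun u hu => by
    have h1 : |(-par m) * (b * u)| ≤ |b| * (Real.pi / k) := by
      rw [abs_mul, abs_neg, abs_par, one_mul, abs_mul]
      gcongr
    linarith [(abs_le.1 h1).1]
  have hlow : -R < -par m * W.im := by
    have := hsmall t (by rw [abs_of_pos ht0.1]; exact ht0.2.le)
    linarith
  have hlow' : -R < -par m * (W.im - b * (Real.pi / k)) := by
    have := hsmall (t - Real.pi / k) (by rw [abs_le]; constructor <;> linarith [ht0.1, ht0.2])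
    linarith
  have hlt : ∀ y : ℝ, -R < -par m * y → R < |y| → R < -par m * y := fun y h1 h2 => by
    have h3 : |(-par m) * y| = |y| := by rw [abs_mul, abs_neg, abs_par, one_mul]
    rw [← h3] at h2
    rcases lt_abs.1 h2 with h4 | h4
    · exact h4
    · linarith
  simp only [basicPetal, Set.mem_ofPred_eq, Complex.re_ofReal_mul, Complex.im_ofReal_mul,
    Complex.sub_im, Complex.sub_re, Complex.I_im, Complex.I_re, mul_one, mul_zero, sub_zero,
    abs_mul, abs_neg, abs_par, one_mul] at hW hW'
  rcases hW with h1 | h1 <;> rcases hW' with h2 | h2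
  · exact Or.inl (Or.inl ⟨hlt _ hlow h1, hlt _ hlow' h2⟩)
  · exact Or.inl (Or.inr ⟨hlt _ hlow h1, h2⟩)
  · exact Or.inr ⟨h1, hlt _ hlow' h2⟩
  · linarith

namespace FatouCoordinates

variable {f : ℂ → ℂ} {k : ℕ} {b : ℝ} {g' ℓ ℓ' H ω Δ : ℂ → ℂ}

/-- Two adjacent Fatou coordinates that differ by a constant deep in their petals do so on the
whole intersection, by analytic continuation in the time coordinate. -/
theorem exists_onPetal_add_one_eq (T : FatouCoordinates f k b) (hk : 1 ≤ k) {m : ℤ}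
    (hm : -(k : ℤ) ≤ m) (hmk : m < k)
    (h : ∃ R C, ∀ z ∈ S k b T.r R m, T.onPetal m z = Z k b m z + Δ z + C)
    (h' : ∃ R C, ∀ z ∈ S k b T.r R (m + 1), T.onPetal (m + 1) z = Z k b (m + 1) z + Δ z + C) :
    ∃ C, ∀ z ∈ adjacentOverlap k b T.r T.R m, T.onPetal (m + 1) z = T.onPetal m z + C := by
  obtain ⟨R₁, C₁, h₁⟩ := h
  obtain ⟨R₂, C₂, h₂⟩ := h'
  have hk' : (0 : ℝ) < k := by exact_mod_cast hk
  have hp0 : 0 < Real.pi / k := div_pos Real.pi_pos hk'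
  have e1 : 3 * Real.pi / (4 * k) = 3 / 4 * (Real.pi / k) := by field_simp
  have e2 : Real.pi / (2 * k) = Real.pi / k / 2 := by field_simp
  have hj : |m| ≤ (k : ℤ) := abs_le.2 ⟨hm, hmk.le⟩
  have hj' : |m + 1| ≤ (k : ℤ) := abs_le.2 ⟨by omega, by omega⟩
  set β : ℝ := b * (Real.pi / k) with hβ
  -- the difference of the two Fatou coordinates as a function of the time coordinate of the
  -- `m`-th petal; that of the next petal is obtained by subtracting `β * I`
  set Θ : ℂ → ℂ := fun W => T.Φ (m + 1) (W - β * Complex.I) - T.Φ m W with hΘ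
  set K : ℂ := -(β * Complex.I) + (C₂ - C₁) with hK
  have hΘZ : ∀ z, z ≠ 0 → |Complex.arg (rot k (m + 1 / 2) z)| < Real.pi / (2 * k) →
      Θ (Z k b m z) = T.onPetal (m + 1) z - T.onPetal m z := fun z hz0 hz => by
    simp only [hΘ, onPetal, Z_add_one_of_mid hk b hz0 hz, hβ]
  have hdiff : DifferentiableOn ℂ Θ (stripRegion T.R (par m) β) := by
    intro W hW
    obtain ⟨hW1, hW2⟩ := stripRegion_subset hW
    have d1 : DifferentiableAt ℂ (T.Φ m) W :=
      (T.Φ_holomorphic m hj).differentiableAt ((isOpen_U T.R m).mem_nhds hW1)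
    have d2 : DifferentiableAt ℂ (T.Φ (m + 1)) (W - β * Complex.I) :=
      (T.Φ_holomorphic (m + 1) hj').differentiableAt ((isOpen_U T.R (m + 1)).mem_nhds hW2)
    exact ((DifferentiableAt.comp (g := T.Φ (m + 1)) (f := fun W => W - β * Complex.I) W d2
      (by fun_prop)).sub d1).differentiableWithinAt
  -- a point of the intersection, deep in both petals
  have hpole : ∀ᶠ z in 𝓝[≠] (0 : ℂ), 1 + (b : ℂ) * z ^ k ≠ 0 := by
    have : ContinuousAt (fun z : ℂ => 1 + (b : ℂ) * z ^ k) 0 := by fun_prop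
    exact (this.eventually_ne (by simp [zero_pow (by omega : k ≠ 0)])).filter_mono
      nhdsWithin_le_nhds
  obtain ⟨z₀, ha, hS, hz₀p, hz₀'⟩ := ((frequently_arg_rot_eq_zero k (m + 1 / 2)).and_eventually
    ((eventually_mem_S_of_sector hk b (max T.R (max R₁ R₂)) T.r_pos).and
      (hpole.and self_mem_nhdsWithin))).exists
  have hz₀ : z₀ ≠ 0 := hz₀'
  have hmid₀ : |Complex.arg (rot k (m + 1 / 2) z₀)| < Real.pi / (2 * k) := by
    rw [ha, abs_zero, e2]; linarith
  obtain ⟨a1, a2⟩ := arg_rot_of_mid hk hz₀ hmid₀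
  have hm₀ := hS m (by rw [a1, ha, e1, e2, zero_add, abs_of_pos (by linarith)]; linarith)
  have hm₀' := hS (m + 1) (by
    rw [a2, ha, e1, e2, zero_sub, abs_neg, abs_of_pos (by linarith)]; linarith)
  have hnear : ∀ᶠ z in 𝓝 z₀, Θ (Z k b m z) = K := by
    have hslit : rot k (m + 1 / 2) z₀ ∈ Complex.slitPlane := by
      rw [Complex.mem_slitPlane_iff_arg, ha]
      exact ⟨Real.pi_pos.ne, rot_ne_zero hz₀⟩
    have hcont : ContinuousAt (fun w => |Complex.arg (rot k (m + 1 / 2) w)|) z₀ := by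
      have h1 : ContinuousAt (fun w => rot k (m + 1 / 2) w) z₀ := by
        unfold rot; fun_prop
      exact ((Complex.continuousAt_arg hslit).comp h1).abs
    filter_upwards [hcont.eventually_lt_const hmid₀,
      (isOpen_S hk b T.r (max T.R (max R₁ R₂)) m).mem_nhds hm₀,
      (isOpen_S hk b T.r (max T.R (max R₁ R₂)) (m + 1)).mem_nhds hm₀'] with z b1 b2 b3
    rw [hΘZ z b2.1 b1, h₁ z (S_anti (by simp) m b2), h₂ z (S_anti (by simp) (m + 1) b3),
      Z_add_one_of_mid hk b b2.1 b1, hK, hβ]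
    ring
  have hZd : ∀ᶠ z in 𝓝 z₀, DifferentiableAt ℂ (Z k b m) z := by
    filter_upwards [(isOpen_S hk b T.r _ m).mem_nhds hm₀] with z hz
    exact (hasDerivAt_Z hk b hz.1 hz.2.2.1).differentiableAt
  have hstrict := (Complex.analyticAt_iff_eventually_differentiableAt.2 hZd).hasStrictDerivAt
  have hder : deriv (Z k b m) z₀ ≠ 0 := by
    rw [(hasDerivAt_Z hk b hz₀ hm₀.2.2.1).deriv]
    have : 1 / z₀ ^ (k + 1) + b / z₀ = (1 + b * z₀ ^ k) / z₀ ^ (k + 1) := by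
      field_simp; ring
    rw [this]
    exact div_ne_zero hz₀p (pow_ne_zero _ hz₀)
  -- the time coordinate is open at `z₀`, so the difference is constant near `Z z₀`
  have hev : Θ =ᶠ[𝓝 (Z k b m z₀)] fun _ => K := by
    rw [← hstrict.map_nhds_eq hder]
    exact hnear
  have hover₀ : z₀ ∈ adjacentOverlap k b T.r T.R m :=
    ⟨S_anti (le_max_left _ _) m hm₀, S_anti (le_max_left _ _) (m + 1) hm₀', hmid₀⟩
  have hEq := (hdiff.analyticOnNhd (isOpen_stripRegion _ _ _)).eqOn_of_preconnected_of_eventuallyEq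
    analyticOnNhd_const (isPreconnected_stripRegion T.R β (par_eq_or m))
    (Z_mem_stripRegion hk T.lt_R hover₀) hev
  refine ⟨K, fun z hz => ?_⟩
  have := hEq (Z_mem_stripRegion hk T.lt_R hz)
  rw [hΘZ z hz.1.1 hz.2.2] at this
  exact sub_eq_iff_eq_add'.1 this

/-- If `H` conjugates the prenormalized germ to the normal form, every Fatou coordinate is, up to
a constant, the time coordinate modified by the same function `timeChange k b H ω`, which
disappears from the transition functions. -/
theorem translations_of_isConjugateToNormalForm (T : FatouCoordinates f k b) (hk : 1 ≤ k)
    (hf : IsParabolicGerm f) (h : LocalDynamics k b T.g g' ℓ ℓ')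
    (hN : IsConjugateToNormalForm f k b) : T.TransitionsAreTranslations := by
  obtain ⟨φ, hφ, h₀, hh₀, hc⟩ := hN
  obtain ⟨q, hq, hqp, hpq⟩ := T.conj_p.1.exists_inverse
  have hft : Tendsto f (𝓝 0) (𝓝 0) := by
    have h1 := ContinuousAt.comp (f := fun z : ℂ => conj z) (g := fun z => f (conj z)) (x := 0)
      (by simpa using hf.antiholomorphic.continuousAt) Complex.continuous_conj.continuousAt
    simpa [Function.comp_def, ContinuousAt, hf.map_zero] using h1
  have hH : IsHolomorphicDiffeo (fun z => h₀ (q z)) := hh₀.comp hq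
  have hHc : ∀ᶠ z in 𝓝 (0 : ℂ), h₀ (q (T.g z)) = conj (φ (h₀ (q z))) := by
    filter_upwards [hpq, hq.tendsto.eventually hc, hq.tendsto.eventually T.conj_p.2,
      (hft.comp hq.tendsto).eventually hqp] with z h1 h2 h3 h4
    have h4' : q (T.p (f (q z))) = f (q z) := h4
    rw [← h2, ← h4', h3, h1]
  obtain ⟨ω, hω0, hωd, hω⟩ := hH.exists_log
  have key : ∀ j : ℤ, |j| ≤ k → ∃ R C, ∀ z ∈ S k b T.r R j,
      T.onPetal j z = Z k b j z + timeChange k b (fun z => h₀ (q z)) ω z + C := fun j hj =>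
    T.exists_onPetal_eq hk h hH hω0 hωd hω hj (h.exists_halfConjugacy hk hH hφ hHc j)
  rw [T.transitionsAreTranslations_iff]
  intro m hm hmk
  exact T.exists_onPetal_add_one_eq hk hm hmk (key m (abs_le.2 ⟨hm, hmk.le⟩))
    (key (m + 1) (abs_le.2 ⟨by omega, by omega⟩))

theorem isConjugateToNormalForm_iff (T : FatouCoordinates f k b) (hk : 1 ≤ k)
    (hf : IsParabolicGerm f) :
    IsConjugateToNormalForm f k b ↔ T.TransitionsAreTranslations := by
  obtain ⟨g', ℓ, ℓ', h⟩ := T.prenormalized.exists_localDynamics hk T.analyticAt_antiholomorphic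
  exact ⟨T.translations_of_isConjugateToNormalForm hk hf h,
    T.isConjugateToNormalForm_of_translations hk h⟩

end FatouCoordinates

/-! ### Invariance of the coefficient of order `2 k + 1` -/

/-- The derivative of a holomorphic function on a punctured neighbourhood of the origin has no
residue: it is not equivalent to `D / z` with `D ≠ 0`. Otherwise the function would vary by about
`2 π i D` along a small circle. -/
theorem eq_zero_of_tendsto_mul_deriv {P P' : ℂ → ℂ} {D : ℂ}
    (hP : ∀ᶠ z in 𝓝[≠] (0 : ℂ), HasDerivAt P (P' z) z)
    (hD : Tendsto (fun z => z * P' z) (𝓝[≠] 0) (𝓝 D)) : D = 0 := by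
  refine norm_le_zero_iff.1 (le_of_forall_pos_le_add fun ε hε => ?_)
  rw [zero_add]
  have h1 : ∀ᶠ z in 𝓝[≠] (0 : ℂ), ‖z * P' z - D‖ ≤ ε := by
    have := (tendsto_iff_norm_sub_tendsto_zero.1 hD).eventually_lt_const hε
    exact this.mono fun z hz => hz.le
  have h2 := hP.and h1
  rw [eventually_nhdsWithin_iff] at h2
  obtain ⟨ρ, hρ, hb⟩ := Metric.eventually_nhds_iff_ball.1 h2
  set r : ℝ := ρ / 2 with hr
  have hr0 : 0 < r := by positivity
  set c : ℝ → ℂ := fun θ => r * Complex.exp (θ * Complex.I) with hc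
  have hcn : ∀ θ, ‖c θ‖ = r := fun θ => by
    rw [hc]; simp only [norm_mul, Complex.norm_exp_ofReal_mul_I, Complex.norm_real]
    rw [mul_one, Real.norm_of_nonneg hr0.le]
  have hcd : ∀ θ : ℝ, HasDerivAt c (c θ * Complex.I) θ := fun θ => by
    have h3 : HasDerivAt (fun t : ℂ => (r : ℂ) * Complex.exp (t * Complex.I))
        (r * (Complex.exp (θ * Complex.I) * (1 * Complex.I))) (θ : ℂ) :=
      (((hasDerivAt_id (θ : ℂ)).mul_const Complex.I).cexp).const_mul _
    refine h3.comp_ofReal.congr_deriv ?_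
    simp only [hc]; ring
  have hcb : ∀ θ, c θ ∈ Metric.ball (0 : ℂ) ρ ∧ c θ ≠ 0 := fun θ => by
    refine ⟨?_, ?_⟩
    · rw [mem_ball_zero_iff, hcn]; exact half_lt_self hρ
    · rw [← norm_pos_iff, hcn]; exact hr0
  -- the variation along the circle of `P (c θ) - D * θ * I`
  set u : ℝ → ℂ := fun θ => P (c θ) - D * Complex.I * θ with hu
  have hud : ∀ θ : ℝ, HasDerivAt u (P' (c θ) * (c θ * Complex.I) - D * Complex.I) θ := fun θ => by
    have h3 := (hb _ (hcb θ).1 (hcb θ).2).1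
    have h4 : HasDerivAt (fun t : ℝ => D * Complex.I * (t : ℂ)) (D * Complex.I) θ := by
      have := ((hasDerivAt_id (θ : ℂ)).const_mul (D * Complex.I)).comp_ofReal
      simpa using this
    exact (h3.comp θ (hcd θ)).sub h4
  have hle := norm_image_sub_le_of_norm_deriv_le_segment' (f := u) (a := 0) (b := 2 * Real.pi)
    (C := ε) (fun θ _ => (hud θ).hasDerivWithinAt) (fun θ _ => by
      have h3 := (hb _ (hcb θ).1 (hcb θ).2).2
      have e : P' (c θ) * (c θ * Complex.I) - D * Complex.I =
          (c θ * P' (c θ) - D) * Complex.I := by ring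
      rw [e, norm_mul, Complex.norm_I, mul_one]
      exact h3) (2 * Real.pi) ⟨by positivity, le_rfl⟩
  have hper : c (2 * Real.pi) = c 0 := by
    simp only [hc]
    push_cast
    rw [Complex.exp_two_pi_mul_I]; simp
  have e : u (2 * Real.pi) - u 0 = -(D * Complex.I * (2 * Real.pi : ℝ)) := by
    simp only [hu, hper]; push_cast; ring
  rw [e, norm_neg, norm_mul, norm_mul, Complex.norm_I, mul_one, Complex.norm_real,
    Real.norm_of_nonneg (by positivity), sub_zero] at hle
  exact le_of_mul_le_mul_right hle (by positivity)

/-- Taylor's formula with a quadratic remainder, uniform in the base point. -/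
theorem exists_norm_sub_sub_le {s : ℂ → ℂ} (hs : AnalyticAt ℂ s 0) :
    ∃ C ρ : ℝ, 0 < ρ ∧ ∀ x ∈ Metric.ball (0 : ℂ) ρ, ∀ y ∈ Metric.ball (0 : ℂ) ρ,
      ‖s y - s x - deriv s x * (y - x)‖ ≤ C * ‖y - x‖ ^ 2 := by
  obtain ⟨L, t, ht, hL⟩ := (hs.deriv.contDiffAt (n := 1)).exists_lipschitzOnWith
  have h1 : ∀ᶠ x in 𝓝 (0 : ℂ), DifferentiableAt ℂ s x :=
    hs.eventually_analyticAt.mono fun x hx => hx.differentiableAt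
  obtain ⟨ρ, hρ, hb⟩ := Metric.eventually_nhds_iff_ball.1 (h1.and ht)
  refine ⟨L, ρ, hρ, fun x hx y hy => ?_⟩
  have hseg : segment ℝ x y ⊆ Metric.ball (0 : ℂ) ρ := (convex_ball _ _).segment_subset hx hy
  have h2 := (convex_segment (𝕜 := ℝ) x y).norm_image_sub_le_of_norm_hasDerivWithin_le
    (f := fun w => s w - deriv s x * w) (f' := fun w => deriv s w - deriv s x)
    (C := L * ‖y - x‖) (fun w hw => by
      have h3 := (hb w (hseg hw)).1.hasDerivAt.sub ((hasDerivAt_id w).const_mul (deriv s x))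
      rw [mul_one] at h3
      exact h3.hasDerivWithinAt) (fun w hw => by
      have h3 := hL.norm_sub_le (hb w (hseg hw)).2 (hb x hx).2
      refine h3.trans ?_
      gcongr
      exact norm_sub_le_of_mem_segment hw) (left_mem_segment ℝ x y) (right_mem_segment ℝ x y)
  have e : s y - s x - deriv s x * (y - x) = s y - deriv s x * y - (s x - deriv s x * x) := by ring
  rw [e, pow_two, ← mul_assoc]
  exact h2

/-- For `q z = z + z ^ (k + 1) + B * z ^ (2 k + 1) + o (z ^ (2 k + 1))`, the inverse `1 / (q z -
z)` of the displacement is `1 / z ^ (k + 1) - B / z + o (1 / z)`. -/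
theorem tendsto_div_sub_inv_pow {k : ℕ} (hk : 1 ≤ k) {q : ℂ → ℂ} {B : ℂ}
    (hq : (fun z => q z - (z + z ^ (k + 1) + B * z ^ (2 * k + 1))) =o[𝓝 0]
      fun z => z ^ (2 * k + 1)) :
    Tendsto (fun z => (q z - z) / z ^ (k + 1)) (𝓝[≠] 0) (𝓝 1) ∧
    Tendsto (fun z => z / (q z - z) - 1 / z ^ k) (𝓝[≠] 0) (𝓝 (-B)) := by
  have hz : Tendsto (fun z : ℂ => z) (𝓝[≠] 0) (𝓝 0) := nhdsWithin_le_nhds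
  have hzk : Tendsto (fun z : ℂ => z ^ k) (𝓝[≠] 0) (𝓝 0) := by
    have := hz.pow k
    rwa [zero_pow (by omega : k ≠ 0)] at this
  set e : ℂ → ℂ := fun z => (q z - (z + z ^ (k + 1) + B * z ^ (2 * k + 1))) / z ^ (2 * k + 1) with he
  have he0 : Tendsto e (𝓝[≠] 0) (𝓝 0) :=
    (hq.mono nhdsWithin_le_nhds).tendsto_div_nhds_zero
  have hbr : Tendsto (fun z => 1 + z ^ k * (B + e z)) (𝓝[≠] 0) (𝓝 1) := by
    have := (hzk.mul (he0.const_add B)).const_add 1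
    simpa using this
  have hqz : ∀ z : ℂ, z ≠ 0 → q z - z = z ^ (k + 1) * (1 + z ^ k * (B + e z)) := fun z hz => by
    have h1 : e z * z ^ (2 * k + 1) = q z - (z + z ^ (k + 1) + B * z ^ (2 * k + 1)) :=
      div_mul_cancel₀ _ (pow_ne_zero _ hz)
    linear_combination -h1
  constructor
  · refine hbr.congr' ?_
    filter_upwards [self_mem_nhdsWithin] with z hz
    have hz0 : z ≠ 0 := hz
    rw [hqz z hz0, mul_div_cancel_left₀ _ (pow_ne_zero _ hz0)]
  · have h1 : Tendsto (fun z => -(B + e z) / (1 + z ^ k * (B + e z))) (𝓝[≠] 0) (𝓝 (-B)) := by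
      have h2 := (he0.const_add B).neg.div hbr one_ne_zero
      rw [add_zero, div_one] at h2
      exact h2
    refine h1.congr' ?_
    filter_upwards [self_mem_nhdsWithin, hbr.eventually_ne one_ne_zero] with z hz hne
    have hz0 : z ≠ 0 := hz
    have hE : z ^ k * (B + e z) = 1 + z ^ k * (B + e z) - 1 := by ring
    have hzk0 : z ^ k ≠ 0 := pow_ne_zero k hz0
    rw [hqz z hz0, pow_succ]
    generalize 1 + z ^ k * (B + e z) = E at hE hne
    field_simp
    linear_combination -hE

/-- The coefficient of `z ^ (2 k + 1)` in a holomorphic parabolic germ `z + z ^ (k + 1) + B * z ^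
(2 k + 1) + ⋯` does not depend on the coordinate `s`: the difference of the forms `dz / z ^ (k +
1)` and `ds / s ^ (k + 1) - B₂ (ds / s - dz / z)` is exact on a punctured neighbourhood of the
origin, while comparison of the displacements `q₁ z - z` and `q₂ (s z) - s z` shows that it is
equivalent to `(B₁ - B₂) dz / z`. -/
theorem coeff_eq_of_conjugate {k : ℕ} (hk : 1 ≤ k) {q₁ q₂ s : ℂ → ℂ} {B₁ B₂ : ℂ}
    (hs : IsHolomorphicDiffeo s) (hc : ∀ᶠ z in 𝓝 (0 : ℂ), s (q₁ z) = q₂ (s z))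
    (h₁ : (fun z => q₁ z - (z + z ^ (k + 1) + B₁ * z ^ (2 * k + 1))) =o[𝓝 0]
      fun z => z ^ (2 * k + 1))
    (h₂ : (fun z => q₂ z - (z + z ^ (k + 1) + B₂ * z ^ (2 * k + 1))) =o[𝓝 0]
      fun z => z ^ (2 * k + 1)) : B₁ = B₂ := by
  have hk0 : (k : ℂ) ≠ 0 := by exact_mod_cast (by omega : k ≠ 0)
  obtain ⟨ω, hω0, hωd, hω⟩ := hs.exists_log
  set lam := deriv s 0 with hlam
  have hl0 : lam ≠ 0 := hs.deriv_ne_zero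
  have hst := hs.tendsto_punctured
  have hz : Tendsto (fun z : ℂ => z) (𝓝[≠] 0) (𝓝 0) := nhdsWithin_le_nhds
  obtain ⟨hd, hd'⟩ := tendsto_div_sub_inv_pow hk h₁
  obtain ⟨hσ, hσ'⟩ := tendsto_div_sub_inv_pow hk h₂
  have hσ := hσ.comp hst
  have hσ' := hσ'.comp hst
  have hsz : Tendsto (fun z => s z / z) (𝓝[≠] 0) (𝓝 lam) := by
    have h1 := hasDerivAt_iff_tendsto_slope.1 hs.analyticAt.differentiableAt.hasDerivAt
    refine h1.congr' ?_
    filter_upwards with z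
    rw [slope_def_field, hs.map_zero, sub_zero, sub_zero]
  have hs' : Tendsto (deriv s) (𝓝[≠] 0) (𝓝 lam) :=
    hs.analyticAt.deriv.continuousAt.tendsto.mono_left nhdsWithin_le_nhds
  have hrat : Tendsto (fun z => z * deriv s z / s z) (𝓝[≠] 0) (𝓝 1) := by
    have h1 := hs'.div hsz hl0
    rw [div_self hl0] at h1
    refine h1.congr' ?_
    filter_upwards [self_mem_nhdsWithin, (tendsto_nhdsWithin_iff.1 hst).2] with z hz hsz0
    have hz0 : z ≠ 0 := hz
    have hsz0' : s z ≠ 0 := hsz0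
    simp only [Pi.div_apply]
    field_simp
  have hsd : ∀ᶠ z in 𝓝[≠] (0 : ℂ), HasDerivAt s (deriv s z) z :=
    (hs.analyticAt.eventually_analyticAt.mono
      fun z hz => hz.differentiableAt.hasDerivAt).filter_mono nhdsWithin_le_nhds
  set P' : ℂ → ℂ := fun z => 1 / z ^ (k + 1) - deriv s z / s z ^ (k + 1) +
    B₂ * (deriv s z / s z - 1 / z) with hP'
  -- a primitive of `P'`; the logarithm of `s z / z` is single-valued
  have hPd : ∀ᶠ z in 𝓝[≠] (0 : ℂ),
      HasDerivAt (fun z => (-1 / (k * z ^ k) + 1 / (k * s z ^ k)) + B₂ * ω z) (P' z) z := by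
    filter_upwards [hsd, hωd, eventually_eventually_nhdsWithin.2 hω, self_mem_nhdsWithin,
      (tendsto_nhdsWithin_iff.1 hst).2] with z a1 a2 a3 hz hsz0
    have hz0 : z ≠ 0 := hz
    have hsz0' : s z ≠ 0 := hsz0
    rw [IsOpen.nhdsWithin_eq isOpen_compl_singleton hz] at a3
    have d1 : HasDerivAt (fun z : ℂ => -1 / ((k : ℂ) * z ^ k)) (1 / z ^ (k + 1)) z := by
      have := (((hasDerivAt_id z).pow k).const_mul (k : ℂ)).inv
        (mul_ne_zero hk0 (pow_ne_zero k hz0))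
      have h2 := this.const_mul (-1 : ℂ)
      refine HasDerivAt.congr_deriv (f := fun z : ℂ => -1 / ((k : ℂ) * z ^ k))
        (h2.congr_of_eventuallyEq (Eventually.of_forall fun w => by simp [div_eq_mul_inv])) ?_
      obtain ⟨d, rfl⟩ : ∃ d, k = d + 1 := ⟨k - 1, by omega⟩
      simp only [id, Nat.add_sub_cancel, Pi.pow_apply]
      field_simp
      ring
    have d2 : HasDerivAt (fun z : ℂ => 1 / ((k : ℂ) * s z ^ k)) (-(deriv s z / s z ^ (k + 1))) z := by
      have := ((a1.pow k).const_mul (k : ℂ)).inv (mul_ne_zero hk0 (pow_ne_zero k hsz0'))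
      refine HasDerivAt.congr_deriv (f := fun z : ℂ => 1 / ((k : ℂ) * s z ^ k))
        (this.congr_of_eventuallyEq (Eventually.of_forall fun w => by simp [div_eq_mul_inv])) ?_
      obtain ⟨d, rfl⟩ : ∃ d, k = d + 1 := ⟨k - 1, by omega⟩
      simp only [Nat.add_sub_cancel, Pi.pow_apply]
      field_simp
      ring
    have d3 : HasDerivAt ω (deriv s z / s z - 1 / z) z := by
      have b1 := a2.hasDerivAt
      have b2 : HasDerivAt (fun w => lam * w * Complex.exp (ω w))
          (lam * Complex.exp (ω z) + lam * z * (Complex.exp (ω z) * deriv ω z)) z := by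
        refine HasDerivAt.congr_deriv (f := fun w => lam * w * Complex.exp (ω w))
          (((hasDerivAt_id z).const_mul lam).mul b1.cexp) ?_
        simp only [id, mul_one]
      have b3 := a1.unique (b2.congr_of_eventuallyEq a3)
      have b4 := a3.self_of_nhds
      have b5 : deriv ω z = deriv s z / s z - 1 / z := by
        rw [b3, b4]
        have := Complex.exp_ne_zero (ω z)
        field_simp
        ring
      rwa [b5] at b1
    have := (d1.add d2).add (d3.const_mul B₂)
    rw [← sub_eq_add_neg] at this
    exact this
  -- the quadratic error in `s (q₁ z) - s z = deriv s z * (q₁ z - z)` is negligible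
  have hquad : Tendsto (fun z => z / (q₁ z - z) - z * deriv s z / (s (q₁ z) - s z)) (𝓝[≠] 0)
      (𝓝 0) := by
    obtain ⟨C, ρ, hρ, hC⟩ := exists_norm_sub_sub_le hs.analyticAt
    have hdz : Tendsto (fun z => q₁ z - z) (𝓝[≠] 0) (𝓝 0) := by
      have h1 := hd.mul (hz.pow (k + 1))
      rw [zero_pow (by omega : k + 1 ≠ 0), mul_zero] at h1
      refine h1.congr' ?_
      filter_upwards [self_mem_nhdsWithin] with z hz
      have hz0 : z ≠ 0 := hz
      rw [div_mul_cancel₀ _ (pow_ne_zero _ hz0)]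
    have hq0 : Tendsto q₁ (𝓝[≠] 0) (𝓝 0) := by
      have := hdz.add hz
      simpa using this
    have hball : Metric.ball (0 : ℂ) ρ ∈ 𝓝 (0 : ℂ) := Metric.ball_mem_nhds 0 hρ
    -- the ratio of the two increments has a finite limit
    have hratio : Tendsto (fun z => (q₁ z - z) / (s (q₁ z) - s z)) (𝓝[≠] 0)
        (𝓝 (1 / (1 * lam ^ (k + 1)))) := by
      have h1 := hd.div (hσ.mul (hsz.pow (k + 1))) (mul_ne_zero one_ne_zero (pow_ne_zero _ hl0))
      refine h1.congr' ?_
      filter_upwards [self_mem_nhdsWithin, (tendsto_nhdsWithin_iff.1 hst).2,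
        hc.filter_mono nhdsWithin_le_nhds] with z hz hsz0 hcz
      have hz0 : z ≠ 0 := hz
      have hsz0' : s z ≠ 0 := hsz0
      simp only [Function.comp_apply, hcz, Pi.div_apply]
      rw [div_pow]
      field_simp
    have hbound : Tendsto (fun z => ‖z‖ * C * ‖(q₁ z - z) / (s (q₁ z) - s z)‖) (𝓝[≠] 0) (𝓝 0) := by
      have h1 := ((tendsto_zero_iff_norm_tendsto_zero.1 hz).mul_const C).mul hratio.norm
      simpa using h1
    refine squeeze_zero_norm' ?_ hbound
    filter_upwards [hz.eventually hball, hq0.eventually hball, self_mem_nhdsWithin,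
      hd.eventually_ne one_ne_zero, hσ.eventually_ne one_ne_zero,
      hc.filter_mono nhdsWithin_le_nhds] with z b1 b2 b3 b4 b5 b6
    have hz0 : z ≠ 0 := b3
    have hne1 : q₁ z - z ≠ 0 := fun h => b4 (by rw [h, zero_div])
    have hne2 : s (q₁ z) - s z ≠ 0 := fun h => b5 (by
      simp only [Function.comp_apply]; rw [← b6, h, zero_div])
    have e1 : z / (q₁ z - z) - z * deriv s z / (s (q₁ z) - s z) =
        z * (s (q₁ z) - s z - deriv s z * (q₁ z - z)) / ((q₁ z - z) * (s (q₁ z) - s z)) := by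
      field_simp
    have h5 := hC z b1 (q₁ z) b2
    rw [e1, norm_div, norm_mul, norm_mul, norm_div]
    have n1 := norm_pos_iff.2 hne1
    have n2 := norm_pos_iff.2 hne2
    rw [div_le_iff₀ (mul_pos n1 n2)]
    calc ‖z‖ * ‖s (q₁ z) - s z - deriv s z * (q₁ z - z)‖
        ≤ ‖z‖ * (C * ‖q₁ z - z‖ ^ 2) := by gcongr
      _ = ‖z‖ * C * (‖q₁ z - z‖ / ‖s (q₁ z) - s z‖) * (‖q₁ z - z‖ * ‖s (q₁ z) - s z‖) := by
        field_simp
  have hlim : Tendsto (fun z => z * P' z) (𝓝[≠] 0) (𝓝 (-(-B₁) + 0 + 1 * (-B₂) + B₂ * (1 - 1))) := by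
    have h1 := ((hd'.neg.add hquad).add (hrat.mul hσ')).add ((hrat.sub_const 1).const_mul B₂)
    refine h1.congr' ?_
    filter_upwards [self_mem_nhdsWithin, (tendsto_nhdsWithin_iff.1 hst).2,
      hc.filter_mono nhdsWithin_le_nhds] with z hz hsz0 hcz
    have hz0 : z ≠ 0 := hz
    have hsz0' : s z ≠ 0 := hsz0
    simp only [Function.comp_apply, hcz, hP']
    have e1 : z * deriv s z / s z * (s z / (q₂ (s z) - s z) - 1 / s z ^ k) =
        z * deriv s z / (q₂ (s z) - s z) - z * deriv s z / s z ^ (k + 1) := by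
      rw [mul_sub, div_mul_div_cancel₀ hsz0', pow_succ]
      field_simp
    have e2 : z * (1 / z ^ (k + 1)) = 1 / z ^ k := by
      rw [pow_succ]; field_simp
    have e3 : z * (deriv s z / s z - 1 / z) = z * deriv s z / s z - 1 := by
      field_simp
    rw [e1]
    linear_combination -e2 - B₂ * e3
  have h0 := eq_zero_of_tendsto_mul_deriv hPd hlim
  linear_combination h0

/-! ### Truncated normal form of a real series tangent to the identity -/

section Polynomial

open Polynomial

theorem X_pow_dvd_comp {R : Type*} [CommRing R] {n : ℕ} {P y : R[X]} (hP : X ^ n ∣ P)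
    (hy : X ∣ y) : X ^ n ∣ P.comp y := by
  obtain ⟨Q, rfl⟩ := hP
  rw [mul_comp, X_pow_comp]
  exact (pow_dvd_pow_of_dvd hy n).mul_right _

theorem dvd_comp_sub_comp {R : Type*} [CommRing R] (P : R[X]) {d x y : R[X]} (h : d ∣ x - y) :
    d ∣ P.comp x - P.comp y := by
  refine h.trans ?_
  have := sub_dvd_eval_sub x y (P.map C)
  rwa [eval_map, eval_map] at this

/-- Up to terms of high order, every polynomial is a polynomial in the coordinate `X * w`. -/
theorem exists_X_pow_dvd_sub_comp {K : Type*} [Field K] {w : K[X]} (hw : w.coeff 0 ≠ 0)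
    (P : K[X]) (n : ℕ) : ∃ T : K[X], X ^ n ∣ P - T.comp (X * w) := by
  induction n with
  | zero => exact ⟨0, by simp⟩
  | succ n ih =>
    obtain ⟨T, Q, hQ⟩ := ih
    refine ⟨T + C (Q.coeff 0 / w.coeff 0 ^ n) * X ^ n, ?_⟩
    have e : P - (T + C (Q.coeff 0 / w.coeff 0 ^ n) * X ^ n).comp (X * w) =
        X ^ n * (Q - C (Q.coeff 0 / w.coeff 0 ^ n) * w ^ n) := by
      rw [add_comp, mul_comp, C_comp, X_pow_comp, mul_pow]
      linear_combination hQ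
    rw [e, pow_succ]
    refine mul_dvd_mul_left _ (X_dvd_iff.2 ?_)
    rw [coeff_sub, coeff_C_mul, coeff_zero_eq_eval_zero (w ^ n), eval_pow,
      ← coeff_zero_eq_eval_zero, div_mul_cancel₀ _ (pow_ne_zero n hw), sub_self]

/-- The order of vanishing does not depend on the coordinate `X * w`. -/
theorem X_pow_dvd_of_comp {K : Type*} [Field K] {w : K[X]} (hw : w.coeff 0 ≠ 0)
    {P : K[X]} (n : ℕ) (h : X ^ n ∣ P.comp (X * w)) : X ^ n ∣ P := by
  induction n with
  | zero => simp
  | succ n ih =>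
    obtain ⟨Q, rfl⟩ := ih ((pow_dvd_pow X n.le_succ).trans h)
    rw [mul_comp, X_pow_comp, mul_pow, mul_assoc, pow_succ] at h
    have h1 := X_dvd_iff.1 ((mul_dvd_mul_iff_left (pow_ne_zero n X_ne_zero)).1 h)
    rw [coeff_zero_eq_eval_zero, eval_mul, eval_pow, eval_comp, eval_mul, eval_X, zero_mul,
      ← coeff_zero_eq_eval_zero, ← coeff_zero_eq_eval_zero] at h1
    rw [pow_succ]
    exact mul_dvd_mul_left _ (X_dvd_iff.2 ((mul_eq_zero.1 h1).resolve_left (pow_ne_zero n hw)))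

/-- One step of the normalization: the coordinate `X + c * X ^ (m + 1)`, with
`c = 2 e / (k - m)`, removes the term `e * X ^ (k + 1 + m)`. -/
theorem exists_normalizing_step {k m : ℕ} (hm : 1 ≤ m) (hmk : m < k) (N : ℕ)
    (hN : k + 2 + m ≤ N) {T : ℝ[X]}
    (hT : X ^ (k + 1 + m) ∣ T - (X + C (1 / 2) * X ^ (k + 1))) :
    ∃ c : ℝ, ∃ T' : ℝ[X], X ^ N ∣ (X * (1 + C c * X ^ m) : ℝ[X]).comp T -
        T'.comp (X * (1 + C c * X ^ m)) ∧
      X ^ (k + 2 + m) ∣ T' - (X + C (1 / 2) * X ^ (k + 1)) := by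
  obtain ⟨Q, hQ⟩ := hT
  obtain ⟨Q', hQ'⟩ : X ∣ Q - C (Q.coeff 0) := X_dvd_iff.2 (by simp)
  set e := Q.coeff 0 with he
  have hkm : (k : ℝ) - m ≠ 0 := sub_ne_zero.2 (by exact_mod_cast hmk.ne')
  set c : ℝ := 2 * e / (k - m) with hc
  have hce : e + c * (m + 1) * (1 / 2) - 1 / 2 * (k + 1) * c = 0 := by
    rw [hc]; field_simp; ring
  have hCe : (C e + C c * ((m : ℝ[X]) + 1) * C (1 / 2) - C (1 / 2) * ((k : ℝ[X]) + 1) * C c : ℝ[X]) = 0 := by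
    have := congrArg (C : ℝ → ℝ[X]) hce
    simpa only [map_sub, map_add, map_mul, map_natCast, map_one, map_zero] using this
  have hw : (1 + C c * X ^ m : ℝ[X]).coeff 0 ≠ 0 := by
    rw [coeff_zero_eq_eval_zero]
    simp only [eval_add, eval_one, eval_mul, eval_C, eval_pow, eval_X]
    rw [zero_pow (by omega), mul_zero, add_zero]
    exact one_ne_zero
  obtain ⟨T', hT'⟩ := exists_X_pow_dvd_sub_comp hw ((X * (1 + C c * X ^ m) : ℝ[X]).comp T) N
  refine ⟨c, T', hT', X_pow_dvd_of_comp hw _ ?_⟩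
  rw [sub_comp, add_comp, X_comp, mul_comp, C_comp, X_pow_comp]
  have h1 := (pow_dvd_pow X hN).trans hT'
  -- it suffices to compare the leading terms after composition with the new coordinate
  suffices h2 : (X : ℝ[X]) ^ (k + 2 + m) ∣ (X * (1 + C c * X ^ m) : ℝ[X]).comp T -
      (X * (1 + C c * X ^ m) + C (1 / 2) * (X * (1 + C c * X ^ m)) ^ (k + 1)) by
    have h3 := dvd_sub h2 h1
    rwa [sub_sub_sub_cancel_left] at h3
  obtain ⟨p, rfl⟩ : ∃ p, m = p + 1 := ⟨m - 1, by omega⟩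
  obtain ⟨q, rfl⟩ : ∃ q, k = q + 1 := ⟨k - 1, by omega⟩
  obtain ⟨s, hs⟩ := powAddExpansion (1 : ℝ[X]) (X ^ (q + 1) * (C (1 / 2) + X ^ (p + 1) * Q)) (p + 2)
  obtain ⟨s', hs'⟩ := powAddExpansion (1 : ℝ[X]) (C c * X ^ (p + 1)) (q + 2)
  have hT1 : T = X * (1 + X ^ (q + 1) * (C (1 / 2) + X ^ (p + 1) * Q)) := by
    linear_combination hQ
  have e1 : (X * (1 + C c * X ^ (p + 1)) : ℝ[X]).comp T = T + C c * T ^ (p + 2) := by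
    simp only [mul_comp, add_comp, X_comp, one_comp, C_comp, X_pow_comp]; ring
  have e2 : T ^ (p + 2) = X ^ (p + 2) *
      (1 + X ^ (q + 1) * (C (1 / 2) + X ^ (p + 1) * Q)) ^ (p + 2) := by
    rw [hT1, mul_pow]
  rw [e1, e2, hs, mul_pow X (1 + C c * X ^ (p + 1)), hs']
  refine ⟨Q' + C c * ((p : ℝ[X]) + 2) * X ^ p * Q + C c * X ^ q * (C (1 / 2) + X ^ (p + 1) * Q) ^ 2 * s -
    C (1 / 2) * C c ^ 2 * X ^ p * s', ?_⟩
  push_cast at hCe ⊢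
  simp only [one_pow]
  linear_combination hQ + X ^ (q + p + 3) * hQ' + X ^ (q + p + 3) * hCe

/-- A real polynomial `X + a * X ^ (k + 1) + ⋯`, with `a > 0` if `k` is even, is conjugate, up to
terms of high order, to `X + X ^ (k + 1) / 2 + B * X ^ (2 k + 1)` by a real polynomial. -/
theorem exists_normalizing_polynomial {k : ℕ} (hk : 1 ≤ k) {A Q : ℝ[X]} {a : ℝ} (ha : a ≠ 0)
    (hpos : Even k → 0 < a) (hA : A = X + C a * X ^ (k + 1) + X ^ (k + 2) * Q) :
    ∃ w : ℝ[X], w.coeff 0 ≠ 0 ∧ ∃ B : ℝ, X ^ (2 * k + 2) ∣ (X * w).comp A -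
      (X + C (1 / 2) * X ^ (k + 1) + C B * X ^ (2 * k + 1)).comp (X * w) := by
  have hk0 : k ≠ 0 := by omega
  -- the terms between the orders `k + 1` and `2 k + 1` are removed one by one
  have key : ∀ i, i < k → ∃ w T : ℝ[X], w.coeff 0 ≠ 0 ∧
      X ^ (2 * k + 2) ∣ (X * w).comp A - T.comp (X * w) ∧
      X ^ (k + 2 + i) ∣ T - (X + C (1 / 2) * X ^ (k + 1)) := by
    intro i
    induction i with
    | zero =>
      intro _
      -- the linear coordinate `l * X`, where `l ^ k = 2 * a`
      obtain ⟨l, hl⟩ : ∃ l : ℝ, l ^ k = 2 * a := by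
        rcases Nat.even_or_odd k with he | ho
        · exact ⟨(2 * a) ^ ((k : ℝ)⁻¹), Real.rpow_inv_natCast_pow (by linarith [hpos he]) hk0⟩
        · rcases lt_or_gt_of_ne ha with h | h
          · refine ⟨-(-(2 * a)) ^ ((k : ℝ)⁻¹), ?_⟩
            rw [ho.neg_pow, Real.rpow_inv_natCast_pow (by linarith) hk0, neg_neg]
          · exact ⟨(2 * a) ^ ((k : ℝ)⁻¹), Real.rpow_inv_natCast_pow (by linarith) hk0⟩
      have hl0 : l ≠ 0 := by
        rintro rfl
        rw [zero_pow hk0] at hl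
        exact ha (by linarith)
      have hCl : (C l * C l⁻¹ : ℝ[X]) = 1 := by rw [← C_mul, mul_inv_cancel₀ hl0, C_1]
      have hCa : (C a * C l⁻¹ ^ k : ℝ[X]) = C (1 / 2) := by
        rw [← C_pow, ← C_mul, inv_pow, hl]
        congr 1
        field_simp
      refine ⟨C l, C l * A.comp (C l⁻¹ * X), by simpa using hl0, ?_, C l⁻¹ ^ (k + 1) * C l *
        Q.comp (C l⁻¹ * X) * C l⁻¹, ?_⟩
      · have e : (C l⁻¹ * (X * C l) : ℝ[X]) = X := by linear_combination X * hCl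
        have e2 : (X * C l).comp A - (C l * A.comp (C l⁻¹ * X)).comp (X * C l) = 0 := by
          rw [mul_comp, mul_comp, comp_assoc, mul_comp, C_comp, C_comp, C_comp, X_comp, X_comp, e,
            comp_X]
          ring
        rw [e2]
        exact dvd_zero _
      · rw [hA]
        simp only [add_comp, mul_comp, X_comp, C_comp, X_pow_comp, mul_pow]
        linear_combination (X + C a * C l⁻¹ ^ k * X ^ (k + 1)) * hCl + X ^ (k + 1) * hCa
    | succ i ih =>
      intro hi
      obtain ⟨w, T, hw, h1, h2⟩ := ih (by omega)
      have h2' : X ^ (k + 1 + (i + 1)) ∣ T - (X + C (1 / 2) * X ^ (k + 1)) := by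
        rwa [show k + 1 + (i + 1) = k + 2 + i by ring]
      obtain ⟨c, T', h3, h4⟩ := exists_normalizing_step (by omega) hi (2 * k + 2) (by omega) h2'
      have e : (X * (1 + C c * X ^ (i + 1)) : ℝ[X]).comp (X * w) =
          X * (w * (1 + C c * (X * w) ^ (i + 1))) := by
        simp only [mul_comp, add_comp, X_comp, one_comp, C_comp, X_pow_comp]; ring
      refine ⟨w * (1 + C c * (X * w) ^ (i + 1)), T', ?_, ?_, h4⟩
      · rw [coeff_zero_eq_eval_zero] at hw ⊢
        simpa using hw
      · rw [← e, comp_assoc, ← comp_assoc T']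
        have h5 := dvd_comp_sub_comp (X * (1 + C c * X ^ (i + 1))) h1
        have h6 := X_pow_dvd_comp h3 (dvd_mul_right X w)
        have h7 := dvd_add h5 h6
        rw [sub_comp, comp_assoc _ T, sub_add_sub_cancel] at h7
        exact h7
  obtain ⟨w, T, hw, h1, Q', hQ'⟩ := key (k - 1) (by omega)
  rw [show k + 2 + (k - 1) = 2 * k + 1 by omega] at hQ'
  refine ⟨w, hw, Q'.coeff 0, ?_⟩
  have h2 : X ^ (2 * k + 2) ∣ T - (X + C (1 / 2) * X ^ (k + 1) + C (Q'.coeff 0) * X ^ (2 * k + 1)) := by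
    obtain ⟨Q'', hQ''⟩ : X ∣ Q' - C (Q'.coeff 0) := X_dvd_iff.2 (by simp)
    exact ⟨Q'', by linear_combination hQ' + X ^ (2 * k + 1) * hQ''⟩
  have h3 := X_pow_dvd_comp h2 (dvd_mul_right X w)
  have h4 := dvd_add h1 h3
  rw [sub_comp, sub_add_sub_cancel] at h4
  exact h4

end Polynomial

/-! ### From the formal normal form to an analytic prenormalization -/

section Truncation

open Polynomial

/-- Truncations are compatible with the substitution of formal power series. -/
theorem X_pow_dvd_subst_sub_coe_comp {R : Type*} [CommRing R] {n : ℕ} {P a : PowerSeries R}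
    {p q : R[X]} (hP : PowerSeries.X ^ n ∣ P - (p : PowerSeries R))
    (ha : PowerSeries.X ^ n ∣ a - (q : PowerSeries R)) (ha0 : PowerSeries.constantCoeff a = 0) :
    PowerSeries.X ^ n ∣ PowerSeries.subst a P - ((p.comp q : R[X]) : PowerSeries R) := by
  have hs : PowerSeries.HasSubst a := PowerSeries.HasSubst.of_constantCoeff_zero' ha0
  have h1 : PowerSeries.X ^ n ∣ PowerSeries.subst a P - aeval a p := by
    obtain ⟨Q, hQ⟩ := hP
    rw [← PowerSeries.subst_coe hs p, ← PowerSeries.subst_sub hs, hQ, PowerSeries.subst_mul hs,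
      PowerSeries.subst_pow hs, PowerSeries.subst_X hs]
    exact (pow_dvd_pow_of_dvd (PowerSeries.X_dvd_iff.2 ha0) n).mul_right _
  have h2 : PowerSeries.X ^ n ∣ aeval a p - aeval (q : PowerSeries R) p := by
    refine ha.trans ?_
    have := sub_dvd_eval_sub a (q : PowerSeries R) (p.map (algebraMap R (PowerSeries R)))
    rwa [eval_map_algebraMap, eval_map_algebraMap] at this
  have h3 : aeval (q : PowerSeries R) p = ((p.comp q : R[X]) : PowerSeries R) := by
    have e := hom_eval₂ p C (coeToPowerSeries.ringHom (R := R)) q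
    have e' : (coeToPowerSeries.ringHom (R := R)).comp C = algebraMap R (PowerSeries R) := by
      ext x
      simp
    rw [e'] at e
    exact e.symm
  rw [← h3]
  have := dvd_add h1 h2
  rwa [sub_add_sub_cancel] at this

theorem X_pow_dvd_sub_trunc {R : Type*} [CommRing R] (n : ℕ) (P : PowerSeries R) :
    PowerSeries.X ^ n ∣ P - (PowerSeries.trunc n P : PowerSeries R) := by
  rw [PowerSeries.X_pow_dvd_iff]
  intro m hm
  rw [map_sub, coeff_coe, PowerSeries.coeff_trunc, if_pos hm, sub_self]

theorem X_pow_dvd_of_coe {R : Type*} [CommRing R] {n : ℕ} {p : R[X]}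
    (h : PowerSeries.X ^ n ∣ (p : PowerSeries R)) : X ^ n ∣ p := by
  rw [X_pow_dvd_iff]
  intro d hd
  have := PowerSeries.X_pow_dvd_iff.1 h d hd
  rwa [coeff_coe] at this

theorem map_trunc {R S : Type*} [CommRing R] [CommRing S] (φ : R →+* S) (n : ℕ)
    (P : PowerSeries R) : (PowerSeries.trunc n P).map φ =
      PowerSeries.trunc n (PowerSeries.map φ P) := by
  ext m
  simp only [coeff_map, PowerSeries.coeff_trunc, PowerSeries.coeff_map]
  split_ifs <;> simp

theorem map_conj_map_ofReal (h : ℝ[X]) :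
    (h.map Complex.ofRealHom).map (starRingEnd ℂ) = h.map Complex.ofRealHom := by
  rw [Polynomial.map_map]
  congr 1
  ext x
  simp

/-- If `f` has a real formal form with suitable first nonlinear term, a polynomial change of
coordinate brings it, up to terms of high order, to the polynomial
`w + w ^ (k + 1) / 2 + B * w ^ (2 k + 1)` in the conjugate variable `w`. -/
theorem exists_polynomial_conjugation {f : ℂ → ℂ} {k : ℕ} {A : PowerSeries ℝ}
    (hf0 : f 0 = 0) (hA : IsRealFormalForm f A) (hk : FirstNonlinear A k)
    (hpos : Even k → 0 < PowerSeries.coeff (k + 1) A) :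
    ∃ P : ℂ[X], P.coeff 0 = 0 ∧ P.coeff 1 ≠ 0 ∧ ∃ B : ℝ, X ^ (2 * k + 2) ∣
      P.comp (PowerSeries.trunc (2 * k + 2) (conjSeries f)) -
        ((X + C (1 / 2) * X ^ (k + 1) + C B * X ^ (2 * k + 1) : ℝ[X]).map
          Complex.ofRealHom).comp (P.map (starRingEnd ℂ)) := by
  obtain ⟨hk1, hk2, hk3⟩ := hk
  have hk0 : k ≠ 0 := by omega
  obtain ⟨hA0, hA1, H, hH0, hH1, hH⟩ := hA
  set N := 2 * k + 2 with hN
  have hcoef : ∀ (R : Type) [CommRing R] (S : PowerSeries R) (m : ℕ), m < N →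
      (PowerSeries.trunc N S).coeff m = PowerSeries.coeff m S := fun R _ S m hm => by
    rw [PowerSeries.coeff_trunc, if_pos hm]
  have hF0 : PowerSeries.constantCoeff (conjSeries f) = 0 := by
    rw [← PowerSeries.coeff_zero_eq_constantCoeff_apply, conjSeries, PowerSeries.coeff_mk]
    simp [hf0]
  have hH0' : PowerSeries.constantCoeff (PowerSeries.map (starRingEnd ℂ) H) = 0 := by
    rw [← PowerSeries.coeff_zero_eq_constantCoeff_apply, PowerSeries.coeff_map, hH0, map_zero]
  -- the truncated form of the formal conjugation
  set HN := PowerSeries.trunc N H with hHN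
  set FN := PowerSeries.trunc N (conjSeries f) with hFN
  set AN := PowerSeries.trunc N A with hAN
  have h1 : X ^ N ∣ HN.comp FN - (AN.map Complex.ofRealHom).comp (HN.map (starRingEnd ℂ)) := by
    refine X_pow_dvd_of_coe ?_
    have e1 := X_pow_dvd_subst_sub_coe_comp (X_pow_dvd_sub_trunc N H)
      (X_pow_dvd_sub_trunc N (conjSeries f)) hF0
    have e2 := X_pow_dvd_subst_sub_coe_comp
      (X_pow_dvd_sub_trunc N (PowerSeries.map Complex.ofRealHom A))
      (X_pow_dvd_sub_trunc N (PowerSeries.map (starRingEnd ℂ) H)) hH0'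
    rw [← map_trunc, ← map_trunc, ← hH] at e2
    have e3 := dvd_sub e2 e1
    rw [sub_sub_sub_cancel_left] at e3
    rwa [coe_sub]
  -- the real normal form
  obtain ⟨Q, hQ⟩ : X ^ (k + 2) ∣ AN - (X + C (PowerSeries.coeff (k + 1) A) * X ^ (k + 1)) := by
    rw [X_pow_dvd_iff]
    intro d hd
    rw [coeff_sub, coeff_add, coeff_C_mul, coeff_X_pow, coeff_X, hcoef _ _ _ (by omega)]
    rcases Nat.lt_or_ge d 2 with h | h
    · interval_cases d
      · rw [hA0]; simp
      · rw [hA1]; simp [hk0]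
    · rcases Nat.lt_or_ge k d with h' | h'
      · obtain rfl : d = k + 1 := by omega
        simp [hk0]
      · rw [hk2 d h h', if_neg (by omega), if_neg (by omega)]
        simp
  obtain ⟨w, hw, B, hB⟩ := exists_normalizing_polynomial hk1 hk3 hpos
    (sub_eq_iff_eq_add'.1 hQ)
  set T : ℝ[X] := X + C (1 / 2) * X ^ (k + 1) + C B * X ^ (2 * k + 1) with hT
  set h := X * w with hh
  have h2 : X ^ N ∣ ((h.comp AN).map Complex.ofRealHom) - (T.comp h).map Complex.ofRealHom := by
    have := (mapRingHom Complex.ofRealHom).map_dvd hB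
    simpa using this
  refine ⟨(h.map Complex.ofRealHom).comp HN, ?_, ?_, B, ?_⟩
  · rw [coeff_zero_eq_eval_zero, eval_comp, ← coeff_zero_eq_eval_zero HN, hcoef _ _ _ (by omega),
      hH0, hh]
    simp
  · have e1 : ((h.map Complex.ofRealHom).comp HN).coeff 1 =
        ((h.map Complex.ofRealHom).comp HN).derivative.eval 0 := by
      rw [← coeff_zero_eq_eval_zero, coeff_derivative]; simp
    have e2 : HN.derivative.eval 0 = PowerSeries.coeff 1 H := by
      rw [← coeff_zero_eq_eval_zero, coeff_derivative, hcoef _ _ _ (by omega)]; simp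
    rw [e1, derivative_comp, eval_mul, e2, eval_comp, ← coeff_zero_eq_eval_zero HN,
      hcoef _ _ _ (by omega), hH0]
    refine mul_ne_zero hH1 ?_
    rw [← coeff_zero_eq_eval_zero, coeff_derivative, coeff_map, hh, coeff_X_mul]
    simpa using hw
  · have e1 := dvd_comp_sub_comp (h.map Complex.ofRealHom) h1
    have hX : X ∣ HN.map (starRingEnd ℂ) := by
      rw [X_dvd_iff, coeff_map, hcoef _ _ _ (by omega), hH0, map_zero]
    have e2 := X_pow_dvd_comp h2 hX
    rw [map_comp, map_comp, sub_comp] at e2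
    have e3 := dvd_add e1 e2
    rw [← comp_assoc, ← comp_assoc, sub_add_sub_cancel] at e3
    rw [map_comp, map_conj_map_ofReal, ← comp_assoc]
    exact e3

end Truncation

open Polynomial in
theorem isBigO_eval_of_X_pow_dvd {P : ℂ[X]} {n : ℕ} (h : X ^ n ∣ P) :
    (fun z => P.eval z) =O[𝓝 (0 : ℂ)] fun z => z ^ n := by
  obtain ⟨Q, rfl⟩ := h
  have h1 : (fun z => Q.eval z) =O[𝓝 (0 : ℂ)] fun _ => (1 : ℂ) :=
    Q.continuous.continuousAt.isBigO_one ℂ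
  have h2 := (isBigO_refl (fun z : ℂ => z ^ n) (𝓝 0)).mul h1
  simpa using h2

theorem isBigO_comp_sub_comp {φ u v w : ℂ → ℂ} (hφ : AnalyticAt ℂ φ 0)
    (hu : Tendsto u (𝓝 0) (𝓝 0)) (hv : Tendsto v (𝓝 0) (𝓝 0))
    (h : (fun z => u z - v z) =O[𝓝 0] w) :
    (fun z => φ (u z) - φ (v z)) =O[𝓝 (0 : ℂ)] w := by
  have h1 := hφ.hasStrictDerivAt.hasStrictFDerivAt.isBigO_sub
  exact (h1.comp_tendsto (hu.prodMk_nhds hv)).trans h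

theorem tendsto_conj_zero : Tendsto (fun z : ℂ => conj z) (𝓝 0) (𝓝 0) := by
  simpa using Complex.continuous_conj.tendsto 0

theorem isBigO_conj_pow {e : ℂ → ℂ} {n : ℕ} (h : e =O[𝓝 (0 : ℂ)] fun z => z ^ n) :
    (fun z => e (conj z)) =O[𝓝 (0 : ℂ)] fun z => z ^ n := by
  refine (h.comp_tendsto tendsto_conj_zero).trans (IsBigO.of_bound 1 (Eventually.of_forall fun z => ?_))
  simp

theorem conj_isBigO {e w : ℂ → ℂ} (h : e =O[𝓝 (0 : ℂ)] w) :
    (fun z => conj (e z)) =O[𝓝 (0 : ℂ)] w := by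
  refine IsBigO.trans (IsBigO.of_bound 1 (Eventually.of_forall fun z => ?_)) h
  simp

open Polynomial in
/-- The Taylor polynomials of `w ↦ f (conj w)` are the truncations of `conjSeries f`. -/
theorem isBigO_sub_eval_trunc {f : ℂ → ℂ} (hf : AnalyticAt ℂ (fun z => f (conj z)) 0) (n : ℕ) :
    (fun z => f (conj z) - (PowerSeries.trunc n (conjSeries f)).eval z) =O[𝓝 0]
      fun z => z ^ n := by
  obtain ⟨F, hF, h⟩ := hf.exists_eventuallyEq_sum_add_pow_mul n
  have h1 : F =O[𝓝 (0 : ℂ)] fun _ => (1 : ℂ) := hF.continuousAt.isBigO_one ℂ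
  have h2 := (isBigO_refl (fun z : ℂ => z ^ n) (𝓝 0)).mul h1
  simp only [mul_one] at h2
  refine h2.congr' ?_ EventuallyEq.rfl
  filter_upwards [h] with z hz
  have e : (PowerSeries.trunc n (conjSeries f)).eval z =
      ∑ i ∈ Finset.range n, (z ^ i / i.factorial) • iteratedDeriv i (fun z => f (conj z)) 0 := by
    rw [eval, PowerSeries.eval₂_trunc_eq_sum_range]
    refine Finset.sum_congr rfl fun i _ => ?_
    rw [conjSeries, PowerSeries.coeff_mk, RingHom.id_apply, smul_eq_mul]
    ring
  rw [hz, e]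
  simp

open Polynomial in
theorem eval_map_conj (P : ℂ[X]) (z : ℂ) :
    (P.map (starRingEnd ℂ)).eval (conj z) = conj (P.eval z) := by
  rw [eval_map, eval₂_at_apply]

open Polynomial in
theorem conj_eval_map_ofReal (P : ℝ[X]) (z : ℂ) :
    conj ((P.map Complex.ofRealHom).eval z) = (P.map Complex.ofRealHom).eval (conj z) := by
  rw [← eval_map_conj, map_conj_map_ofReal]

open Polynomial in
theorem isHolomorphicDiffeo_eval {P : ℂ[X]} (h0 : P.coeff 0 = 0) (h1 : P.coeff 1 ≠ 0) :
    IsHolomorphicDiffeo fun z => P.eval z := by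
  refine ⟨P.differentiable.analyticAt 0, by rw [← coeff_zero_eq_eval_zero, h0], ?_⟩
  rw [P.deriv, ← coeff_zero_eq_eval_zero, coeff_derivative]
  simpa using h1

open Polynomial in
/-- The square of `X + X ^ (k + 1) / 2 + B * X ^ (2 k + 1)` for the composition. -/
theorem X_pow_dvd_comp_self_sub {k : ℕ} (hk : 1 ≤ k) (B : ℝ) :
    X ^ (2 * k + 2) ∣ (X + C (1 / 2) * X ^ (k + 1) + C B * X ^ (2 * k + 1) : ℝ[X]).comp
        (X + C (1 / 2) * X ^ (k + 1) + C B * X ^ (2 * k + 1)) -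
      (X + X ^ (k + 1) + C (2 * B + (k + 1) / 4) * X ^ (2 * k + 1)) := by
  obtain ⟨q, rfl⟩ : ∃ q, k = q + 1 := ⟨k - 1, by omega⟩
  set v : ℝ[X] := C (1 / 2) + C B * X ^ (q + 1) with hv
  obtain ⟨s, hs⟩ := powAddExpansion (1 : ℝ[X]) (X ^ (q + 1) * v) (q + 2)
  obtain ⟨s', hs'⟩ := powAddExpansion (1 : ℝ[X]) (X ^ (q + 1) * v) (2 * q + 3)
  have hT : (X + C (1 / 2) * X ^ (q + 1 + 1) + C B * X ^ (2 * (q + 1) + 1) : ℝ[X]) =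
      X * (1 + X ^ (q + 1) * v) := by
    rw [hv]; ring
  have hC : (C (2 * B + ((q + 1 : ℕ) + 1) / 4) : ℝ[X]) =
      2 * C B + ((q : ℝ[X]) + 2) * C (1 / 2) * C (1 / 2) := by
    have : (2 * B + ((q + 1 : ℕ) + 1) / 4 : ℝ) = 2 * B + ((q : ℝ) + 2) * (1 / 2) * (1 / 2) := by
      push_cast; ring
    rw [this]
    simp only [map_add, map_mul, map_natCast, map_ofNat]
  have hC2 : (C (1 / 2) + C (1 / 2) : ℝ[X]) = 1 := by
    rw [← C_add, ← C_1]; norm_num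
  rw [hC]
  have e : (X + C (1 / 2) * X ^ (q + 1 + 1) + C B * X ^ (2 * (q + 1) + 1) : ℝ[X]).comp
      (X + C (1 / 2) * X ^ (q + 1 + 1) + C B * X ^ (2 * (q + 1) + 1)) =
      X * (1 + X ^ (q + 1) * v) + C (1 / 2) * (X ^ (q + 2) * (1 + X ^ (q + 1) * v) ^ (q + 2)) +
        C B * (X ^ (2 * q + 3) * (1 + X ^ (q + 1) * v) ^ (2 * q + 3)) := by
    rw [hT]
    nth_rw 1 [← hT]
    simp only [mul_comp, add_comp, X_comp, C_comp, X_pow_comp, mul_pow]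
    ring
  rw [e, hs, hs']
  refine ⟨C (1 / 2) * (((q : ℝ[X]) + 2) * C B * X ^ q + X ^ q * v ^ 2 * s) +
    C B * X ^ q * ((2 * (q : ℝ[X]) + 3) * v + s' * X ^ (q + 1) * v ^ 2), ?_⟩
  push_cast
  simp only [one_pow]
  rw [hv]
  linear_combination X ^ (q + 2) * hC2

/-- In codimension `k` (and positive type if `k` is even), the germ `f` has an analytic
prenormalization. A polynomial change of coordinate brings `f` to `conj z + conj z ^ (k + 1) / 2 +
B * conj z ^ (2 k + 1) + ⋯` with `B` real, and the formal invariant, read on the second iterate,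
determines `B`. -/
theorem exists_isPrenormalized {f : ℂ → ℂ} {k : ℕ} {b : ℝ} (hf : IsParabolicGerm f)
    (hcod : HasCodimension f k) (hpos : Even k → IsPositiveType f k)
    (hb : HasFormalInvariant f k b) :
    ∃ p g : ℂ → ℂ, Conjugates p f g ∧ IsPrenormalized g k b ∧
      AnalyticAt ℂ (fun z => g (conj z)) 0 := by
  obtain ⟨A, hA, hAk, hApos⟩ : ∃ A, IsRealFormalForm f A ∧ FirstNonlinear A k ∧
      (Even k → 0 < PowerSeries.coeff (k + 1) A) := by
    by_cases he : Even k
    · obtain ⟨A, h1, h2, h3⟩ := hpos he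
      exact ⟨A, h1, h2, fun _ => h3⟩
    · obtain ⟨A, h1, h2⟩ := hcod
      exact ⟨A, h1, h2, fun h => absurd h he⟩
  have hk : 1 ≤ k := hAk.1
  obtain ⟨P, hP0, hP1, B, hPB⟩ := exists_polynomial_conjugation hf.map_zero hA hAk hApos
  set N := 2 * k + 2 with hN
  set T : Polynomial ℝ := .X + .C (1 / 2) * .X ^ (k + 1) + .C B * .X ^ (2 * k + 1) with hT
  set τ : ℂ → ℂ := fun z => (T.map Complex.ofRealHom).eval z with hτ
  have hτe : ∀ z, τ z = z + 1 / 2 * z ^ (k + 1) + B * z ^ (2 * k + 1) := fun z => by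
    simp [hτ, hT]
  have hτa : AnalyticAt ℂ τ 0 := (T.map Complex.ofRealHom).differentiable.analyticAt 0
  have hτc : ∀ z, conj (τ z) = τ (conj z) := conj_eval_map_ofReal T
  set F : ℂ → ℂ := fun z => f (conj z) with hF
  have hFa : AnalyticAt ℂ F 0 := hf.antiholomorphic
  have hF0 : F 0 = 0 := by simp [hF, hf.map_zero]
  have hFt : Tendsto F (𝓝 0) (𝓝 0) := by
    have := hFa.continuousAt.tendsto
    rwa [hF0] at this
  have hft : Tendsto f (𝓝 0) (𝓝 0) := by
    have := hFt.comp tendsto_conj_zero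
    refine this.congr fun z => ?_
    simp [hF]
  have hPd := isHolomorphicDiffeo_eval hP0 hP1
  set π : ℂ → ℂ := fun z => P.eval z with hπ
  obtain ⟨q, hq, hqπ, hπq⟩ := hPd.exists_inverse
  -- `π ∘ f = τ ∘ conj ∘ π` up to terms of high order
  have h1 : (fun z => π (f z) - τ (conj (π z))) =O[𝓝 0] fun z => z ^ N := by
    have a1 := isBigO_comp_sub_comp hPd.analyticAt hFt
      (v := fun z => (PowerSeries.trunc N (conjSeries f)).eval z) (by
        have a2 := isBigO_sub_eval_trunc hf.antiholomorphic N
        have a3 : Tendsto (fun z : ℂ => z ^ N) (𝓝 0) (𝓝 0) := by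
          have := (continuous_pow N).tendsto (0 : ℂ)
          rwa [zero_pow (by omega)] at this
        have a4 := hFt.sub (a2.trans_tendsto a3)
        simpa [hF] using a4) (isBigO_sub_eval_trunc hf.antiholomorphic N)
    have a2 := isBigO_eval_of_X_pow_dvd hPB
    have a3 := isBigO_conj_pow (a1.add a2)
    refine a3.congr_left fun z => ?_
    simp only [hF, hπ, hτ, Polynomial.eval_sub, Polynomial.eval_comp, Complex.conj_conj,
      eval_map_conj]
    ring
  set g : ℂ → ℂ := fun z => π (f (q z)) with hg
  have hqO : (fun z => q z ^ N) =O[𝓝 0] fun z => z ^ N := by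
    have := hq.analyticAt.differentiableAt.isBigO_sub
    simp only [hq.map_zero, sub_zero] at this
    exact this.pow N
  have h2 : (fun z => g z - τ (conj z)) =O[𝓝 0] fun z => z ^ N := by
    refine IsBigO.congr' ((h1.comp_tendsto hq.tendsto).trans hqO) ?_ EventuallyEq.rfl
    filter_upwards [hπq] with z hz
    simp only [Function.comp_apply, hg, hz]
  have hgt : Tendsto g (𝓝 0) (𝓝 0) := hPd.tendsto.comp (hft.comp hq.tendsto)
  have hlin : ∀ u : ℂ → ℂ, AnalyticAt ℂ u 0 → u 0 = 0 → u =O[𝓝 0] fun z => z := fun u hu hu0 => by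
    simpa only [hu0, sub_zero] using hu.differentiableAt.isBigO_sub
  have hgO : (fun z => g z ^ N) =O[𝓝 0] fun z => z ^ N := by
    have a1 := (hlin F hFa hF0).comp_tendsto (tendsto_conj_zero.comp hq.tendsto)
    have a2 : (fun z => f (q z)) =O[𝓝 0] fun z => z := by
      refine ((a1.congr_left fun z => ?_).trans
        (IsBigO.of_bound 1 (Eventually.of_forall fun z => ?_))).trans
        (hlin q hq.analyticAt hq.map_zero)
      · simp [hF]
      · simp
    exact (((hlin π hPd.analyticAt hPd.map_zero).comp_tendsto (hft.comp hq.tendsto)).trans a2).pow N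
  have hτt : Tendsto τ (𝓝 0) (𝓝 0) := by
    have := hτa.continuousAt.tendsto
    rwa [hτe 0, zero_pow (by omega), zero_pow (by omega), mul_zero, mul_zero, add_zero,
      add_zero] at this
  have hττ : (fun z => g (g z) - τ (τ z)) =O[𝓝 0] fun z => z ^ N := by
    have a1 := (h2.comp_tendsto hgt).trans hgO
    have a2 := isBigO_comp_sub_comp hτa (tendsto_conj_zero.comp hgt) hτt
      (w := fun z => z ^ N) ((conj_isBigO h2).congr_left fun z => by
        simp only [Function.comp_apply, map_sub, hτc, Complex.conj_conj])
    refine (a1.add a2).congr_left fun z => ?_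
    simp
  have ho : (fun z : ℂ => z ^ N) =o[𝓝 0] fun z => z ^ (2 * k + 1) := isLittleO_pow_pow (by omega)
  have hgg : (fun z => g (g z) - (z + z ^ (k + 1) + (2 * B + (k + 1) / 4 : ℂ) * z ^ (2 * k + 1)))
      =o[𝓝 0] fun z => z ^ (2 * k + 1) := by
    have a1 := map_dvd (Polynomial.mapRingHom Complex.ofRealHom) (X_pow_dvd_comp_self_sub hk B)
    rw [map_pow, Polynomial.coe_mapRingHom, Polynomial.map_X] at a1
    refine ((hττ.add (isBigO_eval_of_X_pow_dvd a1)).trans_isLittleO ho).congr_left fun z => ?_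
    rw [Polynomial.map_sub, Polynomial.map_comp, Polynomial.eval_sub, Polynomial.eval_comp]
    simp [hτ, hT]
  -- comparison with the formal invariant
  obtain ⟨h, G, ⟨hh, hconj⟩, hG⟩ := hb
  have hcoef := coeff_eq_of_conjugate hk (hh.comp hq) (q₁ := fun z => g (g z)) (q₂ := G) (by
    filter_upwards [hq.tendsto.eventually hconj, hq.tendsto.eventually (hft.eventually hqπ),
      hq.tendsto.eventually (hft.eventually (hft.eventually hqπ))] with z b1 b2 b3
    simp only [hg]
    rw [b2, b3, b1]) hgg hG
  have hB : (B : ℂ) = ((k : ℂ) + 1) / 8 - b / 2 := by linear_combination hcoef / 2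
  refine ⟨π, g, ⟨hPd, ?_⟩, ?_, ?_⟩
  · filter_upwards [hqπ] with z hz
    simp only [hg, hz]
  · refine (h2.trans_isLittleO ho).congr_left fun z => ?_
    rw [hτe, hB]
  · have a1 : AnalyticAt ℂ (fun z => conj (q (conj z))) 0 := by
      rw [Complex.analyticAt_iff_eventually_differentiableAt]
      have a2 := Complex.analyticAt_iff_eventually_differentiableAt.1 hq.analyticAt
      filter_upwards [tendsto_conj_zero.eventually a2] with z hz
      have := hz.conj_conj
      rwa [Complex.conj_conj] at this
    have a2 : AnalyticAt ℂ F (conj (q (conj 0))) := by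
      rw [map_zero, hq.map_zero, map_zero]; exact hFa
    have a3 := a2.comp (f := fun z => conj (q (conj z))) a1
    have a4 : (F ∘ fun z => conj (q (conj z))) = fun z => f (q (conj z)) := by
      ext z; simp [hF]
    rw [a4] at a3
    have a5 : AnalyticAt ℂ π (f (q (conj 0))) := by
      rw [map_zero, hq.map_zero, hf.map_zero]; exact hPd.analyticAt
    exact a5.comp (f := fun z => f (q (conj z))) a3

end AntiParabolic

theorem mainTheorem2 (k : ℕ) (b : ℝ) (f : ℂ → ℂ)
    (hf : AntiParabolic.IsParabolicGerm f)
    (hk : AntiParabolic.HasCodimension f k)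
    (hpos : Even k → AntiParabolic.IsPositiveType f k)
    (hb : AntiParabolic.HasFormalInvariant f k b) :
    Nonempty (AntiParabolic.FatouCoordinates f k b) ∧
    ∀ T : AntiParabolic.FatouCoordinates f k b,
      AntiParabolic.IsConjugateToNormalForm f k b ↔ T.TransitionsAreTranslations := by
  have hk1 : 1 ≤ k := by
    obtain ⟨A, -, hA⟩ := hk
    exact hA.1
  refine ⟨?_, fun T => T.isConjugateToNormalForm_iff hk1 hf⟩
  obtain ⟨p, g, hp, hpre, ha⟩ := AntiParabolic.exists_isPrenormalized hf hk hpos hb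
  obtain ⟨g', l, l', hL⟩ := hpre.exists_localDynamics hk1 ha
  exact hL.nonempty_fatouCoordinates hk1 hp hpre
    (Complex.analyticAt_iff_eventually_differentiableAt.1 ha)
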